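/- **Setting.** Let $R$ be a reduced crystallographic root system spanning a real vector space $V$, let $\hat R$ be its coroots (linear forms on $V$), $\hat R_+$ the positive ones for a fixed base, $W$ the Weyl group, and $(\cdot,\cdot)$ the canonical $W$-invariant inner product of $V$. Let $\hat R'\subset\hat R$ be the maximal proper standard Levi subsystem obtained by deleting one simple coroot $\hat\alpha_k$, $\hat R'_\pm=\hat R'\cap\hat R_\pm$, and $W'$ its Weyl group. **Pole spaces.** For an affine subspace $L\subset V$, nonempty throughout, let $\hat P_L$, $\hat Z_L$, $\hat R_L$ be the sets of coroots which are on $L$ identically $1$, identically $0$, constant, respectively. Put $\hat R_\Omega=\hat R_+\cup\hat R'_-$. $L$ is an *$\Omega$-pole space* if $L=\{\hat\alpha=1\ \forall\hat\alpha\in\hat P_L\cap\hat R_\Omega\}$ and $|\hat P_L\cap\hat R_\Omega|\ge|\hat Z_L\cap\hat R_\Omega|+\operatorname{codim}L$; a *pole space* is a $W$-translate of an $\Omega$-pole space. $L$ is *residual* if $|\hat P_L|\ge|\hat Z_L|+\operatorname{codim}L$. A pole space $L$ is *standard* if $\hat R_L$ is a standard Levi subsystem whose positive elements are $\ge0$ on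 $L$; $(L_0,x)$ is a *standard pair representing* $L$ if $L_0$ is standard, $x\in W$ and $L=x(L_0)$. A pole space $H$ is *regular* if $\hat Z_H=\emptyset$. A *$w$-good regular envelope* of $L$ is a regular pole space $H\supset L$ with $w(\hat P_H)\subset\hat R_+\cup\hat R'$. **Affine functions.** $c_L$ is the point of $L$ orthogonal to the direction $V^L$ of $L$. For a complex-valued affine function $X$ on $L$ (equivalently on its complexification $L_{\mathbb C}$) put $\nabla_X=X-X(c_L)$; write $\nabla_{\hat\alpha}$ for $X=\hat\alpha|_L$. A nonconstant $X$ has *positive gradient* if $\nabla_X>0$ on $\{p\in L:\hat\alpha(p)>\hat\alpha(c_L)\ \forall\hat\alpha\in\hat R_+\setminus\hat R_L\}$. Write $X\sim Y$ if $Y\in\{X,1-X\}$. **Denominators.** Let $c=\prod_{\hat\alpha\in\hat R_+}\frac{\hat\alpha+1}{\hat\alpha}$, $c'=\prod_{\hat\alpha\in\hat R'_+}\frac{\hat\alpha+1}{\hat\alpha}$, and, for an entire function $\rho\not\equiv0$ with $\rho(z)=\rho(1-z)$, $r(\lambda)=\prod_{\hat\alpha\in\hat R_+}\rho(\hat\alpha(\lambda))$.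 For entire $\varphi$ on $V_{\mathbb C}$ and $x\in W$ put $$\Sigma(\varphi)(\lambda)=\sum_{w\in W}c(-w\lambda)\frac{r(\lambda)}{r(w\lambda)}\varphi(-w\lambda),\quad \Sigma_\tau(\varphi)(\lambda)=\Sigma(\varphi)(-\lambda),\quad \Sigma'_{x}(\varphi)(\lambda)=\sum_{w\in W'x}c'(w\lambda)\frac{r(w\lambda)}{r(\lambda)}\varphi(w\lambda).$$ For $A\in\{\Sigma,\Sigma_\tau,\Sigma'_x\}$ and a pole space $H$, $\mathrm{Den}_{nc}(H,A)$ is the least multiset $D$ of $\sim$-classes of nonconstant affine functions on $H$ such that $\prod_{X\in D}\rho(X)\cdot A(\varphi)|_{H_{\mathbb C}}$ is entire for all entire $\varphi$ and all $\rho$ as above which do not vanish at $\hat\alpha(H)$ and $1-\hat\alpha(H)$ for every $\hat\alpha\in S_A$ constant on $H$; here $S_\Sigma=-\hat R_+$ and $S_{\Sigma_\tau}=S_{\Sigma'_x}=\hat R_+$. It is viewed as a set with multiplicities of affine functions, invariant under $X\mapsto1-X$. All sets below are counted with multiplicity; intersections are minima of multiplicities, inclusions are inequalities of multiplicities, and multiplicities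 add up under restriction and under images of maps. For standard $L$ and $x\in W$, the set $\mathrm{Den}^\sim(L,x,\Sigma)_+$, resp. $\mathrm{Den}^\sim(L,x,\Sigma')_+$, consists of the elements with positive gradient on $L$ of $$\bigcap_{H}\ \mathrm{Den}_{nc}(H,\Sigma)|_L,\qquad\text{resp.}\qquad \bigcap_{H}\ \mathrm{Den}_{nc}(H,\Sigma'_x)|_L,$$ where $H$ runs over the $x$-good regular envelopes of $L$ and only the elements not constant on $L$ are kept. Moreover $$\mathrm{Den}^\sim(L,x,\Sigma_\tau)_+=\bigcap_{H}\ \big((w_H^{-1})^*\,\mathrm{Den}_{nc}(H_0,\Sigma_\tau)_+\big)\big|_L ,$$ where $H$ runs over the same set, $H=w_H(H_0)$ with $H_0$ standard and $w_H$ in the Weyl group $W(\hat R_L)$ of $\hat R_L$, the subscript $+$ selects the elements with positive gradient on $H_0$, and again only the elements not constant on $L$ are kept (if there are several choices of $(w_H,H_0)$, the intersection is over all of them). For $L$ standard and residual let $w_L$ be the longest element of $W(\hat R_L)$ and $\tau_L=-w_L$, which preserves $L$; put $(1-\tau_L)(X)=1-X\circ\tau_L$ for affine $X$ on $L$. For standard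 $L_0,L_1$, $w\in W$ with $w(L_1)=L_0$, and $X=\nabla_{\hat\alpha}+c$ on $L_1$ ($\hat\alpha\in\hat R$, $c\in\mathbb C$) with positive gradient, put $|w|(X)=w(\nabla_{\hat\alpha})+c$ if $w(\hat\alpha)\in\hat R_+$ and $|w|(X)=-w(\nabla_{\hat\alpha})+c$ otherwise, where $w(\nabla_{\hat\alpha})=\nabla_{\hat\alpha}\circ w^{-1}=\nabla_{w(\hat\alpha)}$ on $L_0$. **Cascades.** Let $V'\subset V$ be the span of $R'$, $\varpi$ the fundamental weight with $\hat\alpha_k(\varpi)=1$ that is zero on the other simple coroots, and $L^{\mathrm{temp}}=c_L+\sqrt{-1}\,V^L$. A *cascade* $C$ consists of: a finite set of pairs $(\sigma,L)$ with $L$ an $\Omega$-pole space (which is said to *appear* in $C$) and $\sigma=[a,e]\subset L$ a directed segment; a set $\mathrm{Std}(C)$ of pairs $(L_0,d)$ with $L_0$ standard, $d$ of minimal length in $W'd$, and $d(L_0)$ an $\Omega$-pole space which is $W'$-conjugate to one appearing in $C$, such that for every $L$ appearing in $C$ there is exactly one $(L_0,d)\in\mathrm{Std}(C)$ with $L\in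 W'd(L_0)$; and for each $L$ appearing in $C$ a choice of a standard pair $(L_0,w)$ representing it with $w\in W'd$, $(L_0,d)\in\mathrm{Std}(C)$ — the set of the chosen pairs is $\mathrm{SP}(C)$. They satisfy: 1. (First generation.) There is a set of representatives $L'\subset V'$, standard for $\hat R'$, of the $W'$-orbits of the residual spaces of $R'$ in $V'$, such that for each of them and $L=L'+\mathbb R\varpi$ the pair $([p_\infty,c_L],L)$ belongs to $C$, where $p_\infty=c_L+t\varpi$ for some $t\gg0$ depending on $L$ (so large that $\hat\alpha(p_\infty)>1$ for $\hat\alpha\in\hat R_+\setminus\hat R'_+$); moreover $(L,1)\in\mathrm{Std}(C)$ and $(L,1)$ is the pair chosen for $L$. 2. If $(\sigma,L)\in C$ and $M\subset L$ is an $\Omega$-pole space of codimension one in $L$ with $M\cap\sigma\neq\emptyset$, then for some $u\in W'$ there is $(\sigma',uM)\in C$ where $\sigma'$ starts at the point $u(\sigma)\cap uM$. 3. Every $(\tau,M)\in C$ not of the first generation arises so: there are $(\sigma,L)\in C$ and $u\in W'$ such that $M$ has codimension one in $uL$ and $\tau$ starts at $u(\sigma)\cap M$. 4. Let $T$ be the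 union of the sets $u(L^{\mathrm{temp}})$ over $u\in W'$ and the residual $L$ appearing in $C$. If $([a,e],M)\in C$ and $M^{\mathrm{temp}}\subset T$, then $e=c_M$; otherwise there are $u\in W'$ and a segment $\sigma'$ starting at $u(e)$ with $(\sigma',uM)\in C$. **Theorem.** Let $C$ be a cascade with the following *$\tau$-invariance*: for all $(L_0,x)\in\mathrm{Std}(C)$ with $L_0$ residual, $$\mathrm{Den}^\sim(L_0,x,\Sigma_\tau)_+=(1-\tau_{L_0})\big(\mathrm{Den}^\sim(L_0,x,\Sigma)_+\big).$$ Let $L$ be a residual pole space appearing in $C$, represented by $(L_0,x)\in\mathrm{SP}(C)$, and let $(L_1,y)$ be any standard pair representing $L$. (a) Let $w=x^{-1}y$, so that $w(L_1)=L_0$. Every element of $\mathrm{Den}^\sim(L_1,y,\Sigma)_+$ is of the form $\nabla_{\hat\alpha}+c$ with $\hat\alpha\in\hat R$, $c\in\mathbb C$, and $$\mathrm{Den}^\sim(L_0,x,\Sigma)_+=|w|\,\mathrm{Den}^\sim(L_1,y,\Sigma)_+ .$$ (b) $\mathrm{Den}^\sim(L_1,y,\Sigma_\tau)_+=(1-\tau_{L_1})\big(\mathrm{Den}^\sim(L_1,y,\Sigma)_+\big)$.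 (c) For every standard pair $(L_1,x)$ representing $L$: $\ \mathrm{Den}^\sim(L_1,x,\Sigma')_+\subset(1-\tau_{L_1})\big(\mathrm{Den}^\sim(L_1,x,\Sigma)_+\big)$. -/

import Mathlib

open scoped Pointwise

noncomputable section

namespace EnvDen

variable {ι V N : Type*} [Fintype ι] [AddCommGroup V] [Module ℝ V] [AddCommGroup N] [Module ℝ N]
  (P : RootPairing ι ℝ V N) [P.IsRootSystem] [P.IsCrystallographic] [P.IsReduced]
  (b : P.Base) (k : ι)

/-! ### The Levi subsystem, pole spaces, standard and good spaces

`P` is a root system in `V`, the index `i : ι` stands for the root `P.root i` and for the coroot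
`P.coroot i`, seen as the linear form `P.coroot' i` on `V`.  The base `b` fixes the positive
system, and the index `k` of a simple root fixes the maximal proper standard Levi subsystem `R'`
with base `b.support \ {k}`.  The Weyl group `P.weylGroup` acts on `V` and on `ι`. -/

/-- `i` belongs to the maximal standard Levi subsystem `R'` obtained by deleting the simple root
`k`. -/
def IsLevi (i : ι) : Prop :=
  P.coroot i ∈ Submodule.span ℝ (P.coroot '' {j | j ∈ b.support ∧ j ≠ k})

/-- The Weyl group `W'` of `R'`. -/
def leviWeyl : Subgroup P.weylGroup :=
  Subgroup.closure {s | ∃ i, IsLevi P b k i ∧ s = RootPairing.weylGroup.ofIdx P i}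

/-- The length of a Weyl group element: the number of positive coroots it makes negative. -/
def length (w : P.weylGroup) : ℕ := Set.ncard {i | b.IsPos i ∧ ¬ b.IsPos (w • i)}

/-- `w` is of minimal length in its coset `W' w`. -/
def IsMinimalRep (w : P.weylGroup) : Prop :=
  ∀ u ∈ leviWeyl P b k, length P b w ≤ length P b (u * w)

/-- The coroots equal to `1` on `L`. -/
def poleSet (L : AffineSubspace ℝ V) : Set ι := {i | ∀ p ∈ L, P.coroot' i p = 1}

/-- The coroots vanishing on `L`. -/
def zeroSet (L : AffineSubspace ℝ V) : Set ι := {i | ∀ p ∈ L, P.coroot' i p = 0}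

/-- The coroots which are constant on `L`. -/
def constSet (L : AffineSubspace ℝ V) : Set ι := {i | ∃ c : ℝ, ∀ p ∈ L, P.coroot' i p = c}

/-- The codimension of `L` in `V`. -/
def codim (L : AffineSubspace ℝ V) : ℕ := Module.finrank ℝ V - Module.finrank ℝ L.direction

/-- The index set `R₊ ∪ R'₋` of the form
`Ω = ∏_{α ∈ R'₊} α/(α+1) · ∏_{α ∈ R₊} α/(α-1) dλ`. -/
def omegaSet : Set ι := {i | b.IsPos i ∨ (IsLevi P b k i ∧ ¬ b.IsPos i)}

/-- `Ω`-pole spaces. -/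
def IsOmegaPole (L : AffineSubspace ℝ V) : Prop :=
  (L : Set V).Nonempty ∧
  (zeroSet P L ∩ omegaSet P b k).ncard + codim L ≤ (poleSet P L ∩ omegaSet P b k).ncard ∧
  (L : Set V) = {p | ∀ i ∈ poleSet P L ∩ omegaSet P b k, P.coroot' i p = 1}

/-- Pole spaces: the translates under the Weyl group of the `Ω`-pole spaces. -/
def IsPole (L : AffineSubspace ℝ V) : Prop :=
  ∃ w : P.weylGroup, ∃ M, IsOmegaPole P b k M ∧ L = w • M

/-- Residual spaces. -/
def IsResidual (L : AffineSubspace ℝ V) : Prop :=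
  (L : Set V).Nonempty ∧ (zeroSet P L).ncard + codim L ≤ (poleSet P L).ncard

/-- Standard pole spaces: the coroots constant on `L` form a standard Levi subsystem, and the
positive ones among them are nonnegative on `L`. -/
def IsStandard (L : AffineSubspace ℝ V) : Prop :=
  IsPole P b k L ∧
  (∃ J ⊆ (b.support : Set ι),
    constSet P L = {i | P.coroot i ∈ Submodule.span ℝ (P.coroot '' J)}) ∧
  ∀ i ∈ constSet P L, b.IsPos i → ∀ p ∈ L, 0 ≤ P.coroot' i p

/-- `(L₀, x)` is a standard pair representing `L`. -/
def IsStandardPair (L₀ : AffineSubspace ℝ V) (x : P.weylGroup) (L : AffineSubspace ℝ V) : Prop :=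
  IsStandard P b k L₀ ∧ x • L₀ = L

/-- Regular pole spaces: no coroot vanishes identically on them. -/
def IsRegular (H : AffineSubspace ℝ V) : Prop := IsPole P b k H ∧ zeroSet P H = ∅

/-- `H` is a `w`-good regular envelope of `L`. -/
def IsGoodEnvelope (L : AffineSubspace ℝ V) (w : P.weylGroup) (H : AffineSubspace ℝ V) : Prop :=
  L ≤ H ∧ IsRegular P b k H ∧ ∀ i ∈ poleSet P H, b.IsPos (w • i) ∨ IsLevi P b k (w • i)

/-- The Weyl group of the Levi subsystem of the coroots constant on `L`; it is the subgroup
generated by the simple reflections in it when `L` is standard. -/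
def fixWeyl (L : AffineSubspace ℝ V) : Subgroup P.weylGroup :=
  Subgroup.closure {s | ∃ i ∈ constSet P L, s = RootPairing.weylGroup.ofIdx P i}

/-- `w` is a longest element of the Weyl group of the coroots constant on `L`. -/
def IsLongest (L : AffineSubspace ℝ V) (w : P.weylGroup) : Prop :=
  w ∈ fixWeyl P L ∧ ∀ v ∈ fixWeyl P L, length P b v ≤ length P b w

/-- The longest element `w_L` (it is unique when `L` is standard). -/
def longest (L : AffineSubspace ℝ V) : P.weylGroup := Classical.epsilon (IsLongest P b L)

/-- The map `τ_L = - w_L`. -/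
def tau (L : AffineSubspace ℝ V) (v : V) : V := -(longest P b L • v)

/-- `c` is the centre of `L`: the point of `L` orthogonal to the direction of `L` for the canonical
Weyl group invariant inner product of `V`. -/
def IsCenter (L : AffineSubspace ℝ V) (c : V) : Prop :=
  c ∈ L ∧ ∀ v ∈ L.direction, P.RootForm c v = 0

/-- The centre `c_L` of a nonempty affine subspace. -/
def center (L : AffineSubspace ℝ V) : V := Classical.epsilon (IsCenter P L)

/-! ### Affine functions on an affine subspace

Affine functions on the complexification of `L` are determined by their restrictions to `L`, and
these are the real affine maps from `L` to `ℂ`. -/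

/-- The extension by zero of a function on `L`. -/
def ext {L : AffineSubspace ℝ V} (X : L → ℂ) (v : V) : ℂ :=
  open Classical in if h : v ∈ L then X ⟨v, h⟩ else 0

/-- Restriction to `L` of a function on a larger space `H`. -/
def restr {H : AffineSubspace ℝ V} (L : AffineSubspace ℝ V) (X : H → ℂ) : L → ℂ :=
  fun p => ext X (p : V)

/-- The restriction to `L` of a coroot. -/
def corootOn (L : AffineSubspace ℝ V) (i : ι) : L → ℂ := fun p => ((P.coroot' i (p : V) : ℝ) : ℂ)

/-- The set `Aff*(L)` of nonconstant affine functions on `L`. -/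
def IsAffStar {L : AffineSubspace ℝ V} (X : L → ℂ) : Prop :=
  (∃ A : V →ᵃ[ℝ] ℂ, ∀ p : L, X p = A (p : V)) ∧ ¬ ∃ c : ℂ, ∀ p, X p = c

/-- The equivalence `X ∼ Y` if `X ∈ {Y, 1 - Y}`. -/
def AffEquiv {L : AffineSubspace ℝ V} (X Y : L → ℂ) : Prop := X = Y ∨ X = 1 - Y

/-- The gradient `∇_X` of `X` on `L`. -/
def grad {L : AffineSubspace ℝ V} (X : L → ℂ) : L → ℂ := fun p => X p - ext X (center P L)

/-- The positive cone `L⁺` of `L`. -/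
def posCone (L : AffineSubspace ℝ V) : Set L :=
  {x | ∀ i, b.IsPos i → i ∉ constSet P L → P.coroot' i (center P L) < P.coroot' i (x : V)}

/-- The set `Aff₊*(L)` of nonconstant affine functions on `L` with positive gradient. -/
def IsPosAff {L : AffineSubspace ℝ V} (X : L → ℂ) : Prop :=
  IsAffStar X ∧ ∀ x ∈ posCone P b L, 0 < (grad P X x).re ∧ (grad P X x).im = 0

/-! ### Complex points and holomorphic functions

The complexification of `V` is modelled by `V × V`, where `(x, y)` stands for `x + √-1 y`. -/

/-- The complexification of `L`. -/
def cpts (L : AffineSubspace ℝ V) : Set (V × V) := {l | l.1 ∈ L ∧ l.2 ∈ L.direction}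

/-- The value of a coroot at a complex point. -/
def ccoroot (i : ι) (l : V × V) : ℂ :=
  ((P.coroot' i l.1 : ℝ) : ℂ) + Complex.I * ((P.coroot' i l.2 : ℝ) : ℂ)

/-- The value of an affine function on `L` at a point of the complexification of `L`. -/
def cval {L : AffineSubspace ℝ V} (X : L → ℂ) (l : V × V) : ℂ :=
  ext X l.1 + Complex.I * (ext X (l.2 + l.1) - ext X l.1)

/-- `F` is holomorphic on the complexification of `L`: it is holomorphic in the coordinates
`z` of the points `p + ∑ j, z j • u j`, for `p ∈ L` and `u j` in the direction of `L`. -/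
def HolOn (L : AffineSubspace ℝ V) (F : V × V → ℂ) : Prop :=
  ∀ p ∈ L, ∀ (n : ℕ) (u : Fin n → V), (∀ j, u j ∈ L.direction) →
    Differentiable ℂ
      (fun z : Fin n → ℂ => F (p + ∑ j, (z j).re • u j, ∑ j, (z j).im • u j))

/-! ### The meromorphic functions -/

open Classical in
/-- `c(λ) = ∏ (α(λ) + 1) / α(λ)` over the positive coroots `α` in `S`. -/
def cFun (S : Set ι) (l : V × V) : ℂ :=
  ∏ i with b.IsPos i ∧ i ∈ S, (ccoroot P i l + 1) / ccoroot P i l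

open Classical in
/-- `r(λ) = ∏ ρ(α(λ))` over the positive coroots. -/
def rFun (ρ : ℂ → ℂ) (l : V × V) : ℂ := ∏ i with b.IsPos i, ρ (ccoroot P i l)

/-- `Σ_W(φ)(λ) = ∑_{w ∈ W} c(-wλ) r(λ)/r(wλ) φ(-wλ)`. -/
def sigma (ρ : ℂ → ℂ) (φ : V × V → ℂ) (l : V × V) : ℂ :=
  ∑ᶠ w : P.weylGroup,
    cFun P b Set.univ (-(w • l)) * (rFun P b ρ l / rFun P b ρ (w • l)) * φ (-(w • l))

/-- `Σ_{W,τ}(φ) = Σ_W(φ) ∘ (-id)`. -/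
def sigmaTau (ρ : ℂ → ℂ) (φ : V × V → ℂ) (l : V × V) : ℂ := sigma P b ρ φ (-l)

/-- `Σ'_{W'x}(ψ)(λ) = ∑_{w ∈ W'x} c'(wλ) r(wλ)/r(λ) ψ(wλ)`, with `c'` the function `c` of `R'`. -/
def sigmaPrime (x : P.weylGroup) (ρ : ℂ → ℂ) (ψ : V × V → ℂ) (l : V × V) : ℂ :=
  ∑ᶠ u : leviWeyl P b k,
    cFun P b {i | IsLevi P b k i} (((u : P.weylGroup) * x) • l) *
      (rFun P b ρ (((u : P.weylGroup) * x) • l) / rFun P b ρ l) *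
      ψ (((u : P.weylGroup) * x) • l)

/-! ### Denominators -/

/-- For a function `f` given by a formula valid where no `α` and no `ρ(α)` vanishes, and which is
meromorphic on the complexification of `V`: the product of `g` with the restriction of `f` to the
complexification of `L` is defined and is holomorphic there.  Here `f` is written as a quotient
`A / B` of entire functions with `B` not vanishing identically on `L`. -/
def RestrictionHol (ρ : ℂ → ℂ) (f : V × V → ℂ) (L : AffineSubspace ℝ V) (g : V × V → ℂ) : Prop :=
  ∃ A B : V × V → ℂ, HolOn ⊤ A ∧ HolOn ⊤ B ∧ (∃ l ∈ cpts L, B l ≠ 0) ∧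
    (∀ l, (∀ i, ccoroot P i l ≠ 0 ∧ ρ (ccoroot P i l) ≠ 0) → A l = B l * f l) ∧
    ∃ G : V × V → ℂ, HolOn L G ∧ ∀ l ∈ cpts L, G l * B l = g l * A l

/-- Let `F ρ φ` be a family of meromorphic functions, and `S` the set of coroots `α` for which
`ρ(α)` occurs in the denominator of `F ρ φ`.  The multiset `T` of nonconstant affine functions on
`L` clears denominators if `∏_{X ∈ T} ρ(X) · F ρ φ` is entire on `L`, for all entire `φ` and all
nonzero entire `ρ` with `ρ(z) = ρ(1 - z)` which do not vanish at the constants `α(L)`, `1 - α(L)`,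
where `α ∈ S` is constant on `L`. -/
def Clears (F : (ℂ → ℂ) → (V × V → ℂ) → V × V → ℂ) (S : Set ι) (L : AffineSubspace ℝ V)
    (T : Multiset (L → ℂ)) : Prop :=
  (∀ X ∈ T, IsAffStar X) ∧
  ∀ ρ : ℂ → ℂ, Differentiable ℂ ρ → ρ ≠ 0 → (∀ z, ρ z = ρ (1 - z)) →
    (∀ i ∈ S, ∀ c : ℝ, (∀ p ∈ L, P.coroot' i p = c) → ρ c ≠ 0 ∧ ρ (1 - c) ≠ 0) →
    ∀ φ : V × V → ℂ, HolOn ⊤ φ →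
      RestrictionHol P ρ (F ρ φ) L (fun l => (T.map fun X => ρ (cval X l)).prod)

open Classical in
/-- The multiplicity in `T` of the class of `ν` for `∼`. -/
def multClass {L : AffineSubspace ℝ V} (T : Multiset (L → ℂ)) (ν : L → ℂ) : ℕ :=
  T.countP fun X => AffEquiv X ν

/-- `D` is a multiset of representatives of the denominators (no cancellation) of the family `F` on
`L`: it is the smallest multiset, up to `∼`, which clears denominators. -/
def IsDen (F : (ℂ → ℂ) → (V × V → ℂ) → V × V → ℂ) (S : Set ι) (L : AffineSubspace ℝ V)
    (D : Multiset (L → ℂ)) : Prop :=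
  Clears P F S L D ∧ ∀ T, Clears P F S L T → ∀ ν, multClass D ν ≤ multClass T ν

/-- `D` represents `Den_nc(L, Σ)`. -/
def IsDenSigma (L : AffineSubspace ℝ V) (D : Multiset (L → ℂ)) : Prop :=
  IsDen P (sigma P b) {i | ¬ b.IsPos i} L D

/-- `D` represents `Den_nc(L, Σ_τ)`. -/
def IsDenSigmaTau (L : AffineSubspace ℝ V) (D : Multiset (L → ℂ)) : Prop :=
  IsDen P (sigmaTau P b) {i | b.IsPos i} L D

/-- `D` represents `Den_nc(L, x, Σ')`. -/
def IsDenSigmaPrime (x : P.weylGroup) (L : AffineSubspace ℝ V) (D : Multiset (L → ℂ)) : Prop :=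
  IsDen P (sigmaPrime P b k x) {i | b.IsPos i} L D

/-! ### Enveloping denominators

Sets counted with multiplicities are encoded by their multiplicity functions. -/

open Classical in
/-- The multiplicity of (the class of) `ν` in the intersection over the `x`-good regular envelopes
`H` of `L` of the restrictions to `L` of the elements of the multiset of denominators on `H`
described by `IsD`. -/
def envMult (IsD : (H : AffineSubspace ℝ V) → Multiset (H → ℂ) → Prop)
    (L : AffineSubspace ℝ V) (x : P.weylGroup) (ν : L → ℂ) : ℕ∞ :=
  ⨅ (H : AffineSubspace ℝ V) (_ : IsGoodEnvelope P b k L x H) (D : Multiset (H → ℂ)) (_ : IsD H D),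
    (D.countP (fun X => AffEquiv (restr L X) ν) : ℕ∞)

open Classical in
/-- The set `Den~(L, x, Σ)₊` of enveloping denominators. -/
def denEnv (L : AffineSubspace ℝ V) (x : P.weylGroup) (ν : L → ℂ) : ℕ∞ :=
  if IsPosAff P b ν then envMult P b k (IsDenSigma P b) L x ν else 0

open Classical in
/-- The set `Den~(L, x, Σ')₊` of enveloping denominators. -/
def denEnvPrime (L : AffineSubspace ℝ V) (x : P.weylGroup) (ν : L → ℂ) : ℕ∞ :=
  if IsPosAff P b ν then envMult P b k (IsDenSigmaPrime P b k x) L x ν else 0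

open Classical in
/-- The set `Den~(L, x, Σ_τ)₊`: the intersection over the `x`-good regular envelopes `H` of the
standard space `L` of the restrictions to `L` of the pull backs by `w_H⁻¹` of the denominators of
`Σ_τ` with positive gradient on `H₀`, nonconstant on `L`; here `H = w_H(H₀)` with `H₀` standard and
`w_H` in the Weyl group of the coroots constant on `L`. -/
def denEnvTau (L : AffineSubspace ℝ V) (x : P.weylGroup) (ν : L → ℂ) : ℕ∞ :=
  if IsAffStar ν then
    ⨅ (H : AffineSubspace ℝ V) (_ : IsGoodEnvelope P b k L x H)
      (wH : P.weylGroup) (_ : wH ∈ fixWeyl P L)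
      (H₀ : AffineSubspace ℝ V) (_ : IsStandardPair P b k H₀ wH H)
      (D : Multiset (H₀ → ℂ)) (_ : IsDenSigmaTau P b H₀ D),
      (D.countP (fun X => ∃ Y, AffEquiv Y X ∧ IsPosAff P b Y ∧
        ∀ p : L, ν p = ext Y (wH⁻¹ • (p : V))) : ℕ∞)
  else 0

/-- The image under a map `f` of a set counted with multiplicities. -/
def image {α β : Type*} (f : α → β) (m : α → ℕ∞) (y : β) : ℕ∞ := ∑' x : {x // f x = y}, m x

/-- The map `(1 - τ_L)(X) = 1 - τ_L(X)` on affine functions on `L`. -/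
def oneSubTau (L : AffineSubspace ℝ V) (X : L → ℂ) : L → ℂ :=
  fun p => 1 - ext X (tau P b L (p : V))

/-- `X = ∇_α + c` on `L`, for the coroot `α` with index `i`. -/
def IsCorootForm {L : AffineSubspace ℝ V} (X : L → ℂ) (i : ι) (c : ℂ) : Prop :=
  ∀ p, X p = grad P (corootOn P L i) p + c

open Classical in
/-- The map `|w| : Aff(L₁) → Aff(L₀)`, for `w(L₁) = L₀`: the function `∇_α + c` is sent to
`w(∇_α) + c` if `w(α)` is positive, and to `-w(∇_α) + c` otherwise. -/
def absMap (w : P.weylGroup) (L₁ L₀ : AffineSubspace ℝ V) (X : L₁ → ℂ) : L₀ → ℂ := fun p =>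
  (if ∃ i c, IsCorootForm P X i c ∧ b.IsPos (w • i) then 1 else -1) *
    ext (grad P X) (w⁻¹ • (p : V)) + ext X (center P L₁)

/-! ### Cascades -/

/-- The linear subspace `V'` of `V` spanned by the roots of `R'`. -/
def leviSpan : Submodule ℝ V := Submodule.span ℝ (P.root '' {i | IsLevi P b k i})

/-- Residual spaces `L' ⊆ V'` for the root system `R'`. -/
structure IsLeviResidual (L : AffineSubspace ℝ V) : Prop where
  nonempty : (L : Set V).Nonempty
  subset : (L : Set V) ⊆ leviSpan P b k
  residual : (zeroSet P L ∩ {i | IsLevi P b k i}).ncard +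
      (Module.finrank ℝ (leviSpan P b k) - Module.finrank ℝ L.direction) ≤
    (poleSet P L ∩ {i | IsLevi P b k i}).ncard

/-- A residual space for `R'` is standard. -/
def IsLeviStandard (L : AffineSubspace ℝ V) : Prop :=
  (∃ J ⊆ {j | j ∈ b.support ∧ j ≠ k}, constSet P L ∩ {i | IsLevi P b k i} =
    {i | P.coroot i ∈ Submodule.span ℝ (P.coroot '' J)}) ∧
  ∀ i ∈ constSet P L, IsLevi P b k i → b.IsPos i → ∀ p ∈ L, 0 ≤ P.coroot' i p

/-- `w` is the fundamental weight attached to `k`. -/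
def IsFundWeight (w : V) : Prop := ∀ j ∈ b.support, P.coroot' j w = open Classical in
  if j = k then 1 else 0

/-- The tempered form `c_L + √-1 V^L` of `L`. -/
def temp (L : AffineSubspace ℝ V) : Set (V × V) := {l | l.1 = center P L ∧ l.2 ∈ L.direction}

/-- A cascade for `R' ⊂ R`.  A directed segment `σ = [a, e]` in a pole space `L` is recorded as the
triple `(a, e, L)`. -/
structure Cascade where
  /-- The set of pairs `(σ, L)`. -/
  segs : Set (V × V × AffineSubspace ℝ V)
  finite_segs : segs.Finite
  seg_mem : ∀ a e L, (a, e, L) ∈ segs → IsOmegaPole P b k L ∧ a ∈ L ∧ e ∈ L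
  /-- The distinguished set `Std(C)` of pairs `(L₀, d)`. -/
  Std : Set (AffineSubspace ℝ V × P.weylGroup)
  std_mem : ∀ q ∈ Std, IsStandard P b k q.1 ∧ IsOmegaPole P b k (q.2 • q.1) ∧
    IsMinimalRep P b k q.2 ∧
    ∃ a e L, (a, e, L) ∈ segs ∧ ∃ u ∈ leviWeyl P b k, q.2 • q.1 = u • L
  std_complete : ∀ a e L, (a, e, L) ∈ segs →
    ∃! q : AffineSubspace ℝ V × P.weylGroup, q ∈ Std ∧ ∃ u ∈ leviWeyl P b k, q.2 • q.1 = u • L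
  /-- The chosen standard pair `(L₀, w_L)` of a pole space `L` of the cascade. -/
  stdPair : AffineSubspace ℝ V → AffineSubspace ℝ V × P.weylGroup
  stdPair_spec : ∀ a e L, (a, e, L) ∈ segs →
    IsStandardPair P b k (stdPair L).1 (stdPair L).2 L ∧
    ∃ u ∈ leviWeyl P b k, ∃ d, (stdPair L).2 = u * d ∧ ((stdPair L).1, d) ∈ Std
  /-- The fundamental weight orthogonal to `R'`. -/
  wt : V
  wt_spec : IsFundWeight P b k wt
  /-- The chosen representatives, standard residual spaces for `R'`, of the `W'`-orbits of residual
  spaces for `R'`. -/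
  reps : Set (AffineSubspace ℝ V)
  reps_mem : ∀ L ∈ reps, IsLeviResidual P b k L ∧ IsLeviStandard P b k L
  reps_complete : ∀ L, IsLeviResidual P b k L →
    ∃! M, M ∈ reps ∧ ∃ u ∈ leviWeyl P b k, M = u • L
  /-- The parameter `t ≫ 0` of the base point at infinity `c_L + t • wt` of `L = L' + ℝ wt`. -/
  tInf : AffineSubspace ℝ V → ℝ
  /-- The segments of the first generation: `([c_L + t • wt, c_L], L)` with `L = L' + ℝ wt`. -/
  first : V × V × AffineSubspace ℝ V → Prop
  first_iff : ∀ s, first s ↔ ∃ L' ∈ reps, ∃ L : AffineSubspace ℝ V,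
    (L : Set V) = {v | ∃ p ∈ L', ∃ t : ℝ, v = p + t • wt} ∧
    s = (center P L + tInf L • wt, center P L, L)
  first_large : ∀ a e L, first (a, e, L) →
    ∀ i, b.IsPos i → ¬ IsLevi P b k i → 1 < P.coroot' i a
  first_mem : ∀ a e L, first (a, e, L) → (a, e, L) ∈ segs ∧ (L, 1) ∈ Std ∧ stdPair L = (L, 1)
  /-- Every codimension one pole space met by a segment carries, up to `W'`, a segment starting at
  the point of intersection. -/
  descend : ∀ a e L, (a, e, L) ∈ segs → ∀ M, IsOmegaPole P b k M → M ≤ L →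
    Module.finrank ℝ M.direction + 1 = Module.finrank ℝ L.direction →
    ((M : Set V) ∩ segment ℝ a e).Nonempty →
    ∃ u ∈ leviWeyl P b k, ∃ a' e', (a', e', u • M) ∈ segs ∧
      {a'} = (u • segment ℝ a e) ∩ ((u • M : AffineSubspace ℝ V) : Set V)
  /-- Every segment which is not of the first generation arises in this way. -/
  ascend : ∀ a e M, (a, e, M) ∈ segs → ¬ first (a, e, M) →
    ∃ a' e' L, (a', e', L) ∈ segs ∧ ∃ u ∈ leviWeyl P b k, M ≤ u • L ∧
      Module.finrank ℝ M.direction + 1 = Module.finrank ℝ L.direction ∧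
      {a} = (u • segment ℝ a' e') ∩ (M : Set V)
  /-- A segment in a space whose tempered form lies in those of the `W'`-conjugates of the residual
  spaces of the cascade ends at the centre. -/
  end_center : ∀ a e M, (a, e, M) ∈ segs →
    temp P M ⊆ {l | ∃ a' e' L, (a', e', L) ∈ segs ∧ IsResidual P L ∧
      ∃ u ∈ leviWeyl P b k, l ∈ u • temp P L} → e = center P M
  /-- The other segments end at the initial point of a segment, up to `W'`. -/
  end_initial : ∀ a e M, (a, e, M) ∈ segs →
    ¬ temp P M ⊆ {l | ∃ a' e' L, (a', e', L) ∈ segs ∧ IsResidual P L ∧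
      ∃ u ∈ leviWeyl P b k, l ∈ u • temp P L} →
    ∃ e', ∃ u ∈ leviWeyl P b k, (u • e, u • e', u • M) ∈ segs

variable {P b k}

/-- `L` appears in the cascade. -/
def Cascade.Appears (C : Cascade P b k) (L : AffineSubspace ℝ V) : Prop :=
  ∃ a e, (a, e, L) ∈ C.segs

/-- The set `SP(C)` of chosen standard pairs. -/
def Cascade.SP (C : Cascade P b k) : Set (AffineSubspace ℝ V × P.weylGroup) :=
  {q | ∃ L, C.Appears L ∧ q = C.stdPair L}

/-- The `τ`-invariance of a cascade:
`Den~(L₀, x, Σ_τ)₊ = (1 - τ₀)(Den~(L₀, x, Σ)₊)` for all residual `(L₀, x) ∈ Std(C)`. -/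
def Cascade.TauInvariant (C : Cascade P b k) : Prop :=
  ∀ q ∈ C.Std, IsResidual P q.1 →
    denEnvTau P b k q.1 q.2 = image (oneSubTau P b q.1) (denEnv P b k q.1 q.2)

end EnvDen

end

/-! The denominators on a regular pole space can be computed explicitly, and the resulting formula
is equivariant under the Weyl group. Each of Σ, Σ_τ, Σ'_x is, up to a change of test function, a sum
over a coset of a reflection group of terms ∏(α+1)/α · r(w·)/r · φ(w·), formed with the negative
coroots for Σ and with the positive ones for the other two (`sigma_eq`, `sigmaTau_eq`,
`sigmaPrime_eq`). The poles along α = 0 cancel by antisymmetry. On a regular space H the term of w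
drops out when some factor α+1 vanishes identically on H; otherwise it contributes the classes of
coroots in the denominator r that are not cancelled by r∘w. The supremum of these contributions
clears denominators (`clears_denMS`). Nothing smaller does (`count_le_of_clears`): a generic point
of H has trivial stabilizer, so a test function can isolate a single term. Together this is
`isDen_denMS`.

Let Q be the set of coroots lying in prescribed ∼-classes of nonconstant functions. The number of
denominators in these classes is then `envCard`, taken with the negative coroots of Q for Σ and with
the positive ones for Σ_τ: the longest element of W matches the surviving terms of the two sums.
This number is W-invariant (`envCard_smul`). On a standard space the sign of a coroot can be read
off the gradient of its restriction. Hence, if g(L₁) = L₀ and ν on L₁ has positive gradient, the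
coroots restricting to the class of ν either all keep their sign under g or all change it. In the
first case the multiplicities for Σ and Σ_τ are both transported to gν (`envInf_push_of_pos`); in
the second they are transported to 1 − gν and interchanged (`envInf_push_of_neg`).

When τ preserves L it is the point reflection at the centre, so 1 − τ keeps gradients and replaces
the value c at the centre by 1 − c. In the second case |g|ν therefore equals 1 − (1−τ)(gν), and the
τ-invariance at L₀, which trades Σ_τ for Σ at the cost of 1 − τ, undoes the interchange. This gives
(a), and the same bookkeeping transports the invariance itself to L₁, which is (b)
(`denEnv_eq_image_of_smul`). A chosen pair differs from an element of Std(C) only by a left factor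
in W', which does not affect good envelopes. If τ did not preserve L₀, the invariance would force
all multiplicities involved to vanish (`eq_zero_of_tau_notMem`).

For (c), a surviving term of Σ'_x on an x-good envelope H sends all of the coroots equal to 1 on H
to positive ones, so it is among the surviving terms of Σ_τ. The multiplicities for Σ' are thus
bounded by those for Σ_τ (`denEnvPrime_le_denEnvTau`), and (b) concludes. -/

open scoped Pointwise
set_option linter.unusedSectionVars false

noncomputable section

namespace EnvDen

/-! ### The Weyl group acting on points and on indices. -/

section Weyl

variable {ι V N : Type*} [AddCommGroup V] [Module ℝ V] [AddCommGroup N] [Module ℝ N]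
  (P : RootPairing ι ℝ V N)

/-- The index of the opposite root. -/
def negIdx (i : ι) : ι := P.reflectionPerm i i

lemma coroot'_negIdx (i : ι) (v : V) : P.coroot' (negIdx P i) v = -P.coroot' i v := by
  simp [negIdx, RootPairing.coroot']

lemma root_negIdx (i : ι) : P.root (negIdx P i) = -P.root i := by
  rw [negIdx, P.root_reflectionPerm, P.reflection_apply_self]

lemma negIdx_negIdx (i : ι) : negIdx P (negIdx P i) = i := by
  apply P.root.injective
  rw [root_negIdx, root_negIdx, neg_neg]

/-- The actions on points and on indices come from separate components of `w`. They are linked by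
transposing the coweight map, which permutes coroots by the inverse of the index permutation. -/
lemma coroot'_smul_smul (w : P.weylGroup) (i : ι) (v : V) :
    P.coroot' (w • i) (w • v) = P.coroot' i v := by
  obtain ⟨w, hw⟩ := w
  change P.coroot' (Equiv.toFun w.indexEquiv i) (w.weightMap v) = _
  have h1 := congrArg (fun f => f v) (RootPairing.Hom.weight_coweight_transpose_apply P P
    (P.coroot (w.indexEquiv i)) w.toHom)
  have h2 := congrFun w.toHom.coroot_coweightMap (w.indexEquiv i)
  simp only [Function.comp_apply] at h2
  rw [h2] at h1
  simpa using h1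

lemma coroot'_smul (w : P.weylGroup) (i : ι) (v : V) :
    P.coroot' i (w • v) = P.coroot' (w⁻¹ • i) v := by
  rw [← coroot'_smul_smul P w (w⁻¹ • i) v, smul_inv_smul]

lemma coroot'_smul_idx (w : P.weylGroup) (i : ι) (v : V) :
    P.coroot' (w • i) v = P.coroot' i (w⁻¹ • v) := by
  rw [coroot'_smul, inv_inv]

lemma ofIdx_smul_eq (i : ι) (v : V) :
    RootPairing.weylGroup.ofIdx P i • v = v - P.coroot' i v • P.root i := rfl

lemma ofIdx_mul_self (i : ι) :
    RootPairing.weylGroup.ofIdx P i * RootPairing.weylGroup.ofIdx P i = 1 := by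
  apply Subtype.ext
  change RootPairing.Equiv.reflection P i * RootPairing.Equiv.reflection P i = 1
  rw [mul_eq_one_iff_inv_eq, RootPairing.Equiv.reflection_inv]

lemma ofIdx_inv (i : ι) :
    (RootPairing.weylGroup.ofIdx P i)⁻¹ = RootPairing.weylGroup.ofIdx P i :=
  inv_eq_of_mul_eq_one_left (ofIdx_mul_self P i)

lemma weyl_smul_root (w : P.weylGroup) (i : ι) : w • P.root i = P.root (w • i) :=
  P.weylGroup_apply_root w i

lemma weyl_smul_add (w : P.weylGroup) (u v : V) : w • (u + v) = w • u + w • v := smul_add w u v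

lemma weyl_smul_smul (w : P.weylGroup) (t : ℝ) (v : V) : w • (t • v) = t • (w • v) :=
  smul_comm w t v

lemma weyl_smul_negIdx (w : P.weylGroup) (i : ι) : w • negIdx P i = negIdx P (w • i) := by
  apply P.root.injective
  rw [← weyl_smul_root, root_negIdx, root_negIdx, smul_neg, weyl_smul_root]

variable [P.IsRootSystem]

lemma eq_of_coroot' {u v : V} (h : ∀ i, P.coroot' i u = P.coroot' i v) : u = v := by
  apply P.toLinearMap.toPerfPair.injective
  apply LinearMap.ext_on_range (v := P.coroot)
    (RootPairing.IsRootSystem.span_coroot_eq_top (P := P))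
  exact h

lemma weyl_eq_one_of_idx {w : P.weylGroup} (h : ∀ i : ι, w • i = i) : w = 1 := by
  have hV : ∀ v : V, w • v = v := fun v => eq_of_coroot' P fun i => by
    rw [coroot'_smul]; congr 2; rw [inv_smul_eq_iff, h]
  obtain ⟨w, hw⟩ := w
  apply Subtype.ext
  refine RootPairing.Equiv.ext ?_ ?_ ?_
  · exact LinearMap.ext hV
  · apply LinearMap.ext_on_range (v := P.coroot)
      (RootPairing.IsRootSystem.span_coroot_eq_top (P := P))
    intro i
    have h2 := congrFun w.toHom.coroot_coweightMap i
    simp only [Function.comp_apply] at h2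
    have h3 : w.indexEquiv.symm i = i := by
      rw [Equiv.symm_apply_eq]; exact (h i).symm
    refine h2.trans ?_
    change P.coroot (w.indexEquiv.symm i) = P.coroot i
    rw [h3]
  · exact Equiv.ext h

lemma weyl_eq_one_of_smul {w : P.weylGroup} (h : ∀ v : V, w • v = v) : w = 1 := by
  apply weyl_eq_one_of_idx
  intro i
  apply P.root.injective
  rw [← weyl_smul_root, h]

lemma weyl_eq_of_smul {u w : P.weylGroup} (h : ∀ v : V, u • v = w • v) : u = w := by
  have : w⁻¹ * u = 1 := weyl_eq_one_of_smul P fun v => by rw [mul_smul, h, inv_smul_smul]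
  rwa [inv_mul_eq_one, eq_comm] at this

instance finite_weylGroup [Finite ι] : Finite P.weylGroup := by
  apply Finite.of_injective (fun w : P.weylGroup => (MulAction.toPerm w : Equiv.Perm ι))
  intro u w h
  have : w⁻¹ * u = 1 := weyl_eq_one_of_idx P fun i => by
    rw [mul_smul, inv_smul_eq_iff]
    exact congrArg (fun e : Equiv.Perm ι => e i) h
  rwa [inv_mul_eq_one, eq_comm] at this

lemma finite_module {ι V N : Type*} [AddCommGroup V] [Module ℝ V] [AddCommGroup N] [Module ℝ N]
    (P : RootPairing ι ℝ V N) [P.IsRootSystem] [Finite ι] : Module.Finite ℝ V :=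
  ⟨⟨(Set.finite_range P.root).toFinset, by
    simp⟩⟩

end Weyl

/-! ### The invariant inner product. -/

section Form

variable {ι V N : Type*} [Fintype ι] [AddCommGroup V] [Module ℝ V] [AddCommGroup N] [Module ℝ N]
  (P : RootPairing ι ℝ V N)

lemma rootForm_smul_smul (w : P.weylGroup) (u v : V) :
    P.RootForm (w • u) (w • v) = P.RootForm u v := by
  rw [P.rootForm_apply_apply, P.rootForm_apply_apply]
  simp_rw [coroot'_smul]
  exact Fintype.sum_equiv (MulAction.toPerm w⁻¹ : Equiv.Perm ι) _ _ fun i => rfl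

lemma rootForm_comm (u v : V) : P.RootForm u v = P.RootForm v u := by
  simp [P.rootForm_apply_apply, mul_comm]

lemma rootForm_self_nonneg (v : V) : 0 ≤ P.RootForm v v := by
  rw [P.rootForm_apply_apply]
  exact Finset.sum_nonneg fun i _ => mul_self_nonneg _

lemma rootForm_root_self_pos (i : ι) : 0 < P.RootForm (P.root i) (P.root i) := by
  rw [P.rootForm_apply_apply]
  refine Finset.sum_pos' (fun j _ => mul_self_nonneg _) ⟨i, Finset.mem_univ _, ?_⟩
  simp [RootPairing.coroot']

/-- This is invariance of the form under the reflection in `i`, applied to `v` and to the root,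
which the reflection negates. -/
lemma two_mul_rootForm_root (i : ι) (v : V) :
    2 * P.RootForm v (P.root i) = P.coroot' i v * P.RootForm (P.root i) (P.root i) := by
  have h := rootForm_smul_smul P (RootPairing.weylGroup.ofIdx P i) v (P.root i)
  rw [ofIdx_smul_eq, ofIdx_smul_eq] at h
  have h2 : P.coroot' i (P.root i) = 2 := by simp [RootPairing.coroot']
  rw [h2] at h
  simp only [map_sub, map_smul, LinearMap.sub_apply, LinearMap.smul_apply, smul_eq_mul] at h
  linarith

lemma rootForm_self_eq_zero [P.IsRootSystem] {v : V} (h : P.RootForm v v = 0) : v = 0 := by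
  rw [P.rootForm_apply_apply] at h
  rw [Finset.sum_eq_zero_iff_of_nonneg fun i _ => mul_self_nonneg _] at h
  exact eq_of_coroot' P fun i => by simpa using h i (Finset.mem_univ _)

end Form

/-! ### Positive coroots, heights, and the exchange condition. -/

section Base

variable {ι V N : Type*} [Finite ι] [AddCommGroup V] [Module ℝ V] [AddCommGroup N] [Module ℝ N]
  (P : RootPairing ι ℝ V N) [P.IsRootSystem] (b : P.Base)

lemma exists_point_of_simple (f : ι → ℝ) : ∃ v : V, ∀ j ∈ b.support, P.coroot' j v = f j := by
  refine ⟨P.toLinearMap.toPerfPair.symm (b.toCoweightBasis.constr ℝ fun j => f j), fun j hj => ?_⟩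
  have h : b.toCoweightBasis ⟨j, hj⟩ = P.coroot j := by
    exact (b.flip.toWeightBasis_apply ⟨j, hj⟩ : _)
  have h2 : P.coroot' j (P.toLinearMap.toPerfPair.symm (b.toCoweightBasis.constr ℝ fun j => f j)) =
    P.toLinearMap.toPerfPair (P.toLinearMap.toPerfPair.symm
      (b.toCoweightBasis.constr ℝ fun j => f j)) (P.coroot j) := rfl
  rw [h2, LinearEquiv.apply_symm_apply, ← h, Module.Basis.constr_basis]

variable [P.IsCrystallographic] [P.IsReduced]

lemma isPos_negIdx (i : ι) : b.IsPos (negIdx P i) ↔ ¬ b.IsPos i :=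
  RootPairing.Base.IsPos.neg_iff_not b i

lemma isPos_reflectionPerm_iff (i j : ι) (hj : j ∈ b.support) (h1 : i ≠ j)
    (h2 : i ≠ negIdx P j) : b.IsPos (P.reflectionPerm j i) ↔ b.IsPos i := by
  have key : ∀ i, i ≠ j → b.IsPos i → b.IsPos (P.reflectionPerm j i) :=
    fun i hi h => h.reflectionPerm hj hi
  refine ⟨fun h => ?_, key i h1⟩
  have := key (P.reflectionPerm j i) (fun h => h2 ?_) h
  · simpa using this
  · apply P.root.injective
    have h3 := congrArg (P.reflectionPerm j) h
    rw [show P.reflectionPerm j (P.reflectionPerm j i) = i by simp] at h3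
    rw [h3, negIdx]

/-- Positivity is defined through roots, but coroots are the functions used here. Both notions
behave alike under negation and simple reflections and agree on simple indices, so induction along
simple reflections identifies them. -/
lemma flip_isPos_iff (i : ι) : b.flip.IsPos i ↔ b.IsPos i := by
  have hneg : ∀ i, b.flip.IsPos (negIdx P i) ↔ ¬ b.flip.IsPos i := fun i =>
    RootPairing.Base.IsPos.neg_iff_not b.flip i
  refine RootPairing.Base.induction_reflect (b := b) i
    (p := fun i => b.flip.IsPos i ↔ b.IsPos i) (fun i h => ?_) (fun i hi => ?_)
    fun i j h hj => ?_
  · change b.flip.IsPos (negIdx P i) ↔ b.IsPos (negIdx P i)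
    rw [hneg, isPos_negIdx, h]
  · exact iff_of_true (RootPairing.Base.isPos_of_mem_support (b := b.flip) hi)
      (RootPairing.Base.isPos_of_mem_support hi)
  · by_cases h1 : i = j
    · subst h1
      change b.flip.IsPos (negIdx P i) ↔ b.IsPos (negIdx P i)
      rw [hneg, isPos_negIdx, h]
    by_cases h2 : i = negIdx P j
    · have h3 : P.reflectionPerm j i = j := by rw [h2, negIdx]; simp
      rw [h3]
      exact iff_of_true (RootPairing.Base.isPos_of_mem_support (b := b.flip) hj)
        (RootPairing.Base.isPos_of_mem_support hj)
    rw [isPos_reflectionPerm_iff P b i j hj h1 h2, ← h]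
    exact isPos_reflectionPerm_iff P.flip b.flip i j hj h1 h2

/-- A point at which all simple coroots take the value `1`. -/
def rhoPt : V := (exists_point_of_simple P b fun _ => 1).choose

lemma coroot_eq_sum (i : ι) : ∃ f : ι → ℤ,
    P.coroot i = ∑ j ∈ b.support, (f j : ℝ) • P.coroot j ∧ (b.IsPos i → ∀ j, 0 ≤ f j) := by
  obtain ⟨f, hf, hs, h⟩ := b.flip.exists_root_eq_sum_int i
  have h' : P.coroot i = ∑ j ∈ b.support, (f j : ℝ) • P.coroot j := by
    simp only [Int.cast_smul_eq_zsmul]; exact h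
  refine ⟨f, h', fun hi => ?_⟩
  have h2 := RootPairing.Base.height_eq_sum (b := b.flip) h
  rw [← flip_isPos_iff, RootPairing.Base.isPos_iff, h2] at hi
  rcases hs with hs | hs
  · exact fun j => hs.le j
  · exfalso
    have : ∑ j ∈ b.flip.support, f j ≤ 0 := Finset.sum_nonpos fun j _ => hs.le j
    omega

lemma coroot'_eq_sum {i : ι} {f : ι → ℝ} {s : Finset ι}
    (h : P.coroot i = ∑ j ∈ s, f j • P.coroot j) (v : V) :
    P.coroot' i v = ∑ j ∈ s, f j * P.coroot' j v := by
  change P.toLinearMap v (P.coroot i) = _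
  rw [h, map_sum]
  exact Finset.sum_congr rfl fun j _ => by rw [map_smul]; rfl

lemma coroot'_rhoPt (i : ι) : P.coroot' i (rhoPt P b) = (b.flip.height i : ℝ) := by
  obtain ⟨f, -, -, h⟩ := b.flip.exists_root_eq_sum_int i
  have h' : P.coroot i = ∑ j ∈ b.support, (f j : ℝ) • P.coroot j := by
    simp only [Int.cast_smul_eq_zsmul]; exact h
  rw [RootPairing.Base.height_eq_sum (b := b.flip) h, coroot'_eq_sum P h']
  push_cast
  refine Finset.sum_congr rfl fun j hj => ?_
  rw [rhoPt, (exists_point_of_simple P b fun _ => 1).choose_spec j hj, mul_one]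

/-- Turning positivity into an inequality at a single point makes the chamber arguments below purely
linear. -/
lemma isPos_iff_rhoPt (i : ι) : b.IsPos i ↔ 0 < P.coroot' i (rhoPt P b) := by
  rw [coroot'_rhoPt, ← flip_isPos_iff, RootPairing.Base.isPos_iff, Int.cast_pos]

lemma not_isPos_iff_rhoPt (i : ι) : ¬ b.IsPos i ↔ P.coroot' i (rhoPt P b) < 0 := by
  rw [← isPos_negIdx, isPos_iff_rhoPt, coroot'_negIdx, neg_pos]

/-! ### Simple transitivity -/

lemma isPos_simple_smul (i j : ι) (hj : j ∈ b.support) (hi : b.IsPos i) (hij : i ≠ j) :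
    b.IsPos (RootPairing.weylGroup.ofIdx P j • i) :=
  hi.reflectionPerm hj hij

lemma ofIdx_smul_idx (w : P.weylGroup) (i : ι) : RootPairing.weylGroup.ofIdx P (w • i) =
    w * RootPairing.weylGroup.ofIdx P i * w⁻¹ := by
  apply weyl_eq_of_smul
  intro v
  rw [mul_smul, mul_smul, ofIdx_smul_eq, ofIdx_smul_eq, smul_sub, smul_inv_smul, weyl_smul_smul,
    weyl_smul_root, coroot'_smul_idx]

lemma ofIdx_smul_self (i : ι) : RootPairing.weylGroup.ofIdx P i • i = negIdx P i := rfl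

lemma ofIdx_negIdx (i : ι) :
    RootPairing.weylGroup.ofIdx P (negIdx P i) = RootPairing.weylGroup.ofIdx P i := by
  apply weyl_eq_of_smul
  intro v
  rw [ofIdx_smul_eq, ofIdx_smul_eq, coroot'_negIdx, root_negIdx, smul_neg, neg_smul, neg_neg]

/-- The product of a word in the reflections. -/
def wordProd (l : List ι) : P.weylGroup := (l.map (RootPairing.weylGroup.ofIdx P)).prod

lemma exists_word (w : P.weylGroup) : ∃ l : List ι, (∀ j ∈ l, j ∈ b.support) ∧ wordProd P l = w := by
  have happ : ∀ u v : P.weylGroup,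
      (∃ l : List ι, (∀ j ∈ l, j ∈ b.support) ∧ wordProd P l = u) →
      (∃ l : List ι, (∀ j ∈ l, j ∈ b.support) ∧ wordProd P l = v) →
      ∃ l : List ι, (∀ j ∈ l, j ∈ b.support) ∧ wordProd P l = u * v := by
    rintro u v ⟨l, hl, rfl⟩ ⟨m, hm, rfl⟩
    refine ⟨l ++ m, fun j hj => ?_, by simp [wordProd]⟩
    rcases List.mem_append.1 hj with h | h
    exacts [hl j h, hm j h]
  have hsimple : ∀ j ∈ b.support, ∃ l : List ι, (∀ j ∈ l, j ∈ b.support) ∧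
      wordProd P l = RootPairing.weylGroup.ofIdx P j := fun j hj =>
    ⟨[j], by simpa using hj, by simp [wordProd]⟩
  have hrefl : ∀ i, ∃ l : List ι, (∀ j ∈ l, j ∈ b.support) ∧
      wordProd P l = RootPairing.weylGroup.ofIdx P i := by
    intro i
    refine RootPairing.Base.induction_reflect (b := b) i (fun i h => ?_) hsimple fun i j h hj => ?_
    · change ∃ l : List ι, (∀ j ∈ l, j ∈ b.support) ∧
        wordProd P l = RootPairing.weylGroup.ofIdx P (negIdx P i)
      rwa [ofIdx_negIdx]
    · change ∃ l : List ι, (∀ j ∈ l, j ∈ b.support) ∧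
        wordProd P l = RootPairing.weylGroup.ofIdx P (RootPairing.weylGroup.ofIdx P j • i)
      rw [ofIdx_smul_idx, ofIdx_inv]
      exact happ _ _ (happ _ _ (hsimple j hj) h) (hsimple j hj)
  obtain ⟨w, hw⟩ := w
  induction hw using RootPairing.weylGroup.induction with
  | mem i => exact hrefl i
  | one => exact ⟨[], by simp, rfl⟩
  | mul x y hx hy h1 h2 => exact happ ⟨x, hx⟩ ⟨y, hy⟩ h1 h2

lemma eq_of_simple_neg (i j : ι) (hj : j ∈ b.support) (hi : b.IsPos i)
    (h : ¬ b.IsPos (RootPairing.weylGroup.ofIdx P j • i)) : i = j := by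
  by_contra hij
  exact h (isPos_simple_smul P b i j hj hi hij)

/-- Follow `j` through the word from the right. At the letter where it turns negative it must equal
that letter, since a simple reflection makes no other positive index negative; deleting the letter
has the effect of multiplying by the reflection in `j`. -/
lemma exchange (l : List ι) (hl : ∀ j ∈ l, j ∈ b.support) (j : ι) (hj : j ∈ b.support)
    (h : ¬ b.IsPos (wordProd P l • j)) :
    ∃ m : List ι, (∀ j ∈ m, j ∈ b.support) ∧ m.length + 1 = l.length ∧
      wordProd P m = wordProd P l * RootPairing.weylGroup.ofIdx P j := by
  induction l with
  | nil => exact absurd (by simpa [wordProd] using RootPairing.Base.isPos_of_mem_support hj) h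
  | cons a l ih =>
    have ha : wordProd P (a :: l) = RootPairing.weylGroup.ofIdx P a * wordProd P l := by
      simp [wordProd]
    by_cases hneg : b.IsPos (wordProd P l • j)
    · refine ⟨l, fun j hj => hl j (List.mem_cons_of_mem _ hj), rfl, ?_⟩
      rw [ha, mul_smul] at h
      have := eq_of_simple_neg P b _ a (hl a List.mem_cons_self) hneg h
      rw [ha, ← this, ofIdx_smul_idx, inv_mul_cancel_right, mul_assoc, ofIdx_mul_self, mul_one]
    · obtain ⟨m, hm, hlen, hp⟩ := ih (fun j hj => hl j (List.mem_cons_of_mem _ hj)) hneg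
      refine ⟨a :: m, ?_, by simp [hlen], ?_⟩
      · intro j hj
        rcases List.mem_cons.1 hj with rfl | hj
        exacts [hl _ List.mem_cons_self, hm j hj]
      · rw [ha, mul_assoc, ← hp]; simp [wordProd]

/-- If a shortest word had a last letter `j`, the remaining prefix would make `j` negative, and the
exchange condition would produce a word with two letters fewer. -/
lemma weyl_eq_one_of_isPos (w : P.weylGroup) (h : ∀ i, b.IsPos i → b.IsPos (w • i)) : w = 1 := by
  classical
  have hex : ∃ n, ∃ l : List ι, (∀ j ∈ l, j ∈ b.support) ∧ wordProd P l = w ∧ l.length = n := by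
    obtain ⟨l, h1, h2⟩ := exists_word P b w
    exact ⟨_, l, h1, h2, rfl⟩
  obtain ⟨l, hl, hw, hlen⟩ := Nat.find_spec hex
  rcases List.eq_nil_or_concat' l with rfl | ⟨l', j, rfl⟩
  · rw [← hw]; rfl
  · exfalso
    have hl' : ∀ i ∈ l', i ∈ b.support := fun i hi => hl i (by simp [hi])
    have hj : j ∈ b.support := hl j (by simp)
    have hprod : wordProd P (l' ++ [j]) = wordProd P l' * RootPairing.weylGroup.ofIdx P j := by
      simp [wordProd]
    rw [hprod] at hw
    have hneg : ¬ b.IsPos (wordProd P l' • j) := by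
      have h1 := h j (RootPairing.Base.isPos_of_mem_support hj)
      rw [← hw, mul_smul, ofIdx_smul_self, weyl_smul_negIdx, isPos_negIdx] at h1
      exact h1
    obtain ⟨m, hm, hlen', hp⟩ := exchange P b l' hl' j hj hneg
    refine Nat.find_min hex (m := m.length) ?_ ⟨m, hm, hp.trans hw, rfl⟩
    rw [← hlen, List.length_append]; simp; omega

end Base

/-! ### Standard Levi subsystems, their chambers and longest elements. -/

section Levi

variable {ι V N : Type*} [Fintype ι] [AddCommGroup V] [Module ℝ V] [AddCommGroup N] [Module ℝ N]
  (P : RootPairing ι ℝ V N) [P.IsRootSystem] [P.IsCrystallographic] [P.IsReduced] (b : P.Base)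

/-- The Levi subsystem spanned by a set of simple coroots. -/
def leviSet (J : Set ι) : Set ι := {i | P.coroot i ∈ Submodule.span ℝ (P.coroot '' J)}

/-- The group generated by the reflections in `S`. -/
def reflGroup (S : Set ι) : Subgroup P.weylGroup :=
  Subgroup.closure {s | ∃ i ∈ S, s = RootPairing.weylGroup.ofIdx P i}

lemma ofIdx_mem_reflGroup {S : Set ι} {i : ι} (hi : i ∈ S) :
    RootPairing.weylGroup.ofIdx P i ∈ reflGroup P S :=
  Subgroup.subset_closure ⟨i, hi, rfl⟩

lemma reflGroup_univ : reflGroup P (Set.univ : Set ι) = ⊤ := by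
  rw [eq_top_iff]
  rintro ⟨w, hw⟩ -
  induction hw using RootPairing.weylGroup.induction with
  | mem i => exact ofIdx_mem_reflGroup P (Set.mem_univ i)
  | one => exact one_mem _
  | mul x y hx hy h1 h2 => exact mul_mem h1 h2

lemma reflGroup_smul_eq {S : Set ι} {v : V} (h : ∀ i ∈ S, P.coroot' i v = 0)
    {g : P.weylGroup} (hg : g ∈ reflGroup P S) : g • v = v := by
  induction hg using Subgroup.closure_induction with
  | mem x hx => obtain ⟨i, hi, rfl⟩ := hx; rw [ofIdx_smul_eq, h i hi, zero_smul, sub_zero]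
  | one => exact one_smul _ _
  | mul x y _ _ hx hy => rw [mul_smul, hy, hx]
  | inv x _ hx => rw [inv_smul_eq_iff, hx]

/-- A point where the simple coroots in `J` vanish, the other simple coroots being `1`. -/
def wallPt (J : Set ι) : V :=
  open Classical in (exists_point_of_simple P b fun j => if j ∈ J then 0 else 1).choose

lemma coroot'_wallPt (J : Set ι) {j : ι} (hj : j ∈ b.support) : P.coroot' j (wallPt P b J) =
    open Classical in if j ∈ J then 0 else 1 := by
  classical
  exact (exists_point_of_simple P b fun j => if j ∈ J then 0 else 1).choose_spec j hj

variable {J : Set ι} (hJ : J ⊆ (b.support : Set ι))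

lemma negIdx_mem_leviSet {i : ι} : negIdx P i ∈ leviSet P J ↔ i ∈ leviSet P J := by
  have : P.coroot (negIdx P i) = -P.coroot i := by
    rw [negIdx, P.coroot_reflectionPerm, P.coreflection_apply_self]
  simp [leviSet, this]

lemma coroot'_eq_zero_of_mem_leviSet {i : ι} (hi : i ∈ leviSet P J) {v : V}
    (hv : ∀ j ∈ J, P.coroot' j v = 0) : P.coroot' i v = 0 := by
  have h : Submodule.span ℝ (P.coroot '' J) ≤ LinearMap.ker (P.toLinearMap v) := by
    rw [Submodule.span_le]
    rintro _ ⟨j, hj, rfl⟩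
    exact hv j hj
  exact h hi

include hJ in
-- Evaluate the expansion in simple coroots at `wallPt`: nonnegative terms add up to zero, so only
-- coefficients along `J` survive.
lemma leviSet_sum {i : ι} (hi : i ∈ leviSet P J) (hpos : b.IsPos i) :
    ∃ (s : Finset ι) (f : ι → ℝ), (∀ j ∈ s, j ∈ J) ∧ (∀ j, 0 ≤ f j) ∧
      P.coroot i = ∑ j ∈ s, f j • P.coroot j := by
  classical
  obtain ⟨f, hf, h0⟩ := coroot_eq_sum P b i
  have hw : P.coroot' i (wallPt P b J) = 0 := coroot'_eq_zero_of_mem_leviSet P hi fun j hj => by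
    rw [coroot'_wallPt P b J (hJ hj), if_pos hj]
  rw [coroot'_eq_sum P hf] at hw
  have hnn : ∀ j ∈ b.support, 0 ≤ (f j : ℝ) * P.coroot' j (wallPt P b J) := fun j hj => by
    rw [coroot'_wallPt P b J hj]
    have : (0 : ℝ) ≤ f j := by exact_mod_cast h0 hpos j
    split_ifs <;> simp [this]
  rw [Finset.sum_eq_zero_iff_of_nonneg hnn] at hw
  refine ⟨b.support.filter (· ∈ J), fun j => f j, by simp, fun j => ?_, ?_⟩
  · exact Int.cast_nonneg (h0 hpos j)
  · rw [hf, Finset.sum_filter]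
    refine Finset.sum_congr rfl fun j hj => ?_
    split_ifs with h
    · rfl
    · have := hw j hj
      rw [coroot'_wallPt P b J hj, if_neg h, mul_one] at this
      rw [this, zero_smul]

include hJ in
-- Since the reflections of the Levi subsystem fix `wallPt`, this description makes both its
-- stability under its own Weyl group and the behaviour of signs outside it immediate.
lemma mem_leviSet_iff {i : ι} : i ∈ leviSet P J ↔ P.coroot' i (wallPt P b J) = 0 := by
  classical
  refine ⟨fun hi => coroot'_eq_zero_of_mem_leviSet P hi fun j hj => by
    rw [coroot'_wallPt P b J (hJ hj), if_pos hj], fun hw => ?_⟩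
  have key : ∀ i, b.IsPos i → P.coroot' i (wallPt P b J) = 0 → i ∈ leviSet P J := by
    intro i hpos hw
    obtain ⟨f, hf, h0⟩ := coroot_eq_sum P b i
    rw [coroot'_eq_sum P hf] at hw
    have hnn : ∀ j ∈ b.support, 0 ≤ (f j : ℝ) * P.coroot' j (wallPt P b J) := fun j hj => by
      rw [coroot'_wallPt P b J hj]
      have : (0 : ℝ) ≤ f j := by exact_mod_cast h0 hpos j
      split_ifs <;> simp [this]
    rw [Finset.sum_eq_zero_iff_of_nonneg hnn] at hw
    change P.coroot i ∈ Submodule.span ℝ (P.coroot '' J)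
    rw [hf]
    refine Submodule.sum_mem _ fun j hj => ?_
    by_cases h : j ∈ J
    · exact Submodule.smul_mem _ _ (Submodule.subset_span ⟨j, h, rfl⟩)
    · have := hw j hj
      rw [coroot'_wallPt P b J hj, if_neg h, mul_one] at this
      rw [this, zero_smul]
      exact zero_mem _
  by_cases hpos : b.IsPos i
  · exact key i hpos hw
  · rw [← negIdx_mem_leviSet]
    refine key _ ((isPos_negIdx P b i).2 hpos) ?_
    rw [coroot'_negIdx, hw, neg_zero]

include hJ in
lemma isPos_iff_wallPt {i : ι} (hi : i ∉ leviSet P J) :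
    b.IsPos i ↔ 0 < P.coroot' i (wallPt P b J) := by
  classical
  have key : ∀ i, b.IsPos i → 0 ≤ P.coroot' i (wallPt P b J) := by
    intro i hpos
    obtain ⟨f, hf, h0⟩ := coroot_eq_sum P b i
    rw [coroot'_eq_sum P hf]
    refine Finset.sum_nonneg fun j hj => ?_
    rw [coroot'_wallPt P b J hj]
    have : (0 : ℝ) ≤ f j := by exact_mod_cast h0 hpos j
    split_ifs <;> simp [this]
  refine ⟨fun h => lt_of_le_of_ne (key i h) fun h' => hi ((mem_leviSet_iff P b hJ).2 h'.symm),
    fun h => ?_⟩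
  by_contra hn
  have := key _ ((isPos_negIdx P b i).2 hn)
  rw [coroot'_negIdx] at this
  linarith

include hJ in
lemma reflGroup_wallPt {g : P.weylGroup} (hg : g ∈ reflGroup P (leviSet P J)) :
    g • wallPt P b J = wallPt P b J :=
  reflGroup_smul_eq P (fun _ hi => (mem_leviSet_iff P b hJ).1 hi) hg

include hJ in
lemma smul_mem_leviSet {g : P.weylGroup} (hg : g ∈ reflGroup P (leviSet P J)) {i : ι} :
    g • i ∈ leviSet P J ↔ i ∈ leviSet P J := by
  rw [mem_leviSet_iff P b hJ, mem_leviSet_iff P b hJ, coroot'_smul_idx,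
    reflGroup_wallPt P b hJ (inv_mem hg)]

include hJ in
-- Outside the Levi subsystem the sign of a coroot is the sign of its value at the fixed point
-- `wallPt`.
lemma isPos_smul_of_notMem {g : P.weylGroup} (hg : g ∈ reflGroup P (leviSet P J)) {i : ι}
    (hi : i ∉ leviSet P J) : b.IsPos (g • i) ↔ b.IsPos i := by
  have hi' : g • i ∉ leviSet P J := by rwa [smul_mem_leviSet P b hJ hg]
  rw [isPos_iff_wallPt P b hJ hi, isPos_iff_wallPt P b hJ hi', coroot'_smul_idx,
    reflGroup_wallPt P b hJ (inv_mem hg)]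

/-- In the orbit of `a`, a point whose product with `y` is maximal lies in the closed chamber of
`y`. -/
lemma exists_dominant_of_strict {S : Set ι} {y : V}
    (hy : ∀ i ∈ S, b.IsPos i → 0 < P.coroot' i y) (a : V) :
    ∃ g ∈ reflGroup P S, (∀ i ∈ S, b.IsPos i → 0 ≤ P.coroot' i (g • a)) ∧
      ∀ h ∈ reflGroup P S, P.RootForm (h • a) y ≤ P.RootForm (g • a) y := by
  obtain ⟨⟨g, hg⟩, hmax⟩ := Finite.exists_max
    (fun g : reflGroup P S => P.RootForm ((g : P.weylGroup) • a) y)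
  refine ⟨g, hg, fun i hi hpos => ?_, fun h hh => hmax ⟨h, hh⟩⟩
  have h1 := hmax ⟨RootPairing.weylGroup.ofIdx P i * g, mul_mem (ofIdx_mem_reflGroup P hi) hg⟩
  simp only [mul_smul] at h1
  rw [ofIdx_smul_eq] at h1
  simp only [map_sub, map_smul, LinearMap.sub_apply, LinearMap.smul_apply, smul_eq_mul] at h1
  have h2 := two_mul_rootForm_root P i y
  rw [rootForm_comm] at h2
  have h3 : 0 < P.RootForm (P.root i) y := by
    have := mul_pos (hy i hi hpos) (rootForm_root_self_pos P i)
    linarith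
  by_contra hneg
  have := mul_neg_of_neg_of_pos (not_le.1 hneg) h3
  linarith

lemma exists_dominant (S : Set ι) (a : V) :
    ∃ g ∈ reflGroup P S, ∀ i ∈ S, b.IsPos i → 0 ≤ P.coroot' i (g • a) := by
  obtain ⟨g, hg, h, -⟩ := exists_dominant_of_strict P b (S := S) (y := rhoPt P b)
    (fun i _ h => (isPos_iff_rhoPt P b i).1 h) a
  exact ⟨g, hg, h⟩

/-- Move the antidominant point `-rhoPt` into the closed chamber of `S` and invert the element used.
-/
lemma exists_longest (S : Set ι) :
    ∃ g ∈ reflGroup P S, ∀ i ∈ S, b.IsPos i → ¬ b.IsPos (g • i) := by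
  obtain ⟨g, hg, h⟩ := exists_dominant P b S (-rhoPt P b)
  refine ⟨g⁻¹, inv_mem hg, fun i hi hpos hn => ?_⟩
  have := h i hi hpos
  rw [smul_neg, map_neg, coroot'_smul] at this
  have := (isPos_iff_rhoPt P b _).1 hn
  linarith

include b in
-- Move `v` into the closed chamber, where regularity makes it strictly dominant. The conjugate of
-- `g` fixing that point must preserve positivity.
lemma weyl_eq_one_of_regular {v : V} (hv : ∀ i, P.coroot' i v ≠ 0) {g : P.weylGroup}
    (hg : g • v = v) : g = 1 := by
  obtain ⟨h, -, hd⟩ := exists_dominant P b Set.univ v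
  have key : h * g * h⁻¹ = 1 := by
    refine weyl_eq_one_of_isPos P b _ fun i hi => ?_
    by_contra hn
    have h1 := hd _ (Set.mem_univ _) ((isPos_negIdx P b _).2 hn)
    have h2 : (h * g * h⁻¹)⁻¹ • h • v = h • v := by
      rw [inv_smul_eq_iff, mul_smul, mul_smul, inv_smul_smul, hg]
    rw [coroot'_negIdx, coroot'_smul_idx, h2] at h1
    have h3 := hd i (Set.mem_univ _) hi
    have h4 : P.coroot' i (h • v) = 0 := le_antisymm (by linarith) h3
    rw [coroot'_smul] at h4
    exact hv _ h4
  rw [mul_inv_eq_one] at key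
  exact mul_eq_left.1 key

include hJ in
/-- A closed chamber of a Levi subsystem meets each orbit at most once. -/
lemma smul_eq_of_dominant {g : P.weylGroup} (hg : g ∈ reflGroup P (leviSet P J)) {v : V}
    (hv : ∀ i ∈ leviSet P J, b.IsPos i → 0 ≤ P.coroot' i v)
    (hgv : ∀ i ∈ leviSet P J, b.IsPos i → 0 ≤ P.coroot' i (g • v)) : g • v = v := by
  set ξ := rhoPt P b
  -- After the shift by `ε • ξ` both points are strictly dominant, so in the orbit of `v + ε • ξ`
  -- the product with `g • v + ε • ξ` is maximal at the identity.
  have key : ∀ ε : ℝ, 0 < ε →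
      P.RootForm (g • (v + ε • ξ)) (g • v + ε • ξ) ≤ P.RootForm (v + ε • ξ) (g • v + ε • ξ) := by
    intro ε hε
    have hst : ∀ u : V, (∀ i ∈ leviSet P J, b.IsPos i → 0 ≤ P.coroot' i u) →
        ∀ i ∈ leviSet P J, b.IsPos i → 0 < P.coroot' i (u + ε • ξ) := by
      intro u hu i hi hpos
      rw [map_add, map_smul, smul_eq_mul]
      have := mul_pos hε ((isPos_iff_rhoPt P b i).1 hpos)
      linarith [hu i hi hpos]
    obtain ⟨h, hh, hd, hmax⟩ := exists_dominant_of_strict P b (hst _ hgv) (v + ε • ξ)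
    have h1 : h⁻¹ = 1 := by
      refine weyl_eq_one_of_isPos P b _ fun i hi => ?_
      by_cases hiJ : i ∈ leviSet P J
      · by_contra hn
        have hmem : negIdx P (h⁻¹ • i) ∈ leviSet P J := by
          rwa [negIdx_mem_leviSet, smul_mem_leviSet P b hJ (inv_mem hh)]
        have h2 := hst v hv _ hmem ((isPos_negIdx P b _).2 hn)
        have h3 := hd i hiJ hi
        rw [coroot'_smul] at h3
        rw [coroot'_negIdx] at h2
        linarith
      · rwa [isPos_smul_of_notMem P b hJ (inv_mem hh) hiJ]
    rw [inv_eq_one] at h1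
    simpa [h1] using hmax g hg
  set A := P.RootForm v (g • v) - P.RootForm (g • v) (g • v)
  have hpoly : ∀ ε : ℝ, 0 < ε → 0 ≤ A + ε * (P.RootForm v ξ + P.RootForm ξ (g • v)
      - P.RootForm (g • v) ξ - P.RootForm (g • ξ) (g • v) + ε * (P.RootForm ξ ξ
        - P.RootForm (g • ξ) ξ)) := by
    intro ε hε
    have := key ε hε
    simp only [weyl_smul_add, weyl_smul_smul, map_add, map_smul, LinearMap.add_apply,
      LinearMap.smul_apply, smul_eq_mul] at this
    simp only [A]
    linarith
  -- Letting ε tend to 0 gives (gv, gv) ≤ (v, gv). As `g` is an isometry, this makes the squared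
  -- length of `g • v - v` nonpositive.
  have hA : 0 ≤ A := by
    set B := P.RootForm v ξ + P.RootForm ξ (g • v)
      - P.RootForm (g • v) ξ - P.RootForm (g • ξ) (g • v)
    set C := P.RootForm ξ ξ - P.RootForm (g • ξ) ξ
    have hc : Filter.Tendsto (fun ε : ℝ => A + ε * (B + ε * C)) (nhdsWithin 0 (Set.Ioi 0))
        (nhds (A + 0 * (B + 0 * C))) := by
      apply Filter.Tendsto.mono_left _ nhdsWithin_le_nhds
      apply Continuous.tendsto
      fun_prop
    have := ge_of_tendsto hc (Filter.eventually_of_mem self_mem_nhdsWithin fun ε hε => hpoly ε hε)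
    simpa using this
  have h0 : P.RootForm (g • v - v) (g • v - v) = 0 := by
    apply le_antisymm _ (rootForm_self_nonneg P _)
    simp only [map_sub, LinearMap.sub_apply]
    rw [← rootForm_smul_smul P g v v, rootForm_comm P (g • v) v]
    simp only [A] at hA
    linarith
  exact sub_eq_zero.1 (rootForm_self_eq_zero P h0)

include hJ in
-- Elements of the reflection group can flip only positive coroots of the Levi subsystem, and
-- `exists_longest` flips all of them. Length counts flips, so an element of maximal length flips
-- the same set.
lemma isLongest_flips {L : AffineSubspace ℝ V} (hL : constSet P L = leviSet P J)
    {w : P.weylGroup} (hw : IsLongest P b L w) {i : ι} (hi : i ∈ leviSet P J)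
    (hpos : b.IsPos i) : ¬ b.IsPos (w • i) := by
  have hfix : fixWeyl P L = reflGroup P (leviSet P J) := by rw [← hL]; rfl
  obtain ⟨g, hg, hflip⟩ := exists_longest P b (leviSet P J)
  have hle := hw.2 g (hfix ▸ hg)
  have hsub : ∀ u ∈ reflGroup P (leviSet P J), {i | b.IsPos i ∧ ¬ b.IsPos (u • i)} ⊆
      {i | b.IsPos i ∧ i ∈ leviSet P J} := by
    rintro u hu i ⟨h1, h2⟩
    refine ⟨h1, ?_⟩
    by_contra h3
    exact h2 ((isPos_smul_of_notMem P b hJ hu h3).2 h1)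
  have hgeq : {i | b.IsPos i ∧ ¬ b.IsPos (g • i)} = {i | b.IsPos i ∧ i ∈ leviSet P J} :=
    Set.Subset.antisymm (hsub g hg) fun i hi => ⟨hi.1, hflip i hi.2 hi.1⟩
  have := Set.eq_of_subset_of_ncard_le (hsub w (hfix ▸ hw.1))
    (by rw [← hgeq]; exact hle) (Set.toFinite _)
  have hmem : i ∈ {i | b.IsPos i ∧ i ∈ leviSet P J} := ⟨hpos, hi⟩
  rw [← this] at hmem
  exact hmem.2

lemma isLongest_longest (L : AffineSubspace ℝ V) : IsLongest P b L (longest P b L) := by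
  apply Classical.epsilon_spec (p := IsLongest P b L)
  obtain ⟨⟨g, hg⟩, hmax⟩ := Finite.exists_max (fun g : fixWeyl P L => length P b (g : P.weylGroup))
  exact ⟨g, hg, fun v hv => hmax ⟨v, hv⟩⟩

end Levi

/-! ### Division of an entire function by the equation of a hyperplane. -/

section Division

variable {E : Type*} [NormedAddCommGroup E] [NormedSpace ℂ E]

/-- The ring of entire functions has no zero divisors. -/
lemma eq_zero_of_mul_eq_zero {F₁ F₂ : E → ℂ} (h₁ : Differentiable ℂ F₁)
    (h₂ : Differentiable ℂ F₂) (h : ∀ e, F₁ e * F₂ e = 0) {e₀ : E} (h₀ : F₁ e₀ ≠ 0) (e : E) :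
    F₂ e = 0 := by
  -- Restricting to the complex line through `e` and `e₀` reduces the claim to one variable.
  have hl : Differentiable ℂ fun z : ℂ => e + z • (e₀ - e) := by fun_prop
  have ha : ∀ F : E → ℂ, Differentiable ℂ F →
      AnalyticOnNhd ℂ (fun z : ℂ => F (e + z • (e₀ - e))) Set.univ := fun F hF z _ =>
    (hF.comp hl).analyticAt z
  rcases AnalyticOnNhd.eq_zero_or_eq_zero_of_mul_eq_zero (ha F₁ h₁) (ha F₂ h₂)
    (fun z _ => h _) isPreconnected_univ with h' | h'
  · exact absurd (by simpa using h' 1 (Set.mem_univ _)) h₀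
  · simpa using h' 0 (Set.mem_univ _)

variable [FiniteDimensional ℂ E]

/-- A Cauchy estimate on unit balls; it supplies the dominating constant for differentiation under
the integral sign. -/
lemma exists_fderiv_bound {F : E → ℂ} (hF : Differentiable ℂ F) (e₀ : E) (M : ℝ) :
    ∃ C, 0 ≤ C ∧ ∀ e ∈ Metric.closedBall e₀ M, ‖F e‖ ≤ C ∧ ‖fderiv ℂ F e‖ ≤ C := by
  have : ProperSpace E := FiniteDimensional.proper ℂ E
  obtain ⟨C, hC⟩ := (isCompact_closedBall e₀ (M + 1)).exists_bound_of_continuousOn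
    hF.continuous.continuousOn
  refine ⟨2 * |C| + 1, by positivity, fun e he => ?_⟩
  have hmem : ∀ x ∈ Metric.ball e 1, ‖F x‖ ≤ |C| := fun x hx => by
    refine (hC x ?_).trans (le_abs_self C)
    rw [Metric.mem_closedBall] at he ⊢
    rw [Metric.mem_ball] at hx
    linarith [dist_triangle x e e₀]
  have h0 := hmem e (Metric.mem_ball_self one_pos)
  refine ⟨by linarith [abs_nonneg C], ?_⟩
  have := Complex.norm_fderiv_le_div_of_mapsTo_ball (f := F) (c := e) (R₁ := 1)
    (R₂ := 2 * |C| + 1) hF.differentiableOn (fun x hx => by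
      rw [Metric.mem_closedBall, dist_eq_norm]
      linarith [norm_sub_le (F x) (F e), hmem x hx]) one_pos
  simpa using this

/-- Up to a factor 2π the integral represents F/(ℓ+c) near the hyperplane when F vanishes there. On
the circle of radius 2 the denominator stays away from zero, so the integrand depends
holomorphically on the parameter. -/
lemma differentiableAt_circle {F : E → ℂ} (hF : Differentiable ℂ F) (ℓ : E →L[ℂ] ℂ) (c : ℂ)
    (v : E) {e₀ : E} (h₀ : ℓ e₀ + c = 0) :
    DifferentiableAt ℂ (fun e => ∫ θ in (0 : ℝ)..2 * Real.pi,
      F (e + circleMap 0 2 θ • v) * (ℓ e + c + circleMap 0 2 θ)⁻¹) e₀ := by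
  -- With this radius |ℓ e + c| ≤ 1 on the ball, so the denominators on the circle of radius 2 have
  -- modulus at least 1.
  set r : ℝ := (‖ℓ‖ + 1)⁻¹ with hr
  have hrpos : 0 < r := by positivity
  obtain ⟨C, hC0, hC⟩ := exists_fderiv_bound hF e₀ (r + 2 * ‖v‖)
  have hmem : ∀ e ∈ Metric.ball e₀ r, ∀ θ : ℝ,
      e + circleMap 0 2 θ • v ∈ Metric.closedBall e₀ (r + 2 * ‖v‖) := by
    intro e he θ
    rw [Metric.mem_ball, dist_eq_norm] at he
    rw [Metric.mem_closedBall, dist_eq_norm]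
    calc ‖e + circleMap 0 2 θ • v - e₀‖ = ‖(e - e₀) + circleMap 0 2 θ • v‖ := by congr 1; abel
      _ ≤ ‖e - e₀‖ + ‖circleMap 0 2 θ • v‖ := norm_add_le _ _
      _ ≤ r + 2 * ‖v‖ := by rw [norm_smul]; simp; linarith
  have hden : ∀ e ∈ Metric.ball e₀ r, ∀ θ : ℝ, 1 ≤ ‖ℓ e + c + circleMap 0 2 θ‖ := by
    intro e he θ
    rw [Metric.mem_ball, dist_eq_norm] at he
    have h1 : ℓ e + c = ℓ (e - e₀) := by rw [map_sub]; linear_combination h₀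
    have h2 : ‖ℓ (e - e₀)‖ ≤ 1 := by
      refine (ℓ.le_opNorm _).trans ?_
      calc ‖ℓ‖ * ‖e - e₀‖ ≤ (‖ℓ‖ + 1) * r := by gcongr; linarith
        _ = 1 := by rw [hr]; field_simp
    have h3 : ‖circleMap 0 2 θ‖ = 2 := by simp
    have h4 := norm_sub_norm_le (circleMap 0 2 θ) (-(ℓ e + c))
    rw [norm_neg, sub_neg_eq_add, add_comm (circleMap 0 2 θ), h1, h3] at h4
    rw [h1]; linarith
  have hne : ∀ e ∈ Metric.ball e₀ r, ∀ θ : ℝ, ℓ e + c + circleMap 0 2 θ ≠ 0 :=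
    fun e he θ h => by have := hden e he θ; rw [h, norm_zero] at this; linarith
  have hcont : ∀ e ∈ Metric.ball e₀ r, Continuous fun θ : ℝ =>
      F (e + circleMap 0 2 θ • v) * (ℓ e + c + circleMap 0 2 θ)⁻¹ := fun e he => by
    have := hF.continuous
    refine Continuous.mul (by fun_prop) (Continuous.inv₀ (by fun_prop) (hne e he))
  have hinv : Continuous fun θ : ℝ => (ℓ e₀ + c + circleMap 0 2 θ)⁻¹ :=
    Continuous.inv₀ (by fun_prop) (hne e₀ (Metric.mem_ball_self hrpos))
  refine HasFDerivAt.differentiableAt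
    (intervalIntegral.hasFDerivAt_integral_of_dominated_of_fderiv_le
    (F := fun e θ => F (e + circleMap 0 2 θ • v) * (ℓ e + c + circleMap 0 2 θ)⁻¹)
    (F' := fun e θ => F (e + circleMap 0 2 θ • v) • (-((ℓ e + c + circleMap 0 2 θ) ^ 2)⁻¹ • ℓ) +
      (ℓ e + c + circleMap 0 2 θ)⁻¹ • fderiv ℂ F (e + circleMap 0 2 θ • v))
    (s := Metric.ball e₀ r) (bound := fun _ => C * ‖ℓ‖ + C) (Metric.ball_mem_nhds e₀ hrpos)
    ?_ ?_ ?_ ?_ ?_ ?_)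
  · filter_upwards [Metric.ball_mem_nhds e₀ hrpos] with e he
    exact (hcont e he).aestronglyMeasurable
  · exact (hcont e₀ (Metric.mem_ball_self hrpos)).intervalIntegrable _ _
  · refine MeasureTheory.AEStronglyMeasurable.add ?_ ?_
    · refine Continuous.aestronglyMeasurable ?_
      have := hF.continuous
      simp only [← inv_pow]
      fun_prop
    · refine MeasureTheory.AEStronglyMeasurable.smul hinv.aestronglyMeasurable ?_
      borelize E
      borelize (E →L[ℂ] ℂ)
      have h1 : Measurable fun θ : ℝ => fderiv ℂ F (e₀ + circleMap 0 2 θ • v) :=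
        (measurable_fderiv ℂ F).comp (Continuous.measurable (by fun_prop))
      exact h1.aestronglyMeasurable
  · refine Filter.Eventually.of_forall fun θ _ e he => ?_
    have h1 := hC _ (hmem e he θ)
    have h2 := inv_le_one_of_one_le₀ (hden e he θ)
    have h3 : ‖(ℓ e + c + circleMap 0 2 θ)‖⁻¹ ^ 2 ≤ 1 := pow_le_one₀ (by positivity) h2
    refine (norm_add_le _ _).trans ?_
    rw [norm_smul, norm_smul, norm_smul, norm_neg, norm_inv, norm_inv, norm_pow, ← inv_pow]
    have h5 : ‖(ℓ e + c + circleMap 0 2 θ)‖⁻¹ ^ 2 * ‖ℓ‖ ≤ ‖ℓ‖ :=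
      mul_le_of_le_one_left (norm_nonneg _) h3
    have h6 : ‖F (e + circleMap 0 2 θ • v)‖ *
        (‖(ℓ e + c + circleMap 0 2 θ)‖⁻¹ ^ 2 * ‖ℓ‖) ≤ C * ‖ℓ‖ :=
      mul_le_mul h1.1 h5 (by positivity) hC0
    have h7 : ‖(ℓ e + c + circleMap 0 2 θ)‖⁻¹ * ‖fderiv ℂ F (e + circleMap 0 2 θ • v)‖ ≤ C :=
      (mul_le_of_le_one_left (norm_nonneg _) h2).trans h1.2
    linarith
  · exact intervalIntegrable_const
  · refine Filter.Eventually.of_forall fun θ _ e he => ?_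
    have h1 : HasFDerivAt (fun e => F (e + circleMap 0 2 θ • v))
        (fderiv ℂ F (e + circleMap 0 2 θ • v)) e :=
      (hasFDerivAt_comp_add_right _).2 (hF _).hasFDerivAt
    have h2 : HasFDerivAt (fun e => (ℓ e + c + circleMap 0 2 θ)⁻¹)
        (-((ℓ e + c + circleMap 0 2 θ) ^ 2)⁻¹ • ℓ) e := by
      have h3 : HasFDerivAt (fun e => ℓ e + c + circleMap 0 2 θ) ℓ e :=
        (ℓ.hasFDerivAt.add_const c).add_const _
      exact (hasDerivAt_inv (hne e he θ)).comp_hasFDerivAt e h3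
    exact h1.mul h2

/-- An entire function vanishing on a hyperplane is divisible by its equation. -/
lemma exists_eq_mul_of_vanish {F : E → ℂ} (hF : Differentiable ℂ F) (ℓ : E →L[ℂ] ℂ) (c : ℂ)
    {v : E} (hv : ℓ v = 1) (h : ∀ e, ℓ e + c = 0 → F e = 0) :
    ∃ G : E → ℂ, Differentiable ℂ G ∧ ∀ e, F e = (ℓ e + c) * G e := by
  classical
  have hline : ∀ e, Differentiable ℂ fun z : ℂ => F (e + z • v) := fun e => by fun_prop
  -- The line `e + z • v` meets the hyperplane at `z = -(ℓ e + c)`. The slope is the quotient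
  -- F/(ℓ+c) off the hyperplane and the derivative along `v` on it.
  set G : E → ℂ := fun e => dslope (fun z : ℂ => F (e + z • v)) (-(ℓ e + c)) 0 with hG
  have hGv : ∀ e, ℓ e + c ≠ 0 → G e = F e / (ℓ e + c) := by
    intro e he
    have h1 : F (e + (-(ℓ e + c)) • v) = 0 := h _ (by rw [map_add, map_smul, hv, smul_eq_mul]; ring)
    rw [hG]
    simp only
    rw [dslope_of_ne _ (fun h => he (neg_eq_zero.1 h.symm)), slope_def_field, h1]
    simp
  have hdiv : ∀ e, F e = (ℓ e + c) * G e := by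
    intro e
    by_cases he : ℓ e + c = 0
    · rw [h e he, he, zero_mul]
    · rw [hGv e he]; field_simp
  refine ⟨G, fun e₀ => ?_, hdiv⟩
  by_cases he : ℓ e₀ + c = 0
  · refine ((differentiableAt_circle hF ℓ c v he).const_mul ((2 * Real.pi)⁻¹ : ℂ)).congr_of_eventuallyEq
      ?_
    have hnear : ∀ᶠ e in nhds e₀, ‖ℓ e + c‖ < 2 := by
      have : Continuous fun e => ‖ℓ e + c‖ := by fun_prop
      refine this.continuousAt.eventually_lt continuousAt_const ?_
      rw [he]; simp
    filter_upwards [hnear] with e hlt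
    have hd : Differentiable ℂ (dslope (fun z : ℂ => F (e + z • v)) (-(ℓ e + c))) := by
      rw [← differentiableOn_univ, Complex.differentiableOn_dslope Filter.univ_mem,
        differentiableOn_univ]
      exact hline e
    -- The mean value property recovers `G e` from the circle, where the removable singularity is
    -- never met.
    have hav := DiffContOnCl.circleAverage (c := 0) (R := 2)
      (f := dslope (fun z : ℂ => F (e + z • v)) (-(ℓ e + c))) hd.diffContOnCl
    rw [Real.circleAverage_def] at hav
    rw [hG]
    simp only
    rw [← hav, Complex.real_smul]
    push_cast
    congr 1
    refine intervalIntegral.integral_congr fun θ _ => ?_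
    have hne : circleMap 0 2 θ ≠ -(ℓ e + c) := fun h => by
      have h2 : ‖circleMap 0 2 θ‖ = 2 := by simp
      rw [h, norm_neg] at h2
      linarith
    have h1 : F (e + (-(ℓ e + c)) • v) = 0 :=
      h _ (by rw [map_add, map_smul, hv, smul_eq_mul]; ring)
    rw [dslope_of_ne _ hne, slope_def_field, h1, sub_zero, sub_neg_eq_add, div_eq_mul_inv,
      add_comm (circleMap 0 2 θ) (ℓ e + c)]
  · have hnear : ∀ᶠ e in nhds e₀, ℓ e + c ≠ 0 := by
      have : Continuous fun e => ℓ e + c := by fun_prop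
      exact this.continuousAt.eventually_ne he
    have hd : DifferentiableAt ℂ (fun e => F e / (ℓ e + c)) e₀  := by
      simp only [div_eq_mul_inv]
      exact (hF e₀).fun_mul (DifferentiableAt.fun_inv (by fun_prop) he)
    exact hd.congr_of_eventuallyEq (hnear.mono hGv)

end Division

/-! ### Division by products of affine functions. -/

section ProdDivision

variable {E : Type*} [NormedAddCommGroup E] [NormedSpace ℂ E]

lemma differentiable_finset_prod {κ : Type*} (s : Finset κ) {F : κ → E → ℂ}
    (h : ∀ k ∈ s, Differentiable ℂ (F k)) : Differentiable ℂ fun e => ∏ k ∈ s, F k e := by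
  classical
  induction s using Finset.induction_on with
  | empty => simp
  | insert i s hi ih =>
    simp only [Finset.prod_insert hi]
    exact (h i (Finset.mem_insert_self _ _)).fun_mul
      (ih fun j hj => h j (Finset.mem_insert_of_mem hj))

lemma differentiable_multiset_prod {κ : Type*} (s : Multiset κ) {F : κ → E → ℂ}
    (h : ∀ k ∈ s, Differentiable ℂ (F k)) :
    Differentiable ℂ fun e => (s.map fun k => F k e).prod := by
  induction s using Multiset.induction_on with
  | empty => simp
  | cons i s ih =>
    simp only [Multiset.map_cons, Multiset.prod_cons]
    exact (h i (Multiset.mem_cons_self _ _)).fun_mul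
      (ih fun j hj => h j (Multiset.mem_cons_of_mem hj))

variable [FiniteDimensional ℂ E]

lemma exists_apply_eq_one {ℓ : E →L[ℂ] ℂ} (h : ℓ ≠ 0) : ∃ v, ℓ v = 1 := by
  obtain ⟨u, hu⟩ : ∃ u, ℓ u ≠ 0 := by
    by_contra! hc
    exact h (ContinuousLinearMap.ext hc)
  exact ⟨(ℓ u)⁻¹ • u, by rw [map_smul, smul_eq_mul, inv_mul_cancel₀ hu]⟩

/-- If `F R` vanishes on a hyperplane on which `R` does not vanish identically, then the equation of
the hyperplane divides `F`. -/
lemma exists_eq_mul_of_mul_vanish {F R : E → ℂ} (hF : Differentiable ℂ F)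
    (hR : Differentiable ℂ R) {ℓ : E →L[ℂ] ℂ} (hℓ : ℓ ≠ 0) (c : ℂ)
    (hFR : ∀ e, ℓ e + c = 0 → F e * R e = 0) (hne : ∃ e, ℓ e + c = 0 ∧ R e ≠ 0) :
    ∃ G : E → ℂ, Differentiable ℂ G ∧ ∀ e, F e = (ℓ e + c) * G e := by
  obtain ⟨v, hv⟩ := exists_apply_eq_one hℓ
  refine exists_eq_mul_of_vanish hF ℓ c hv fun e he => ?_
  obtain ⟨e₀, h₀, hR₀⟩ := hne
  -- This map projects onto the hyperplane, so the absence of zero divisors can be used there.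
  have hproj : Differentiable ℂ fun e => e - (ℓ e + c) • v := by fun_prop
  have key := eq_zero_of_mul_eq_zero (F₁ := fun e => R (e - (ℓ e + c) • v))
    (F₂ := fun e => F (e - (ℓ e + c) • v)) (hR.comp hproj) (hF.comp hproj) (fun e => by
      rw [mul_comm]
      apply hFR
      rw [map_sub, map_smul, hv, smul_eq_mul]; ring) (e₀ := e₀) (by simpa [h₀] using hR₀) e
  simpa [he] using key

/-- Factors are removed one at a time. A nonzero constant is harmless; a genuine hyperplane equation
divides `F R`, hence `F`, because `R` does not vanish identically on that hyperplane. -/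
lemma exists_eq_prod_mul {κ : Type*} (s : Finset κ) (ℓ : κ → E →L[ℂ] ℂ) (c : κ → ℂ) {F R M : E → ℂ}
    (hF : Differentiable ℂ F) (hR : Differentiable ℂ R) (hM : Differentiable ℂ M)
    (hFR : ∀ e, F e * R e = (∏ j ∈ s, (ℓ j e + c j)) * M e)
    (hs : ∀ j ∈ s, (ℓ j = 0 ∧ c j ≠ 0) ∨ (ℓ j ≠ 0 ∧ ∃ e, ℓ j e + c j = 0 ∧ R e ≠ 0)) :
    ∃ G : E → ℂ, Differentiable ℂ G ∧ ∀ e, F e = (∏ j ∈ s, (ℓ j e + c j)) * G e := by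
  classical
  induction s using Finset.induction_on generalizing F with
  | empty => exact ⟨F, hF, by simp⟩
  | insert j s hj ih =>
    have hs' := fun k (hk : k ∈ s) => hs k (Finset.mem_insert_of_mem hk)
    have hne : ∃ e, ℓ j e + c j ≠ 0 := by
      rcases hs j (Finset.mem_insert_self _ _) with ⟨h1, h2⟩ | ⟨h1, e, h2, -⟩
      · exact ⟨0, by simpa [h1] using h2⟩
      · obtain ⟨v, hv⟩ := exists_apply_eq_one h1
        refine ⟨e + v, ?_⟩
        rw [map_add, hv, add_right_comm, h2]; simp
    obtain ⟨G₁, hG₁, hG₁'⟩ : ∃ G : E → ℂ, Differentiable ℂ G ∧ ∀ e, F e = (ℓ j e + c j) * G e := by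
      rcases hs j (Finset.mem_insert_self _ _) with ⟨h1, h2⟩ | ⟨h1, h2⟩
      · exact ⟨fun e => (c j)⁻¹ * F e, hF.const_mul _, fun e => by simp [h1, h2]⟩
      · refine exists_eq_mul_of_mul_vanish hF hR h1 (c j) (fun e he => ?_) h2
        rw [hFR, Finset.prod_insert hj, he]; ring
    have hstep : ∀ e, G₁ e * R e = (∏ k ∈ s, (ℓ k e + c k)) * M e := by
      intro e
      obtain ⟨e₀, h₀⟩ := hne
      have := eq_zero_of_mul_eq_zero (F₁ := fun e => ℓ j e + c j)
        (F₂ := fun e => G₁ e * R e - (∏ k ∈ s, (ℓ k e + c k)) * M e) (by fun_prop)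
        ((hG₁.fun_mul hR).fun_sub
          ((differentiable_finset_prod s fun k _ => by fun_prop).fun_mul hM))
        (fun e => by
          have := hFR e
          rw [Finset.prod_insert hj, hG₁'] at this
          linear_combination this) h₀ e
      exact sub_eq_zero.1 this
    obtain ⟨G, hG, hG'⟩ := ih hG₁ hstep hs'
    exact ⟨G, hG, fun e => by rw [hG₁', hG', Finset.prod_insert hj, mul_assoc]⟩

/-- Because the hyperplanes are distinct, dividing by one equation keeps the vanishing along the
others. -/
lemma exists_eq_prod_mul_of_vanish {κ : Type*} (s : Finset κ) (ℓ : κ → E →L[ℂ] ℂ) (c : κ → ℂ)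
    {F : E → ℂ} (hF : Differentiable ℂ F) (hℓ : ∀ j ∈ s, ℓ j ≠ 0)
    (h0 : ∀ j ∈ s, ∀ e, ℓ j e + c j = 0 → F e = 0)
    (hs : ∀ j ∈ s, ∀ k ∈ s, j ≠ k → ∃ e, ℓ j e + c j = 0 ∧ ℓ k e + c k ≠ 0) :
    ∃ G : E → ℂ, Differentiable ℂ G ∧ ∀ e, F e = (∏ j ∈ s, (ℓ j e + c j)) * G e := by
  classical
  induction s using Finset.induction_on generalizing F with
  | empty => exact ⟨F, hF, by simp⟩
  | insert j s hj ih =>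
    obtain ⟨v, hv⟩ := exists_apply_eq_one (hℓ j (Finset.mem_insert_self _ _))
    obtain ⟨G₁, hG₁, hG₁'⟩ := exists_eq_mul_of_vanish hF (ℓ j) (c j) hv
      (h0 j (Finset.mem_insert_self _ _))
    obtain ⟨G, hG, hG'⟩ := ih hG₁ (fun k hk => hℓ k (Finset.mem_insert_of_mem hk))
      (fun k hk e he => by
        have hjk : k ≠ j := fun h => hj (h ▸ hk)
        obtain ⟨u, hu⟩ := exists_apply_eq_one (hℓ k (Finset.mem_insert_of_mem hk))
        obtain ⟨e₀, h₀, hne⟩ := hs k (Finset.mem_insert_of_mem hk) j (Finset.mem_insert_self _ _) hjk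
        have hproj : Differentiable ℂ fun e => e - (ℓ k e + c k) • u := by fun_prop
        have := eq_zero_of_mul_eq_zero (F₁ := fun e => ℓ j (e - (ℓ k e + c k) • u) + c j)
          (F₂ := fun e => G₁ (e - (ℓ k e + c k) • u)) (by fun_prop) (hG₁.comp hproj) (fun e => by
            rw [← hG₁']
            apply h0 k (Finset.mem_insert_of_mem hk)
            rw [map_sub, map_smul, hu, smul_eq_mul]; ring) (e₀ := e₀) (by simpa [h₀] using hne) e
        simpa [he] using this)
      (fun k hk l hl => hs k (Finset.mem_insert_of_mem hk) l (Finset.mem_insert_of_mem hl))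
    exact ⟨G, hG, fun e => by rw [hG₁', hG', Finset.prod_insert hj, mul_assoc]⟩

end ProdDivision

/-! ### Holomorphic functions on complexified affine subspaces. -/

section Hol

variable {V : Type*} [AddCommGroup V] [Module ℝ V]

/-- The point of the complexification with given coordinates. -/
def cpt {n : ℕ} (p : V) (u : Fin n → V) (z : Fin n → ℂ) : V × V :=
  (p + ∑ j, (z j).re • u j, ∑ j, (z j).im • u j)

/-- The complexification of a linear form. -/
def clin (f : V →ₗ[ℝ] ℝ) (l : V × V) : ℂ := (f l.1 : ℂ) + Complex.I * (f l.2 : ℂ)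

lemma clin_cpt (f : V →ₗ[ℝ] ℝ) {n : ℕ} (p : V) (u : Fin n → V) (z : Fin n → ℂ) :
    clin f (cpt p u z) = f p + ∑ j, z j * f (u j) := by
  simp only [clin, cpt, map_add, map_sum, map_smul, smul_eq_mul]
  push_cast
  rw [add_assoc, Finset.mul_sum, ← Finset.sum_add_distrib]
  congr 1
  refine Finset.sum_congr rfl fun j _ => ?_
  conv_rhs => rw [← Complex.re_add_im (z j)]
  ring

lemma holOn_clin (L : AffineSubspace ℝ V) (f : V →ₗ[ℝ] ℝ) : HolOn L (clin f) := by
  intro p _ n u _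
  change Differentiable ℂ fun z => clin f (cpt p u z)
  simp only [clin_cpt]
  fun_prop

lemma HolOn.mono {L M : AffineSubspace ℝ V} (h : L ≤ M) {F : V × V → ℂ} (hF : HolOn M F) :
    HolOn L F := fun p hp n u hu =>
  hF p (h hp) n u fun j => AffineSubspace.direction_le h (hu j)

variable {L : AffineSubspace ℝ V} {F G : V × V → ℂ}

lemma HolOn.mul (hF : HolOn L F) (hG : HolOn L G) : HolOn L fun l => F l * G l :=
  fun p hp n u hu => (hF p hp n u hu).fun_mul (hG p hp n u hu)

lemma HolOn.add (hF : HolOn L F) (hG : HolOn L G) : HolOn L fun l => F l + G l :=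
  fun p hp n u hu => (hF p hp n u hu).fun_add (hG p hp n u hu)

lemma HolOn.sub (hF : HolOn L F) (hG : HolOn L G) : HolOn L fun l => F l - G l :=
  fun p hp n u hu => (hF p hp n u hu).fun_sub (hG p hp n u hu)

lemma HolOn.const (c : ℂ) : HolOn L fun _ => c := fun _ _ _ _ _ => by fun_prop

lemma HolOn.comp {ρ : ℂ → ℂ} (hρ : Differentiable ℂ ρ) (hF : HolOn L F) :
    HolOn L fun l => ρ (F l) :=
  fun p hp n u hu => hρ.comp (hF p hp n u hu)

lemma HolOn.sum {κ : Type*} (s : Finset κ) {F : κ → V × V → ℂ} (hF : ∀ i ∈ s, HolOn L (F i)) :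
    HolOn L fun l => ∑ i ∈ s, F i l :=
  fun p hp n u hu => Differentiable.fun_sum fun i hi => hF i hi p hp n u hu

lemma HolOn.prod {κ : Type*} (s : Finset κ) {F : κ → V × V → ℂ} (hF : ∀ i ∈ s, HolOn L (F i)) :
    HolOn L fun l => ∏ i ∈ s, F i l := by
  classical
  induction s using Finset.induction_on with
  | empty => simpa using HolOn.const 1
  | insert i s hi ih =>
    simp only [Finset.prod_insert hi]
    exact (hF i (Finset.mem_insert_self _ _)).mul
      (ih fun j hj => hF j (Finset.mem_insert_of_mem hj))

lemma HolOn.multiset_prod {κ : Type*} (s : Multiset κ) {F : κ → V × V → ℂ}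
    (hF : ∀ i ∈ s, HolOn L (F i)) : HolOn L fun l => (s.map fun i => F i l).prod := by
  induction s using Multiset.induction_on with
  | empty => simpa using HolOn.const 1
  | cons i s ih =>
    simp only [Multiset.map_cons, Multiset.prod_cons]
    exact (hF i (Multiset.mem_cons_self _ _)).mul
      (ih fun j hj => hF j (Multiset.mem_cons_of_mem hj))

lemma HolOn.pow (hF : HolOn L F) (k : ℕ) : HolOn L fun l => F l ^ k :=
  fun p hp n u hu => (hF p hp n u hu).fun_pow k

/-- Composition with a linear map of the real space. -/
lemma HolOn.comp_linear (hF : HolOn ⊤ F) (A : V →ₗ[ℝ] V) :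
    HolOn ⊤ fun l => F (A l.1, A l.2) := by
  intro p _ n u _
  have := hF (A p) (AffineSubspace.mem_top _ _ _) n (fun j => A (u j)) (by simp)
  convert this using 3 with z
  simp [map_sum]

lemma HolOn.smul {G' : Type*} [Group G'] [DistribMulAction G' V] [SMulCommClass G' ℝ V]
    (hF : HolOn ⊤ F) (w : G') : HolOn ⊤ fun l => F (w • l) :=
  hF.comp_linear (DistribSMul.toLinearMap ℝ V w)

lemma HolOn.neg_arg (hF : HolOn ⊤ F) : HolOn ⊤ fun l => F (-l) :=
  hF.comp_linear (-LinearMap.id)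

/-! ### Coordinates -/

/-- A linear projection onto the direction of `L`. -/
def dirProj (L : AffineSubspace ℝ V) : V →ₗ[ℝ] V :=
  L.direction.subtype ∘ₗ
    (L.direction.subtype.exists_leftInverse_of_injective (Submodule.ker_subtype _)).choose

lemma dirProj_mem (L : AffineSubspace ℝ V) (v : V) : dirProj L v ∈ L.direction :=
  Submodule.coe_mem _

lemma dirProj_of_mem {L : AffineSubspace ℝ V} {v : V} (hv : v ∈ L.direction) :
    dirProj L v = v := by
  have h := (L.direction.subtype.exists_leftInverse_of_injective
    (Submodule.ker_subtype _)).choose_spec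
  exact congrArg Subtype.val (LinearMap.congr_fun h ⟨v, hv⟩)

/-- The projection of the complexification of `V` onto that of `L`. -/
def cproj (L : AffineSubspace ℝ V) (p₀ : V) (l : V × V) : V × V :=
  (p₀ + dirProj L (l.1 - p₀), dirProj L l.2)

lemma cproj_mem {p₀ : V} (hp : p₀ ∈ L) (l : V × V) : cproj L p₀ l ∈ cpts L := by
  refine ⟨?_, dirProj_mem _ _⟩
  have := AffineSubspace.vadd_mem_of_mem_direction (dirProj_mem L (l.1 - p₀)) hp
  rwa [vadd_eq_add, add_comm] at this

lemma cproj_of_mem {p₀ : V} (hp : p₀ ∈ L) {l : V × V} (hl : l ∈ cpts L) : cproj L p₀ l = l := by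
  refine Prod.ext ?_ (dirProj_of_mem hl.2)
  have : l.1 - p₀ ∈ L.direction := AffineSubspace.vsub_mem_direction hl.1 hp
  simp [cproj, dirProj_of_mem this]

/-- Pulling back along a projection extends functions from the complexification of `L` to all of the
complexified space, so the division lemmas apply without coordinates on `L`. -/
lemma holOn_cproj {p₀ : V} (hp : p₀ ∈ L) (hF : HolOn L F) : HolOn ⊤ fun l => F (cproj L p₀ l) := by
  intro p _ n u _
  have := hF (p₀ + dirProj L (p - p₀)) (cproj_mem hp (p, 0)).1 n (fun j => dirProj L (u j))
    fun j => dirProj_mem _ _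
  convert this using 3 with z
  refine Prod.ext ?_ ?_
  · simp only [cproj]
    rw [add_sub_right_comm, map_add, map_sum]
    simp [add_assoc]
  · simp [cproj, map_sum]

variable [FiniteDimensional ℝ V]

/-- The coordinate space of the complexification. -/
abbrev CV (V : Type*) [AddCommGroup V] [Module ℝ V] : Type := Fin (Module.finrank ℝ V) → ℂ

/-- The coordinate isomorphism. -/
def kap (z : CV V) : V × V := cpt 0 (Module.finBasis ℝ V) z

/-- The inverse of the coordinate isomorphism. -/
def kapInv (l : V × V) : CV V := fun j => clin ((Module.finBasis ℝ V).coord j) l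

lemma kap_kapInv (l : V × V) : kap (kapInv l) = l := by
  refine Prod.ext ?_ ?_
  · simp [kap, kapInv, cpt, clin]
  · simp [kap, kapInv, cpt, clin]

lemma kapInv_cpt {n : ℕ} (p : V) (u : Fin n → V) (z : Fin n → ℂ) :
    kapInv (cpt p u z) = fun i => ((Module.finBasis ℝ V).coord i p : ℂ) +
      ∑ j, z j * ((Module.finBasis ℝ V).coord i (u j) : ℂ) := by
  funext i
  rw [kapInv, clin_cpt]

lemma holOn_top_iff : HolOn ⊤ F ↔ Differentiable ℂ fun z : CV V => F (kap z) := by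
  refine ⟨fun h => h 0 (AffineSubspace.mem_top _ _ _) _ _ (by simp), fun h p _ n u _ => ?_⟩
  have h2 : (fun z : Fin n → ℂ => F (p + ∑ j, (z j).re • u j, ∑ j, (z j).im • u j)) =
      fun z => F (kap (kapInv (cpt p u z))) := by
    funext z; rw [kap_kapInv]; rfl
  rw [h2]
  simp only [kapInv_cpt]
  refine h.comp ?_
  fun_prop

lemma holOn_eq_zero_of_mul {p₀ : V} (hp : p₀ ∈ L) (hF : HolOn L F) (hG : HolOn L G)
    (h : ∀ l ∈ cpts L, F l * G l = 0) (hne : ∃ l ∈ cpts L, F l ≠ 0) :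
    ∀ l ∈ cpts L, G l = 0 := by
  intro l hl
  obtain ⟨l₀, hl₀, hne⟩ := hne
  have := eq_zero_of_mul_eq_zero (holOn_top_iff.1 (holOn_cproj hp hF))
    (holOn_top_iff.1 (holOn_cproj hp hG)) (fun z => h _ (cproj_mem hp _)) (e₀ := kapInv l₀)
    (by rwa [kap_kapInv, cproj_of_mem hp hl₀]) (kapInv l)
  rwa [kap_kapInv, cproj_of_mem hp hl] at this

lemma holOn_prod_ne_zero {p₀ : V} (hp : p₀ ∈ L) {κ : Type*} (s : Finset κ) {F : κ → V × V → ℂ}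
    (hF : ∀ i ∈ s, HolOn L (F i)) (hne : ∀ i ∈ s, ∃ l ∈ cpts L, F i l ≠ 0) :
    ∃ l ∈ cpts L, ∏ i ∈ s, F i l ≠ 0 := by
  classical
  induction s using Finset.induction_on with
  | empty => exact ⟨(p₀, 0), ⟨hp, zero_mem _⟩, by simp⟩
  | insert i s hi ih =>
    obtain ⟨l₀, hl₀, h₀⟩ := ih (fun j hj => hF j (Finset.mem_insert_of_mem hj))
      fun j hj => hne j (Finset.mem_insert_of_mem hj)
    by_contra! hc
    refine h₀ (holOn_eq_zero_of_mul hp (hF i (Finset.mem_insert_self _ _))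
      (HolOn.prod s fun j hj => hF j (Finset.mem_insert_of_mem hj)) (fun l hl => ?_)
      (hne i (Finset.mem_insert_self _ _)) l₀ hl₀)
    rw [← hc l hl, Finset.prod_insert hi]

end Hol

/-! ### Sums over cosets of reflection groups and their signs. -/

section Coset

variable {ι V N : Type*} [Fintype ι] [AddCommGroup V] [Module ℝ V] [AddCommGroup N] [Module ℝ N]
  (P : RootPairing ι ℝ V N) [P.IsRootSystem] [P.IsCrystallographic] [P.IsReduced] (b : P.Base)

lemma ccoroot_smul (w : P.weylGroup) (i : ι) (l : V × V) :
    ccoroot P i (w • l) = ccoroot P (w⁻¹ • i) l := by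
  simp only [ccoroot, Prod.smul_fst, Prod.smul_snd, coroot'_smul]

lemma ccoroot_negIdx (i : ι) (l : V × V) : ccoroot P (negIdx P i) l = -ccoroot P i l := by
  simp only [ccoroot, coroot'_negIdx]; push_cast; ring

lemma ccoroot_neg (i : ι) (l : V × V) : ccoroot P i (-l) = -ccoroot P i l := by
  simp only [ccoroot, Prod.fst_neg, Prod.snd_neg, map_neg]; push_cast; ring

lemma ccoroot_eq_clin (i : ι) : ccoroot P i = clin (P.coroot' i) := rfl

lemma holOn_ccoroot (L : AffineSubspace ℝ V) (i : ι) : HolOn L (ccoroot P i) :=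
  holOn_clin L _

lemma holOn_ccoroot_smul (w : P.weylGroup) (L : AffineSubspace ℝ V) (i : ι) :
    HolOn L fun l => ccoroot P i (w • l) := by
  simp only [ccoroot_smul]
  exact holOn_ccoroot P L _

lemma ofIdx_smul_of_ccoroot_eq_zero {i : ι} {l : V × V} (h : ccoroot P i l = 0) :
    RootPairing.weylGroup.ofIdx P i • l = l := by
  have h1 : P.coroot' i l.1 = 0 := by
    have := congrArg Complex.re h; simpa [ccoroot] using this
  have h2 : P.coroot' i l.2 = 0 := by
    have := congrArg Complex.im h; simpa [ccoroot] using this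
  refine Prod.ext ?_ ?_
  · rw [Prod.smul_fst, ofIdx_smul_eq, h1, zero_smul, sub_zero]
  · rw [Prod.smul_snd, ofIdx_smul_eq, h2, zero_smul, sub_zero]

/-- The data of a positive system `pos`, a subsystem `sub`, and a coset `reps` of the reflection
group of `sub`. -/
structure CosetDatum where
  /-- the positive system -/
  pos : Set ι
  /-- the subsystem -/
  sub : Set ι
  /-- the coset -/
  reps : Set P.weylGroup
  /-- an element of the coset -/
  base : P.weylGroup
  neg_mem_pos : ∀ i, negIdx P i ∈ pos ↔ i ∉ pos
  neg_mem_sub : ∀ i, negIdx P i ∈ sub ↔ i ∈ sub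
  refl_mem_sub : ∀ i ∈ sub, ∀ j ∈ sub, RootPairing.weylGroup.ofIdx P i • j ∈ sub
  mem_reps : ∀ w, w ∈ reps ↔ w * base⁻¹ ∈ reflGroup P sub

namespace CosetDatum

variable {P} (D : CosetDatum P)

open Classical in
/-- The positive indices in the subsystem. -/
def idx : Finset ι := Finset.univ.filter fun i => i ∈ D.pos ∧ i ∈ D.sub

open Classical in
/-- The positive indices. -/
def posIdx : Finset ι := Finset.univ.filter fun i => i ∈ D.pos

/-- The coset as a finite set. -/
def coset : Finset P.weylGroup := (Set.toFinite D.reps).toFinset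

lemma mem_idx {i : ι} : i ∈ D.idx ↔ i ∈ D.pos ∧ i ∈ D.sub := by simp [idx]

lemma mem_posIdx {i : ι} : i ∈ D.posIdx ↔ i ∈ D.pos := by simp [posIdx]

lemma mem_coset {w : P.weylGroup} : w ∈ D.coset ↔ w * D.base⁻¹ ∈ reflGroup P D.sub := by
  simp [coset, D.mem_reps]

/-- The sum over the coset. -/
def sumF (ρ : ℂ → ℂ) (φ : V × V → ℂ) (l : V × V) : ℂ :=
  ∑ w ∈ D.coset, (∏ i ∈ D.idx, (ccoroot P i (w • l) + 1) / ccoroot P i (w • l)) *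
    ((∏ i ∈ D.posIdx, ρ (ccoroot P i (w • l))) / ∏ i ∈ D.posIdx, ρ (ccoroot P i l)) * φ (w • l)

open Classical in
/-- The positive one among the indices `i` and `-i`. -/
def absIdx (i : ι) : ι := if i ∈ D.pos then i else negIdx P i

open Classical in
lemma ccoroot_absIdx (i : ι) (l : V × V) :
    ccoroot P i l = (if i ∈ D.pos then 1 else -1) * ccoroot P (D.absIdx i) l := by
  unfold absIdx
  split_ifs
  · ring
  · rw [ccoroot_negIdx]; ring

lemma absIdx_mem_pos (i : ι) : D.absIdx i ∈ D.pos := by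
  unfold absIdx
  split_ifs with h
  · exact h
  · rwa [D.neg_mem_pos]

lemma absIdx_mem_sub {i : ι} (h : i ∈ D.sub) : D.absIdx i ∈ D.sub := by
  unfold absIdx
  split_ifs
  · exact h
  · rwa [D.neg_mem_sub]

lemma absIdx_of_mem {i : ι} (h : i ∈ D.pos) : D.absIdx i = i := if_pos h

lemma absIdx_of_notMem {i : ι} (h : i ∉ D.pos) : D.absIdx i = negIdx P i := if_neg h

lemma absIdx_negIdx (i : ι) : D.absIdx (negIdx P i) = D.absIdx i := by
  by_cases h : i ∈ D.pos
  · rw [D.absIdx_of_mem h, D.absIdx_of_notMem (by rwa [D.neg_mem_pos, not_not]), negIdx_negIdx]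
  · rw [D.absIdx_of_notMem h, D.absIdx_of_mem (by rwa [D.neg_mem_pos])]

lemma absIdx_smul_absIdx (s : P.weylGroup) (i : ι) :
    D.absIdx (s • D.absIdx i) = D.absIdx (s • i) := by
  by_cases h : i ∈ D.pos
  · rw [D.absIdx_of_mem h]
  · rw [D.absIdx_of_notMem h, weyl_smul_negIdx, absIdx_negIdx]

/-- A reflection in the subsystem changes the sign of the product of its positive coroots. -/
lemma prod_ofIdx_smul {j : ι} (hj : j ∈ D.sub) (l : V × V) :
    ∏ i ∈ D.idx, ccoroot P i (RootPairing.weylGroup.ofIdx P j • l) =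
      -∏ i ∈ D.idx, ccoroot P i l := by
  classical
  wlog hpos : j ∈ D.pos generalizing j
  · rw [← ofIdx_negIdx]
    exact this ((D.neg_mem_sub j).2 hj) ((D.neg_mem_pos j).2 hpos)
  set s := RootPairing.weylGroup.ofIdx P j with hs
  have hss : ∀ i : ι, s • s • i = i := fun i => by rw [smul_smul, hs, ofIdx_mul_self, one_smul]
  have hmem : ∀ i ∈ D.idx, D.absIdx (s • i) ∈ D.idx := fun i hi =>
    D.mem_idx.2 ⟨D.absIdx_mem_pos _, D.absIdx_mem_sub (D.refl_mem_sub j hj i (D.mem_idx.1 hi).2)⟩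
  have hinv : ∀ i ∈ D.idx, D.absIdx (s • D.absIdx (s • i)) = i := fun i hi => by
    rw [absIdx_smul_absIdx, hss, D.absIdx_of_mem (D.mem_idx.1 hi).1]
  have h1 : ∏ i ∈ D.idx, ccoroot P i (s • l) =
      (∏ i ∈ D.idx, (if s • i ∈ D.pos then (1 : ℂ) else -1)) *
        ∏ i ∈ D.idx, ccoroot P (D.absIdx (s • i)) l := by
    rw [← Finset.prod_mul_distrib]
    refine Finset.prod_congr rfl fun i _ => ?_
    rw [ccoroot_smul, hs, ofIdx_inv, ← D.ccoroot_absIdx]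
  have h2 : ∏ i ∈ D.idx, ccoroot P (D.absIdx (s • i)) l = ∏ i ∈ D.idx, ccoroot P i l :=
    Finset.prod_bij' (fun i _ => D.absIdx (s • i)) (fun i _ => D.absIdx (s • i)) hmem hmem hinv hinv
      fun _ _ => rfl
  have hjm : j ∈ D.idx := D.mem_idx.2 ⟨hpos, hj⟩
  have hsj : s • j = negIdx P j := rfl
  -- The positive indices other than `j` that `s` makes negative pair off under i ↦ -s(i). A fixed
  -- point would satisfy s(i) = -i, so its root would be proportional to that of `j`, which
  -- reducedness excludes.
  have h3 : ∏ i ∈ D.idx.erase j, (if s • i ∈ D.pos then (1 : ℂ) else -1) = 1 := by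
    refine Finset.prod_involution (fun i _ => D.absIdx (s • i)) ?_ ?_ ?_ ?_
    · intro i hi
      have hip := (D.mem_idx.1 (Finset.mem_of_mem_erase hi)).1
      by_cases h : s • i ∈ D.pos
      · rw [D.absIdx_of_mem h, hss, if_pos h, if_pos hip, one_mul]
      · rw [D.absIdx_of_notMem h, weyl_smul_negIdx, hss, if_neg h, if_neg]
        · ring
        · rw [D.neg_mem_pos]; exact not_not.2 hip
    · intro i hi hne heq
      have h : s • i ∉ D.pos := fun h => hne (if_pos h)
      rw [D.absIdx_of_notMem h] at heq
      have hij : s • i = negIdx P i := by rw [← heq, negIdx_negIdx, heq]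
      have h4 : (2 : ℝ) • P.root i = P.coroot' j (P.root i) • P.root j := by
        have := congrArg P.root hij
        rw [← weyl_smul_root, ofIdx_smul_eq, root_negIdx] at this
        rw [two_smul]; rw [sub_eq_iff_eq_add] at this
        nth_rewrite 1 [this]; abel
      refine Finset.ne_of_mem_erase hi ?_
      by_contra hne'
      have hli := RootPairing.IsReduced.linearIndependent P hne' (fun h5 => by
        have h6 : i = negIdx P j := P.root.injective (by rw [h5, root_negIdx])
        rw [h6] at hi
        have := (D.mem_idx.1 (Finset.mem_of_mem_erase hi)).1
        rw [D.neg_mem_pos] at this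
        exact this hpos)
      have h7 := LinearIndependent.pair_iff.1 hli 2 (-(P.coroot' j (P.root i)))
        (by rw [h4, neg_smul, add_neg_cancel])
      exact two_ne_zero h7.1
    · intro i hi
      refine Finset.mem_erase.2 ⟨fun h => ?_, hmem i (Finset.mem_of_mem_erase hi)⟩
      have h5 := hinv i (Finset.mem_of_mem_erase hi)
      rw [h, hsj, absIdx_negIdx, D.absIdx_of_mem hpos] at h5
      exact Finset.ne_of_mem_erase hi h5.symm
    · intro i hi
      exact hinv i (Finset.mem_of_mem_erase hi)
  rw [h1, h2, ← Finset.mul_prod_erase _ _ hjm, h3, hsj, if_neg]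
  · ring
  · rw [D.neg_mem_pos]; exact not_not.2 hpos

lemma exists_sign {w : P.weylGroup} (hw : w ∈ D.coset) : ∃ ε : ℂ, (ε = 1 ∨ ε = -1) ∧ ∀ l,
    ∏ i ∈ D.idx, ccoroot P i (w • l) = ε * ∏ i ∈ D.idx, ccoroot P i (D.base • l) := by
  have key : ∀ u ∈ reflGroup P D.sub, ∃ ε : ℂ, (ε = 1 ∨ ε = -1) ∧ ∀ l,
      ∏ i ∈ D.idx, ccoroot P i (u • l) = ε * ∏ i ∈ D.idx, ccoroot P i l := by
    intro u hu
    induction hu using Subgroup.closure_induction with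
    | mem x hx =>
      obtain ⟨j, hj, rfl⟩ := hx
      exact ⟨-1, Or.inr rfl, fun l => by rw [D.prod_ofIdx_smul hj]; ring⟩
    | one => exact ⟨1, Or.inl rfl, fun l => by rw [one_smul, one_mul]⟩
    | mul x y _ _ hx hy =>
      obtain ⟨ε, hε, h⟩ := hx
      obtain ⟨δ, hδ, h'⟩ := hy
      refine ⟨ε * δ, ?_, fun l => by rw [mul_smul, h, h', mul_assoc]⟩
      rcases hε with rfl | rfl <;> rcases hδ with rfl | rfl <;> simp
    | inv x _ hx =>
      obtain ⟨ε, hε, h⟩ := hx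
      refine ⟨ε, hε, fun l => ?_⟩
      have := h (x⁻¹ • l)
      rw [smul_inv_smul] at this
      rw [this, ← mul_assoc]
      rcases hε with rfl | rfl <;> simp
  obtain ⟨ε, hε, h⟩ := key _ (D.mem_coset.1 hw)
  exact ⟨ε, hε, fun l => by rw [← h, ← mul_smul, inv_mul_cancel_right]⟩

open Classical in
/-- The sign of an element of the coset. -/
def sign (w : P.weylGroup) : ℂ := if hw : w ∈ D.coset then (D.exists_sign hw).choose else 0

lemma sign_eq {w : P.weylGroup} (hw : w ∈ D.coset) : D.sign w = 1 ∨ D.sign w = -1 := by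
  rw [sign, dif_pos hw]; exact (D.exists_sign hw).choose_spec.1

lemma sign_mul_self {w : P.weylGroup} (hw : w ∈ D.coset) : D.sign w * D.sign w = 1 := by
  rcases D.sign_eq hw with h | h <;> rw [h] <;> ring

lemma prod_smul {w : P.weylGroup} (hw : w ∈ D.coset) (l : V × V) :
    ∏ i ∈ D.idx, ccoroot P i (w • l) = D.sign w * ∏ i ∈ D.idx, ccoroot P i (D.base • l) := by
  rw [sign, dif_pos hw]; exact (D.exists_sign hw).choose_spec.2 l

lemma ofIdx_base_mul {i : ι} :
    RootPairing.weylGroup.ofIdx P (D.base⁻¹ • i) =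
      D.base⁻¹ * RootPairing.weylGroup.ofIdx P i * D.base := by
  rw [ofIdx_smul_idx, inv_inv]

lemma mul_mem_coset {w : P.weylGroup} (hw : w ∈ D.coset) {i : ι} (hi : i ∈ D.sub) :
    w * RootPairing.weylGroup.ofIdx P (D.base⁻¹ • i) ∈ D.coset := by
  rw [mem_coset] at hw ⊢
  have : w * RootPairing.weylGroup.ofIdx P (D.base⁻¹ • i) * D.base⁻¹ =
      (w * D.base⁻¹) * RootPairing.weylGroup.ofIdx P i := by
    rw [ofIdx_base_mul]; group
  rw [this]
  exact mul_mem hw (ofIdx_mem_reflGroup P hi)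

include b in
lemma exists_regular : ∃ l : V × V, ∀ i, ccoroot P i l ≠ 0 := by
  refine ⟨(rhoPt P b, 0), fun i h => ?_⟩
  have h1 : P.coroot' i (rhoPt P b) = 0 := by
    have := congrArg Complex.re h; simpa [ccoroot] using this
  by_cases hi : b.IsPos i
  · exact ((isPos_iff_rhoPt P b i).1 hi).ne' h1
  · exact ((not_isPos_iff_rhoPt P b i).1 hi).ne h1

include b in
-- Both signs are compared at one regular point, where the product of coroots can be cancelled.
lemma sign_mul_ofIdx {w : P.weylGroup} (hw : w ∈ D.coset) {i : ι} (hi : i ∈ D.sub) :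
    D.sign (w * RootPairing.weylGroup.ofIdx P (D.base⁻¹ • i)) = -D.sign w := by
  obtain ⟨l, hl⟩ := exists_regular b
  have h1 := D.prod_smul (D.mul_mem_coset hw hi) l
  have h2 := D.prod_smul hw (RootPairing.weylGroup.ofIdx P (D.base⁻¹ • i) • l)
  rw [← mul_smul] at h2
  rw [h2, ofIdx_base_mul, ← mul_smul, ← mul_assoc, ← mul_assoc, mul_inv_cancel, one_mul, mul_smul,
    D.prod_ofIdx_smul hi] at h1
  have h3 : ∏ i ∈ D.idx, ccoroot P i (D.base • l) ≠ 0 :=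
    Finset.prod_ne_zero_iff.2 fun i _ => by rw [ccoroot_smul]; exact hl _
  have h4 : (D.sign (w * (D.base⁻¹ * RootPairing.weylGroup.ofIdx P i * D.base)) + D.sign w) *
      ∏ i ∈ D.idx, ccoroot P i (D.base • l) = 0 := by
    simp only [mul_assoc] at h1 ⊢
    linear_combination -h1
  rw [ofIdx_base_mul]
  exact eq_neg_of_add_eq_zero_left ((mul_eq_zero.1 h4).resolve_right h3)

end CosetDatum

end Coset

/-! ### Numerator and denominator of the coset sum, and classes of coroots. -/

section Clear

variable {ι V N : Type*} [Fintype ι] [AddCommGroup V] [Module ℝ V] [AddCommGroup N] [Module ℝ N]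
  {P : RootPairing ι ℝ V N} [P.IsRootSystem] [P.IsCrystallographic] [P.IsReduced] (b : P.Base)

namespace CosetDatum

variable (D : CosetDatum P)

/-- The numerator of the sum over the coset. -/
def num (ρ : ℂ → ℂ) (φ : V × V → ℂ) (l : V × V) : ℂ :=
  ∑ w ∈ D.coset, D.sign w * (∏ i ∈ D.idx, (ccoroot P i (w • l) + 1)) *
    (∏ i ∈ D.posIdx, ρ (ccoroot P i (w • l))) * φ (w • l)

/-- The denominator of the sum over the coset. -/
def den (ρ : ℂ → ℂ) (l : V × V) : ℂ :=
  (∏ i ∈ D.idx, ccoroot P i (D.base • l)) * ∏ i ∈ D.posIdx, ρ (ccoroot P i l)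

/-- By antisymmetry the products of 1/α(wl) for different `w` agree up to sign, so a single product
of coroots serves as a common denominator. -/
lemma num_eq_den_mul {ρ : ℂ → ℂ} (φ : V × V → ℂ) {l : V × V}
    (hl : ∀ i, ccoroot P i l ≠ 0 ∧ ρ (ccoroot P i l) ≠ 0) :
    D.num ρ φ l = D.den ρ l * D.sumF ρ φ l := by
  rw [num, den, sumF, Finset.mul_sum]
  refine Finset.sum_congr rfl fun w hw => ?_
  have hr : ∏ i ∈ D.posIdx, ρ (ccoroot P i l) ≠ 0 := Finset.prod_ne_zero_iff.2 fun i _ => (hl i).2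
  have hc : ∏ i ∈ D.idx, ccoroot P i (D.base • l) ≠ 0 :=
    Finset.prod_ne_zero_iff.2 fun i _ => by rw [ccoroot_smul]; exact (hl _).1
  rw [Finset.prod_div_distrib, D.prod_smul hw]
  have hs := D.sign_mul_self hw
  have hs0 : D.sign w ≠ 0 := fun h => by rw [h] at hs; simp at hs
  field_simp
  linear_combination (∏ i ∈ D.idx, (ccoroot P i (w • l) + 1)) * (φ (w • l)) *
    (∏ i ∈ D.posIdx, ρ (ccoroot P i (w • l))) * hs

lemma holOn_num {ρ : ℂ → ℂ} (hρ : Differentiable ℂ ρ) {φ : V × V → ℂ} (hφ : HolOn ⊤ φ) :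
    HolOn ⊤ (D.num ρ φ) := by
  refine HolOn.sum _ fun w _ => HolOn.mul (HolOn.mul (HolOn.mul (HolOn.const _) ?_) ?_) (hφ.smul w)
  · exact HolOn.prod _ fun i _ => (holOn_ccoroot_smul P w ⊤ i).add (HolOn.const 1)
  · exact HolOn.prod _ fun i _ => (holOn_ccoroot_smul P w ⊤ i).comp hρ

lemma holOn_den {ρ : ℂ → ℂ} (hρ : Differentiable ℂ ρ) : HolOn ⊤ (D.den ρ) :=
  HolOn.mul (HolOn.prod _ fun i _ => holOn_ccoroot_smul P _ ⊤ i)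
    (HolOn.prod _ fun i _ => (holOn_ccoroot P ⊤ i).comp hρ)

include b in
-- The reflection `s` in this wall fixes `l`, so the terms of `w` and `w * s` cancel.
lemma num_eq_zero (ρ : ℂ → ℂ) (φ : V × V → ℂ) {i : ι} (hi : i ∈ D.idx) {l : V × V}
    (hl : ccoroot P i (D.base • l) = 0) : D.num ρ φ l = 0 := by
  set s := RootPairing.weylGroup.ofIdx P (D.base⁻¹ • i) with hs
  have hsl : s • l = l := ofIdx_smul_of_ccoroot_eq_zero P (by rwa [← ccoroot_smul])
  have hsub := (D.mem_idx.1 hi).2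
  have hss : ∀ w : P.weylGroup, w * s * s = w := fun w => by
    rw [mul_assoc, hs, ofIdx_mul_self, mul_one]
  have h : D.num ρ φ l = -D.num ρ φ l := by
    rw [num, ← Finset.sum_neg_distrib]
    refine Finset.sum_bij' (fun w _ => w * s) (fun w _ => w * s)
      (fun w hw => D.mul_mem_coset hw hsub) (fun w hw => D.mul_mem_coset hw hsub)
      (fun w _ => hss w) (fun w _ => hss w) fun w hw => ?_
    rw [D.sign_mul_ofIdx b hw hsub]
    simp only [mul_smul, hsl]
    ring
  exact self_eq_neg.1 h

end CosetDatum

variable [FiniteDimensional ℝ V]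

/-- A real linear form as a linear form in the complex coordinates. -/
def clm (f : V →ₗ[ℝ] ℝ) : CV V × ℂ →L[ℂ] ℂ :=
  ∑ j, (f (Module.finBasis ℝ V j) : ℂ) • ((ContinuousLinearMap.proj j).comp
    (ContinuousLinearMap.fst ℂ (CV V) ℂ))

lemma clm_apply (f : V →ₗ[ℝ] ℝ) (e : CV V × ℂ) : clm f e = clin f (kap e.1) := by
  rw [kap, clin_cpt]
  simp [clm, mul_comm]

lemma clm_ne_zero {f : V →ₗ[ℝ] ℝ} (hf : f ≠ 0) : clm f ≠ 0 := by
  intro h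
  apply hf
  ext v
  have := congrArg (fun g => g (kapInv (v, 0), 0)) h
  simp only [clm_apply, kap_kapInv] at this
  simpa [clin] using this

lemma differentiable_kap {F : V × V → ℂ} (hF : HolOn ⊤ F) :
    Differentiable ℂ fun e : CV V × ℂ => F (kap e.1) :=
  (holOn_top_iff.1 hF).comp differentiable_fst

lemma differentiable_cproj {H : AffineSubspace ℝ V} {p₀ : V} (hp : p₀ ∈ H) {F : V × V → ℂ}
    (hF : HolOn H F) : Differentiable ℂ fun e : CV V × ℂ => F (cproj H p₀ (kap e.1)) :=
  differentiable_kap (holOn_cproj hp hF)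

namespace CosetDatum

variable (D : CosetDatum P)

/-- The coroots in the positive part of the subsystem are pairwise independent. -/
lemma exists_separating {i j : ι} (hi : i ∈ D.idx) (hj : j ∈ D.idx) (hij : i ≠ j) :
    ∃ v : V, P.coroot' i v = 0 ∧ P.coroot' j v ≠ 0 := by
  by_contra! hc
  have hker : LinearMap.ker (P.coroot' i) ≤ LinearMap.ker (P.coroot' j) := fun v hv => hc v hv
  have hli := RootPairing.IsReduced.linearIndependent P.flip (i := i) (j := j) hij (fun h => by
    have h5 : i = negIdx P j := by
      apply P.coroot.injective
      rw [negIdx, P.coroot_reflectionPerm, P.coreflection_apply_self]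
      exact h
    have h6 := (D.mem_idx.1 hi).1
    rw [h5, D.neg_mem_pos] at h6
    exact h6 (D.mem_idx.1 hj).1)
  obtain ⟨c, hcc⟩ : ∃ c : ℝ, ∀ v, P.coroot' j v = c * P.coroot' i v := by
    refine ⟨P.coroot' j (P.root i) / 2, fun v => ?_⟩
    have h2 : P.coroot' i (P.root i) = 2 := by simp [RootPairing.coroot']
    have := hker (show v - (P.coroot' i v / 2) • P.root i ∈ _ by
      rw [LinearMap.mem_ker, map_sub, map_smul, h2]; simp)
    rw [LinearMap.mem_ker, map_sub, map_smul, smul_eq_mul] at this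
    linarith
  have h : P.coroot j = c • P.coroot i := by
    apply P.toLinearMap.flip.toPerfPair.injective
    ext v
    have := hcc v
    simpa [RootPairing.coroot'] using this
  have h7 := LinearIndependent.pair_iff.1 hli c (-1) (by
    change c • P.coroot i + (-1 : ℝ) • P.coroot j = 0
    rw [h]; simp)
  norm_num at h7

include b in
-- The extra complex variable deforms ρ to ρ + t. For ρ itself, a factor ρ(α) may vanish on a wall
-- and hide whether the wall divides the remaining factor; in the family this no longer happens.
lemma exists_num_eq {ρ : ℂ → ℂ} (hρ : Differentiable ℂ ρ) {φ : V × V → ℂ} (hφ : HolOn ⊤ φ) :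
    ∃ Q : CV V × ℂ → ℂ, Differentiable ℂ Q ∧ ∀ e, D.num (fun s => ρ s + e.2) φ (kap e.1) =
      (∏ i ∈ D.idx, ccoroot P i (D.base • kap e.1)) * Q e := by
  have hdiff : Differentiable ℂ
      fun e : CV V × ℂ => D.num (fun s => ρ s + e.2) φ (kap e.1) := by
    unfold num
    refine Differentiable.fun_sum fun w _ => ?_
    refine Differentiable.fun_mul (Differentiable.fun_mul (Differentiable.fun_mul
      (differentiable_const _) ?_) ?_) (differentiable_kap (hφ.smul w))
    · exact differentiable_kap (F := fun l => ∏ i ∈ D.idx, (ccoroot P i (w • l) + 1))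
        (HolOn.prod _ fun i _ => (holOn_ccoroot_smul P w ⊤ i).add (HolOn.const 1))
    · refine differentiable_finset_prod _ fun i _ => Differentiable.fun_add ?_ differentiable_snd
      exact differentiable_kap (F := fun l => ρ (ccoroot P i (w • l)))
        ((holOn_ccoroot_smul P w ⊤ i).comp hρ)
  have hval : ∀ (i : ι) (e : CV V × ℂ), clm (P.coroot' (D.base⁻¹ • i)) e + 0 =
      ccoroot P i (D.base • kap e.1) := fun i e => by
    rw [add_zero, clm_apply, ccoroot_smul, ccoroot_eq_clin]
  obtain ⟨Q, hQ, h⟩ := exists_eq_prod_mul_of_vanish D.idx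
    (fun i => clm (P.coroot' (D.base⁻¹ • i))) (fun _ => 0) hdiff
    (fun i _ => clm_ne_zero fun h => by
      have h2 : P.coroot' (D.base⁻¹ • i) (P.root (D.base⁻¹ • i)) = 2 := by simp [RootPairing.coroot']
      rw [h] at h2
      simp at h2)
    (fun i hi e he => D.num_eq_zero b _ _ hi (by rwa [hval] at he))
    (fun i hi j hj hij => by
      obtain ⟨v, hv1, hv2⟩ := D.exists_separating hi hj hij
      refine ⟨(kapInv (D.base⁻¹ • v, 0), 0), ?_, ?_⟩
      · rw [hval, kap_kapInv]
        simp [ccoroot, hv1]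
      · rw [hval, kap_kapInv]
        simpa [ccoroot, Prod.smul_fst, Prod.smul_snd] using hv2)
  refine ⟨Q, hQ, fun e => ?_⟩
  rw [h e]
  congr 1
  exact Finset.prod_congr rfl fun i _ => hval i e

end CosetDatum

/-! ### Classes of coroots on an affine subspace -/

variable (P) in
/-- The coroots whose restriction to `H` is equivalent to that of `i`. -/
def cls (H : AffineSubspace ℝ V) (i : ι) : Set ι :=
  {j | (∀ p ∈ H, P.coroot' j p = P.coroot' i p) ∨ ∀ p ∈ H, P.coroot' j p = 1 - P.coroot' i p}

lemma mem_cls_self (H : AffineSubspace ℝ V) (i : ι) : i ∈ cls P H i := Or.inl fun _ _ => rfl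

lemma cls_eq_of_mem {H : AffineSubspace ℝ V} {i j : ι} (h : i ∈ cls P H j) :
    cls P H i = cls P H j := by
  ext k
  rcases h with h | h
  · constructor
    · rintro (hk | hk)
      · exact Or.inl fun p hp => by rw [hk p hp, h p hp]
      · exact Or.inr fun p hp => by rw [hk p hp, h p hp]
    · rintro (hk | hk)
      · exact Or.inl fun p hp => by rw [hk p hp, h p hp]
      · exact Or.inr fun p hp => by rw [hk p hp, h p hp]
  · constructor
    · rintro (hk | hk)
      · exact Or.inr fun p hp => by rw [hk p hp, h p hp]
      · exact Or.inl fun p hp => by rw [hk p hp, h p hp]; ring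
    · rintro (hk | hk)
      · exact Or.inr fun p hp => by rw [hk p hp, h p hp]; ring
      · exact Or.inl fun p hp => by rw [hk p hp, h p hp]

lemma cls_eq_iff {H : AffineSubspace ℝ V} {i j : ι} : cls P H i = cls P H j ↔ i ∈ cls P H j :=
  ⟨fun h => h ▸ mem_cls_self H i, cls_eq_of_mem⟩

open Classical in
variable (P) in
/-- The multiset of the classes of the coroots in `A`. -/
def clsMS (H : AffineSubspace ℝ V) (A : Set ι) : Multiset (Set ι) :=
  (Finset.univ.filter fun i => i ∈ A).val.map (cls P H)

lemma exists_of_mem_clsMS {H : AffineSubspace ℝ V} {A : Set ι} {c : Set ι}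
    (h : c ∈ clsMS P H A) : ∃ i ∈ A, c = cls P H i := by
  classical
  obtain ⟨i, hi, rfl⟩ := Multiset.mem_map.1 h
  exact ⟨i, by simpa using hi, rfl⟩

open Classical in
variable (P) in
/-- A function on `H` representing a class of coroots. -/
def repFun (H : AffineSubspace ℝ V) (c : Set ι) : H → ℂ :=
  if h : c.Nonempty then corootOn P H h.some else 0

open Classical in
variable (P) in
/-- The extension of `repFun` to complex points. -/
def crep (c : Set ι) (l : V × V) : ℂ := if h : c.Nonempty then ccoroot P h.some l else 0

lemma ccoroot_of_mem_cls {H : AffineSubspace ℝ V} {i j : ι} (h : i ∈ cls P H j) {l : V × V}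
    (hl : l ∈ cpts H) : ccoroot P i l = ccoroot P j l ∨ ccoroot P i l = 1 - ccoroot P j l := by
  have hadd : l.2 + l.1 ∈ H := AffineSubspace.vadd_mem_of_mem_direction hl.2 hl.1
  rcases h with h | h
  · left
    have h1 := h _ hl.1
    have h2 := h _ hadd
    rw [map_add, map_add, h1] at h2
    simp only [ccoroot, h1, add_right_cancel h2]
  · right
    have h1 := h _ hl.1
    have h2 := h _ hadd
    rw [map_add, map_add, h1] at h2
    have h3 : P.coroot' i l.2 = - P.coroot' j l.2 := by linarith
    simp only [ccoroot, h1, h3]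
    push_cast; ring

lemma comp_ccoroot_of_mem_cls {H : AffineSubspace ℝ V} {i j : ι} (h : i ∈ cls P H j) {l : V × V}
    (hl : l ∈ cpts H) {f : ℂ → ℂ} (hf : ∀ z, f z = f (1 - z)) :
    f (ccoroot P i l) = f (ccoroot P j l) := by
  rcases ccoroot_of_mem_cls h hl with h | h
  · rw [h]
  · rw [h, ← hf]

/-- The choice of a representative of a class is immaterial for functions symmetric under z ↦ 1 - z,
which is how ρ and ρ + t enter. -/
lemma comp_crep {H : AffineSubspace ℝ V} (i : ι) {l : V × V}
    (hl : l ∈ cpts H) {f : ℂ → ℂ} (hf : ∀ z, f z = f (1 - z)) :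
    f (crep P (cls P H i) l) = f (ccoroot P i l) := by
  have hne : (cls P H i).Nonempty := ⟨i, mem_cls_self H i⟩
  rw [crep, dif_pos hne]
  exact comp_ccoroot_of_mem_cls hne.some_mem hl hf

lemma ext_corootOn {H : AffineSubspace ℝ V} (i : ι) {v : V} (hv : v ∈ H) :
    ext (corootOn P H i) v = P.coroot' i v := by
  rw [ext, dif_pos hv]; rfl

lemma cval_corootOn {H : AffineSubspace ℝ V} (i : ι) {l : V × V} (hl : l ∈ cpts H) :
    cval (corootOn P H i) l = ccoroot P i l := by
  have hadd : l.2 + l.1 ∈ H := AffineSubspace.vadd_mem_of_mem_direction hl.2 hl.1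
  rw [cval, ext_corootOn i hl.1, ext_corootOn i hadd, map_add, ccoroot]
  push_cast; ring

lemma cval_repFun {H : AffineSubspace ℝ V} {c : Set ι} (hc : c.Nonempty) {l : V × V}
    (hl : l ∈ cpts H) : cval (repFun P H c) l = crep P c l := by
  rw [repFun, crep, dif_pos hc, dif_pos hc, cval_corootOn _ hl]

lemma holOn_crep (H : AffineSubspace ℝ V) (c : Set ι) : HolOn H (crep P c) := by
  by_cases h : c.Nonempty
  · have : crep P c = ccoroot P h.some := by funext l; rw [crep, dif_pos h]
    rw [this]; exact holOn_ccoroot P H _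
  · have : crep P c = fun _ => 0 := by funext l; rw [crep, dif_neg h]
    rw [this]; exact HolOn.const 0

end Clear

/-! ### Upper bound: an explicit multiset that clears denominators. -/

section ClearDen

variable {ι V N : Type*} [Fintype ι] [AddCommGroup V] [Module ℝ V] [AddCommGroup N] [Module ℝ N]
  {P : RootPairing ι ℝ V N} [P.IsRootSystem] [P.IsCrystallographic] [P.IsReduced] (b : P.Base) [FiniteDimensional ℝ V]

namespace CosetDatum

variable (D : CosetDatum P)

open Classical in
/-- The elements of the coset whose term does not vanish identically on `H`. -/
def surv (H : AffineSubspace ℝ V) : Finset P.weylGroup :=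
  D.coset.filter fun w => ∀ j ∈ poleSet P H, w • j ∈ D.sub → w • j ∈ D.pos

open Classical in
/-- The classes, with multiplicities, of the denominators on `H`. -/
def denCls (H : AffineSubspace ℝ V) : Multiset (Set ι) :=
  (D.surv H).sup fun w =>
    clsMS P H (D.pos \ constSet P H) - clsMS P H ({j | w • j ∈ D.pos} \ constSet P H)

/-- The denominators on `H`. -/
def denMS (H : AffineSubspace ℝ V) : Multiset (H → ℂ) := (D.denCls H).map (repFun P H)

open Classical in
/-- The product of the factors constant on `H`. -/
def constProd (H : AffineSubspace ℝ V) (w : P.weylGroup) (f : ℂ → ℂ) (l : V × V) : ℂ :=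
  ∏ j ∈ Finset.univ.filter (fun j => w • j ∈ D.pos ∧ j ∈ constSet P H), f (ccoroot P j l)

lemma prod_posIdx_smul {H : AffineSubspace ℝ V} (w : P.weylGroup) {f : ℂ → ℂ}
    (hf : ∀ z, f z = f (1 - z)) {l : V × V} (hl : l ∈ cpts H) :
    ∏ i ∈ D.posIdx, f (ccoroot P i (w • l)) = D.constProd H w f l *
      ((clsMS P H ({j | w • j ∈ D.pos} \ constSet P H)).map fun c => f (crep P c l)).prod := by
  classical
  have h1 : ∏ i ∈ D.posIdx, f (ccoroot P i (w • l)) =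
      ∏ j ∈ Finset.univ.filter (fun j => w • j ∈ D.pos), f (ccoroot P j l) := by
    refine Finset.prod_bij' (fun i _ => w⁻¹ • i) (fun j _ => w • j) ?_ ?_ ?_ ?_ ?_
    · intro i hi; simpa using D.mem_posIdx.1 hi
    · intro j hj; rw [mem_posIdx]; simpa using hj
    · intro i _; exact smul_inv_smul _ _
    · intro i _; exact inv_smul_smul _ _
    · intro i _; rw [ccoroot_smul]
  rw [h1, constProd, ← Finset.prod_filter_mul_prod_filter_not _ (fun j => j ∈ constSet P H),
    Finset.filter_filter, Finset.filter_filter, clsMS, Multiset.map_map]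
  congr 1
  refine Finset.prod_congr (by ext j; simp) fun j _ => ?_
  simp only [Function.comp_apply]
  exact (comp_crep j hl hf).symm

/-- A coroot `j` equal to 1 on `H` for which `w • j` lies in the subsystem but is not positive makes
the factor indexed by `-(w • j)` equal to 1 - α_j = 0. -/
lemma term_eq_zero {H : AffineSubspace ℝ V} {w : P.weylGroup} (hw : w ∈ D.coset)
    (hs : w ∉ D.surv H) {l : V × V} (hl : l ∈ cpts H) :
    ∏ i ∈ D.idx, (ccoroot P i (w • l) + 1) = 0 := by
  classical
  have : ∃ j ∈ poleSet P H, w • j ∈ D.sub ∧ w • j ∉ D.pos := by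
    by_contra! hc
    exact hs (Finset.mem_filter.2 ⟨hw, hc⟩)
  obtain ⟨j, hj, h1, h2⟩ := this
  refine Finset.prod_eq_zero (i := negIdx P (w • j))
    (D.mem_idx.2 ⟨(D.neg_mem_pos _).2 h2, (D.neg_mem_sub _).2 h1⟩) ?_
  have hadd : l.2 + l.1 ∈ H := AffineSubspace.vadd_mem_of_mem_direction hl.2 hl.1
  have h3 := hj _ hl.1
  have h4 := hj _ hadd
  rw [map_add, h3] at h4
  have h5 : P.coroot' j l.2 = 0 := by linarith
  rw [ccoroot_negIdx, ccoroot_smul, inv_smul_smul, ccoroot, h3, h5]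
  simp

lemma num_eq_sum_surv {H : AffineSubspace ℝ V} (ρ : ℂ → ℂ) (φ : V × V → ℂ) {l : V × V}
    (hl : l ∈ cpts H) : D.num ρ φ l =
      ∑ w ∈ D.surv H, D.sign w * (∏ i ∈ D.idx, (ccoroot P i (w • l) + 1)) *
        (∏ i ∈ D.posIdx, ρ (ccoroot P i (w • l))) * φ (w • l) := by
  classical
  refine (Finset.sum_subset (Finset.filter_subset _ _) fun w hw hs => ?_).symm
  rw [D.term_eq_zero hw hs hl]; ring

lemma clsMS_le {H : AffineSubspace ℝ V} {w : P.weylGroup} (hw : w ∈ D.surv H) :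
    clsMS P H (D.pos \ constSet P H) ≤
      D.denCls H + clsMS P H ({j | w • j ∈ D.pos} \ constSet P H) := by
  classical
  have h : clsMS P H (D.pos \ constSet P H) - clsMS P H ({j | w • j ∈ D.pos} \ constSet P H) ≤
      D.denCls H := Finset.le_sup (f := fun w => clsMS P H (D.pos \ constSet P H) -
        clsMS P H ({j | w • j ∈ D.pos} \ constSet P H)) hw
  exact tsub_le_iff_right.1 h

lemma exists_of_mem_denCls {H : AffineSubspace ℝ V} {c : Set ι} (h : c ∈ D.denCls H) :
    ∃ i ∈ D.pos, i ∉ constSet P H ∧ c = cls P H i := by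
  classical
  obtain ⟨w, -, hc⟩ := Multiset.mem_sup.1 h
  obtain ⟨i, hi, rfl⟩ := exists_of_mem_clsMS (Multiset.mem_of_le (tsub_le_self) hc)
  exact ⟨i, hi.1, hi.2, rfl⟩

end CosetDatum

lemma isAffStar_corootOn {H : AffineSubspace ℝ V} {i : ι} (hi : i ∉ constSet P H) :
    IsAffStar (corootOn P H i) := by
  refine ⟨⟨((Complex.ofRealCLM : ℝ →ₗ[ℝ] ℂ) ∘ₗ P.coroot' i).toAffineMap, fun p => rfl⟩, ?_⟩
  rintro ⟨c, hc⟩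
  refine hi ⟨c.re, fun p hp => ?_⟩
  have := congrArg Complex.re (hc ⟨p, hp⟩)
  simpa [corootOn] using this

lemma notMem_constSet_of_mem_cls {H : AffineSubspace ℝ V} {i j : ι} (h : j ∈ cls P H i)
    (hi : i ∉ constSet P H) : j ∉ constSet P H := by
  rintro ⟨c, hc⟩
  rcases h with h | h
  · exact hi ⟨c, fun p hp => by rw [← h p hp, hc p hp]⟩
  · exact hi ⟨1 - c, fun p hp => by have := h p hp; rw [hc p hp] at this; linarith⟩

lemma coroot'_direction_of_constSet {H : AffineSubspace ℝ V} {p : V} (hp : p ∈ H) {i : ι}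
    (hi : i ∈ constSet P H) {v : V} (hv : v ∈ H.direction) : P.coroot' i v = 0 := by
  obtain ⟨c, hc⟩ := hi
  have := hc _ (AffineSubspace.vadd_mem_of_mem_direction hv hp)
  rw [vadd_eq_add, map_add, hc p hp] at this
  linarith

lemma mem_constSet_iff {H : AffineSubspace ℝ V} {p : V} (hp : p ∈ H) {i : ι} :
    i ∈ constSet P H ↔ ∀ v ∈ H.direction, P.coroot' i v = 0 := by
  refine ⟨fun hi v hv => coroot'_direction_of_constSet hp hi hv, fun h => ⟨P.coroot' i p, ?_⟩⟩
  intro q hq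
  have := h _ (AffineSubspace.vsub_mem_direction hq hp)
  rw [vsub_eq_sub, map_sub] at this
  linarith

lemma ccoroot_cproj (H : AffineSubspace ℝ V) (p₀ : V) (i : ι) (e : CV V × ℂ) :
    ccoroot P i (cproj H p₀ (kap e.1)) = clm (P.coroot' i ∘ₗ dirProj H) e +
      (P.coroot' i (p₀ - dirProj H p₀) : ℝ) := by
  rw [clm_apply]
  simp only [ccoroot, cproj, clin, map_add, map_sub, LinearMap.comp_apply]
  push_cast; ring

namespace CosetDatum

variable (D : CosetDatum P)

include b in
-- The factors ρ(α) of the denominator cancel termwise, by the choice of `denCls`; the factors α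
-- cancel only in the whole sum. The two cancellations are reconciled by working in the family ρ + t
-- and specializing to t = 0 at the end.
lemma exists_clearing {H : AffineSubspace ℝ V} {p₀ : V} (hp : p₀ ∈ H) (hH : zeroSet P H = ∅)
    {ρ : ℂ → ℂ} (hρ : Differentiable ℂ ρ) (hsymm : ∀ z, ρ z = ρ (1 - z)) {φ : V × V → ℂ}
    (hφ : HolOn ⊤ φ) (hconst : ∀ i ∈ D.pos, i ∈ constSet P H → ρ (P.coroot' i p₀) ≠ 0) :
    ∃ G : V × V → ℂ, HolOn H G ∧ ∀ l ∈ cpts H, G l * D.den ρ l =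
      ((D.denCls H).map fun c => ρ (crep P c l)).prod * D.num ρ φ l := by
  classical
  set R₀ : ℂ → ℂ → ℂ := fun t s => ρ s + t with hR₀
  have hsymm' : ∀ t z, R₀ t z = R₀ t (1 - z) := fun t z => by simp only [hR₀]; rw [← hsymm]
  set M := clsMS P H (D.pos \ constSet P H) with hM
  set Mw : P.weylGroup → Multiset (Set ι) :=
    fun w => clsMS P H ({j | w • j ∈ D.pos} \ constSet P H) with hMw
  set LH : CV V × ℂ → V × V := fun e => cproj H p₀ (kap e.1) with hLH
  have hLHmem : ∀ e, LH e ∈ cpts H := fun e => cproj_mem hp _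
  have hdc : ∀ (c : Set ι), Differentiable ℂ fun e => R₀ e.2 (crep P c (LH e)) := fun c =>
    Differentiable.fun_add (differentiable_cproj hp ((holOn_crep H c).comp hρ)) differentiable_snd
  have hdi : ∀ i : ι, Differentiable ℂ fun e => R₀ e.2 (ccoroot P i (LH e)) := fun i =>
    Differentiable.fun_add (differentiable_cproj hp ((holOn_ccoroot P H i).comp hρ)) differentiable_snd
  -- `F` is the cleared numerator after the nonconstant factors of r have been cancelled in each
  -- surviving term; the subtraction of multisets is exact by `clsMS_le`.
  set F : CV V × ℂ → ℂ := fun e => ∑ w ∈ D.surv H,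
    D.sign w * (∏ i ∈ D.idx, (ccoroot P i (w • LH e) + 1)) *
      (D.constProd H w (R₀ e.2) (LH e) *
        ((D.denCls H + Mw w - M).map fun c => R₀ e.2 (crep P c (LH e))).prod) *
      φ (w • LH e) with hF
  set R : CV V × ℂ → ℂ := fun e => (M.map fun c => R₀ e.2 (crep P c (LH e))).prod with hR
  obtain ⟨Q, hQ, hNQ⟩ := D.exists_num_eq b hρ hφ
  have hRdiff : Differentiable ℂ R := differentiable_multiset_prod _ fun c _ => hdc c
  have hFdiff : Differentiable ℂ F := by
    refine Differentiable.fun_sum fun w _ => Differentiable.fun_mul (Differentiable.fun_mul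
      (Differentiable.fun_mul (differentiable_const _) ?_) (Differentiable.fun_mul ?_ ?_)) ?_
    · exact differentiable_cproj hp (F := fun l => ∏ i ∈ D.idx, (ccoroot P i (w • l) + 1))
        (HolOn.prod _ fun i _ => (holOn_ccoroot_smul P w H i).add (HolOn.const 1))
    · exact differentiable_finset_prod _ fun i _ => hdi i
    · exact differentiable_multiset_prod _ fun c _ => hdc c
    · exact differentiable_cproj hp (F := fun l => φ (w • l)) ((hφ.smul w).mono le_top)
  set dl : CV V × ℂ → ℂ :=
    fun e => ((D.denCls H).map fun c => R₀ e.2 (crep P c (LH e))).prod with hdl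
  have hdldiff : Differentiable ℂ dl := differentiable_multiset_prod _ fun c _ => hdc c
  have hkap : ∀ e : CV V × ℂ, LH e = kap (kapInv (LH e)) := fun e => (kap_kapInv _).symm
  have hQL : Differentiable ℂ fun e : CV V × ℂ => Q (kapInv (LH e), e.2) := by
    refine hQ.comp (Differentiable.prodMk ?_ differentiable_snd)
    rw [differentiable_pi]
    intro j
    exact differentiable_cproj hp (holOn_clin H _)
  have hFR : ∀ e, F e * R e = dl e * D.num (R₀ e.2) φ (LH e) := by
    intro e
    rw [D.num_eq_sum_surv _ _ (hLHmem e), hF, Finset.sum_mul, Finset.mul_sum]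
    refine Finset.sum_congr rfl fun w hw => ?_
    rw [D.prod_posIdx_smul w (hsymm' e.2) (hLHmem e)]
    have h1 : D.denCls H + Mw w - M + M = D.denCls H + Mw w :=
      tsub_add_cancel_of_le (D.clsMS_le hw)
    have h2 := congrArg (fun m => (m.map fun c => R₀ e.2 (crep P c (LH e))).prod) h1
    simp only [Multiset.map_add, Multiset.prod_add] at h2
    simp only [hR, hdl]
    linear_combination (D.sign w * (∏ i ∈ D.idx, (ccoroot P i (w • LH e) + 1)) *
      D.constProd H w (R₀ e.2) (LH e) * φ (w • LH e)) * h2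
  have hlin : ∀ (i : ι) e, clm (P.coroot' (D.base⁻¹ • i) ∘ₗ dirProj H) e +
      ((P.coroot' (D.base⁻¹ • i) (p₀ - dirProj H p₀) : ℝ) : ℂ) = ccoroot P i (D.base • LH e) :=
    fun i e => by rw [ccoroot_smul, ← ccoroot_cproj]
  obtain ⟨G₁, hG₁, hFG⟩ := exists_eq_prod_mul D.idx
    (fun i => clm (P.coroot' (D.base⁻¹ • i) ∘ₗ dirProj H))
    (fun i => ((P.coroot' (D.base⁻¹ • i) (p₀ - dirProj H p₀) : ℝ) : ℂ))
    (M := fun e => dl e * Q (kapInv (LH e), e.2)) hFdiff hRdiff (hdldiff.fun_mul hQL)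
    (fun e => by
      have h1 := hNQ (kapInv (LH e), e.2)
      simp only [← hkap] at h1
      rw [hFR, h1]
      simp only [hlin]
      ring)
    (fun i hi => by
      -- A coroot constant on `H` has nonzero value there by regularity. A nonconstant one defines a
      -- hyperplane on which a suitable `t` makes every factor ρ + t nonzero.
      by_cases hc : D.base⁻¹ • i ∈ constSet P H
      · left
        have hz : ∀ v, P.coroot' (D.base⁻¹ • i) (dirProj H v) = 0 := fun v =>
          coroot'_direction_of_constSet hp hc (dirProj_mem H v)
        refine ⟨?_, ?_⟩
        · refine ContinuousLinearMap.ext fun e => ?_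
          rw [clm_apply]
          simp [clin, hz]
        · rw [map_sub, hz, sub_zero]
          intro h0
          have h1 : D.base⁻¹ • i ∈ zeroSet P H := by
            obtain ⟨c, hc⟩ := hc
            intro p hp'
            rw [hc p hp', ← hc p₀ hp]
            exact_mod_cast h0
          rw [hH] at h1
          exact h1
      · right
        have hne : clm (P.coroot' (D.base⁻¹ • i) ∘ₗ dirProj H) ≠ 0 := by
          refine clm_ne_zero fun h => hc ((mem_constSet_iff hp).2 fun v hv => ?_)
          have := LinearMap.congr_fun h v
          rwa [LinearMap.comp_apply, dirProj_of_mem hv] at this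
        refine ⟨hne, ?_⟩
        obtain ⟨u, hu⟩ := exists_apply_eq_one hne
        set c := ((P.coroot' (D.base⁻¹ • i) (p₀ - dirProj H p₀) : ℝ) : ℂ)
        set l := cproj H p₀ (kap ((-c) • u).1) with hl
        obtain ⟨t, ht⟩ := Infinite.exists_notMem_finset
          ((M.map fun k => -ρ (crep P k l)).toFinset)
        refine ⟨(((-c) • u).1, t), ?_, ?_⟩
        · have : clm (P.coroot' (D.base⁻¹ • i) ∘ₗ dirProj H) (((-c) • u).1, t) =
              clm (P.coroot' (D.base⁻¹ • i) ∘ₗ dirProj H) ((-c) • u) := by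
            rw [clm_apply, clm_apply]
          rw [this, map_smul, hu, smul_eq_mul]; ring
        · refine Multiset.prod_ne_zero fun h0 => ht ?_
          obtain ⟨k, hk, hk0⟩ := Multiset.mem_map.1 h0
          rw [Multiset.mem_toFinset, Multiset.mem_map]
          exact ⟨k, hk, by simp only [hR₀] at hk0; exact neg_eq_of_add_eq_zero_right hk0⟩)
  -- The factors of r that are constant on `H` combine to this nonzero number, by the condition
  -- imposed on ρ.
  set k₀ : ℂ := D.constProd H 1 ρ (p₀, 0) with hk₀
  have hk₀ne : k₀ ≠ 0 := by
    refine Finset.prod_ne_zero_iff.2 fun i hi => ?_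
    simp only [one_smul, Finset.mem_filter, Finset.mem_univ, true_and] at hi
    have := hconst i hi.1 hi.2
    simpa [ccoroot] using this
  have hkc : ∀ l ∈ cpts H, D.constProd H 1 ρ l = k₀ := by
    intro l hl
    refine Finset.prod_congr rfl fun i hi => ?_
    simp only [Finset.mem_filter, Finset.mem_univ, true_and] at hi
    obtain ⟨c, hc⟩ := hi.2
    have h1 := coroot'_direction_of_constSet hp hi.2 hl.2
    simp [ccoroot, h1, hc _ hl.1, hc _ hp]
  refine ⟨fun l => k₀⁻¹ * G₁ (kapInv l, 0), ?_, fun l hl => ?_⟩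
  · refine HolOn.mono le_top (HolOn.mul (HolOn.const _) (holOn_top_iff.2 ?_))
    have : Differentiable ℂ fun z : CV V => G₁ (kapInv (kap z), 0) := by
      have hk : ∀ z : CV V, kapInv (kap z) = z := fun z => by
        rw [kap, kapInv_cpt]
        funext i
        simp [Finsupp.single_apply, apply_ite]
      simp only [hk]
      exact hG₁.comp (by fun_prop)
    exact this
  · have hLl : LH (kapInv l, 0) = l := by
      simp only [hLH]; rw [kap_kapInv, cproj_of_mem hp hl]
    have h1 := hFG (kapInv l, 0)
    have h2 := hFR (kapInv l, 0)
    simp only [hlin, hLl] at h1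
    rw [h1] at h2
    simp only [hR, hdl, hLl, hR₀, add_zero] at h2
    have h3 := D.prod_posIdx_smul 1 hsymm hl
    simp only [one_smul, Set.ofPred_mem_eq] at h3
    rw [hkc l hl] at h3
    rw [den, h3, ← h2, hM]
    field_simp

include b in
/-- The denominators clear denominators. -/
theorem clears_denMS {H : AffineSubspace ℝ V} {p₀ : V} (hp : p₀ ∈ H) (hH : zeroSet P H = ∅) :
    Clears P D.sumF D.pos H (D.denMS H) := by
  classical
  refine ⟨fun X hX => ?_, fun ρ hρ hρ0 hsymm hc φ hφ => ?_⟩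
  · obtain ⟨c, hc, rfl⟩ := Multiset.mem_map.1 hX
    obtain ⟨i, -, hi, rfl⟩ := D.exists_of_mem_denCls hc
    have hne : (cls P H i).Nonempty := ⟨i, mem_cls_self H i⟩
    rw [repFun, dif_pos hne]
    exact isAffStar_corootOn (notMem_constSet_of_mem_cls hne.some_mem hi)
  · have hconst : ∀ i ∈ D.pos, i ∈ constSet P H → ρ (P.coroot' i p₀) ≠ 0 := by
      rintro i hi ⟨c, hic⟩
      rw [hic p₀ hp]
      exact (hc i hi c hic).1
    obtain ⟨G, hG, hGeq⟩ := D.exists_clearing b hp hH hρ hsymm hφ hconst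
    refine ⟨D.num ρ φ, D.den ρ, D.holOn_num hρ hφ, D.holOn_den hρ, ?_,
      fun l hl => D.num_eq_den_mul φ hl, G, hG, fun l hl => ?_⟩
    -- It remains to see that the common denominator is not identically zero on `H`: regularity
    -- handles the coroots, and a nonconstant coroot takes every complex value on the
    -- complexification, in particular one where ρ does not vanish.
    · have hz : ∀ i : ι, ∃ l ∈ cpts H, ccoroot P i l ≠ 0 := by
        intro i
        by_contra! h
        have : i ∈ zeroSet P H := fun p hpH => by
          have := h (p, 0) ⟨hpH, zero_mem _⟩
          simpa [ccoroot] using this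
        rw [hH] at this
        exact this
      obtain ⟨l₁, hl₁, h₁⟩ := holOn_prod_ne_zero hp D.idx
        (F := fun i l => ccoroot P i (D.base • l)) (fun i _ => holOn_ccoroot_smul P _ H i)
        fun i _ => by simp only [ccoroot_smul]; exact hz _
      obtain ⟨l₂, hl₂, h₂⟩ := holOn_prod_ne_zero hp D.posIdx
        (F := fun i l => ρ (ccoroot P i l)) (fun i _ => (holOn_ccoroot P H i).comp hρ) fun i hi => by
          rw [mem_posIdx] at hi
          by_cases hic : i ∈ constSet P H
          · refine ⟨(p₀, 0), ⟨hp, zero_mem _⟩, ?_⟩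
            simpa [ccoroot] using hconst i hi hic
          · obtain ⟨s, hs⟩ : ∃ s, ρ s ≠ 0 := by
              by_contra! h
              exact hρ0 (funext h)
            obtain ⟨v, hv, hv0⟩ : ∃ v ∈ H.direction, P.coroot' i v ≠ 0 := by
              by_contra! h
              exact hic ((mem_constSet_iff hp).2 h)
            set d := (s - P.coroot' i p₀) / P.coroot' i v with hd
            refine ⟨(p₀ + d.re • v, d.im • v), ⟨?_, Submodule.smul_mem _ _ hv⟩, ?_⟩
            · have := AffineSubspace.vadd_mem_of_mem_direction (Submodule.smul_mem _ d.re hv) hp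
              rwa [vadd_eq_add, add_comm] at this
            · have hval : ccoroot P i (p₀ + d.re • v, d.im • v) = s := by
                have h1 : ccoroot P i (p₀ + d.re • v, d.im • v) =
                    P.coroot' i p₀ + (d.re + d.im * Complex.I) * P.coroot' i v := by
                  simp only [ccoroot, map_add, map_smul, smul_eq_mul]
                  push_cast; ring
                rw [h1, Complex.re_add_im, hd, div_mul_cancel₀ _ (by exact_mod_cast hv0)]
                ring
              rw [hval]; exact hs
      by_contra! h
      refine h₂ (holOn_eq_zero_of_mul hp (HolOn.prod D.idx fun i _ => holOn_ccoroot_smul P D.base H i)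
        (HolOn.prod D.posIdx fun i _ => (holOn_ccoroot P H i).comp hρ) h ⟨l₁, hl₁, h₁⟩ l₂ hl₂)
    · rw [hGeq l hl]
      congr 2
      rw [denMS, Multiset.map_map]
      refine Multiset.map_congr rfl fun c hc => ?_
      obtain ⟨i, -, -, rfl⟩ := D.exists_of_mem_denCls hc
      rw [Function.comp_apply, cval_repFun ⟨i, mem_cls_self H i⟩ hl]

end CosetDatum

end ClearDen

/-! ### Lower bound: minimality of the explicit multiset. -/

section MinDen

variable {ι V N : Type*} [Fintype ι] [AddCommGroup V] [Module ℝ V] [AddCommGroup N] [Module ℝ N]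
  {P : RootPairing ι ℝ V N} [P.IsRootSystem] [P.IsCrystallographic] [P.IsReduced] (b : P.Base)

/-- A nonempty affine space has a point which is generic for finitely many affine functions. -/
lemma exists_generic {H : AffineSubspace ℝ V} {p₀ : V} (hp : p₀ ∈ H) (S : Finset (V →ᵃ[ℝ] ℂ)) :
    ∃ q ∈ H, ∀ f ∈ S, f q = 0 → ∀ p ∈ H, f p = 0 := by
  classical
  induction S using Finset.induction_on with
  | empty => exact ⟨p₀, hp, by simp⟩
  | insert g S _ ih =>
    obtain ⟨q, hq, hS⟩ := ih
    by_cases hg : ∀ p ∈ H, g p = 0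
    · refine ⟨q, hq, fun f hf => ?_⟩
      rcases Finset.mem_insert.1 hf with rfl | hf
      · exact fun _ => hg
      · exact hS f hf
    · push Not at hg
      obtain ⟨r, hr, hgr⟩ := hg
      have hval : ∀ (f : V →ᵃ[ℝ] ℂ) (t : ℝ),
          f (AffineMap.lineMap q r t) = f q + t * (f r - f q) := fun f t => by
        rw [AffineMap.apply_lineMap, AffineMap.lineMap_apply]
        simp; ring
      -- An affine function that is not constant along the line from `q` to `r` vanishes for at most
      -- one real parameter; these parameters are avoided.
      set bad : Finset ℝ := (insert g S).image fun f => (-f q / (f r - f q)).re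
      obtain ⟨t, ht⟩ := Infinite.exists_notMem_finset (bad ∪ {0, 1})
      simp only [Finset.mem_union, Finset.mem_insert, Finset.mem_singleton, not_or] at ht
      refine ⟨AffineMap.lineMap q r t, AffineMap.lineMap_mem t hq hr, fun f hf h0 => ?_⟩
      rw [hval] at h0
      have hd : f r - f q = 0 := by
        by_contra hd
        refine ht.1 (Finset.mem_image.2 ⟨f, hf, ?_⟩)
        have : (-f q / (f r - f q)) = t := by
          rw [div_eq_iff hd]; linear_combination -h0
        rw [this, Complex.ofReal_re]
      have hq0 : f q = 0 := by rw [hd, mul_zero, add_zero] at h0; exact h0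
      rcases Finset.mem_insert.1 hf with rfl | hf
      · exact absurd (by rw [← sub_add_cancel (f r) (f q), hd, hq0, add_zero]) hgr
      · exact hS f hf hq0

/-- Comparing orders of vanishing in this form needs continuity of the cofactors only. -/
lemma eq_zero_of_pow_mul_eq {m n : ℕ} (hmn : n < m) {U R : ℂ → ℂ} (hU : Continuous U)
    (hR : Continuous R) (h : ∀ z, z ^ m * U z = z ^ n * R z) : R 0 = 0 := by
  obtain ⟨d, rfl⟩ := Nat.exists_eq_add_of_lt hmn
  have hc : Continuous fun z : ℂ => z ^ (d + 1) * U z := (continuous_pow _).mul hU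
  have := Continuous.ext_on (dense_compl_singleton (0 : ℂ)) hR hc fun z hz => by
    have hz0 : z ^ n ≠ 0 := pow_ne_zero _ hz
    apply mul_left_cancel₀ hz0
    rw [← h z]; ring
  rw [this]; simp

/-- The complex line through a real point. -/
def line (q v : V) (z : ℂ) : V × V := (q + z.re • v, z.im • v)

lemma line_mem {H : AffineSubspace ℝ V} {q v : V} (hq : q ∈ H) (hv : v ∈ H.direction) (z : ℂ) :
    line q v z ∈ cpts H := by
  refine ⟨?_, Submodule.smul_mem _ _ hv⟩
  have := AffineSubspace.vadd_mem_of_mem_direction (Submodule.smul_mem _ z.re hv) hq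
  rwa [vadd_eq_add, add_comm] at this

lemma line_zero (q v : V) : line q v 0 = (q, 0) := by simp [line]

lemma clin_line (f : V →ₗ[ℝ] ℝ) (q v : V) (z : ℂ) : clin f (line q v z) = f q + z * f v := by
  have : z = z.re + z.im * Complex.I := (Complex.re_add_im z).symm
  simp only [clin, line, map_add, map_smul, smul_eq_mul]
  nth_rewrite 3 [this]
  push_cast; ring

lemma ccoroot_line (i : ι) (q v : V) (z : ℂ) :
    ccoroot P i (line q v z) = P.coroot' i q + z * P.coroot' i v := by
  rw [ccoroot_eq_clin, clin_line]

lemma smul_line (w : P.weylGroup) (q v : V) (z : ℂ) :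
    w • line q v z = line (w • q) (w • v) z := by
  simp [line, weyl_smul_smul]

lemma HolOn.continuous_line {H : AffineSubspace ℝ V} {F : V × V → ℂ} (hF : HolOn H F) {q v : V}
    (hq : q ∈ H) (hv : v ∈ H.direction) : Continuous fun z => F (line q v z) := by
  have h := (hF q hq 1 (fun _ => v) fun _ => hv).continuous.comp
    (continuous_pi fun _ => continuous_id : Continuous fun z : ℂ => fun _ : Fin 1 => z)
  convert h using 2 with z
  simp [line]

lemma cval_eq {H : AffineSubspace ℝ V} {X : H → ℂ} {A : V →ᵃ[ℝ] ℂ} (hA : ∀ p : H, X p = A p)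
    {l : V × V} (hl : l ∈ cpts H) : cval X l = A l.1 + Complex.I * A.linear l.2 := by
  have hadd : l.2 + l.1 ∈ H := AffineSubspace.vadd_mem_of_mem_direction hl.2 hl.1
  have h := A.map_vadd l.1 l.2
  rw [vadd_eq_add, vadd_eq_add] at h
  rw [cval, ext, ext, dif_pos hl.1, dif_pos hadd, hA, hA, h]
  ring

lemma holOn_cval {H : AffineSubspace ℝ V} {X : H → ℂ} (hX : IsAffStar X) : HolOn H (cval X) := by
  obtain ⟨⟨A, hA⟩, -⟩ := hX
  intro p hp n u hu
  have : ∀ z : Fin n → ℂ, cval X (p + ∑ j, (z j).re • u j, ∑ j, (z j).im • u j) =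
      A p + ∑ j, z j * A.linear (u j) := by
    intro z
    have hs : ∀ c : Fin n → ℝ, ∑ j, c j • u j ∈ H.direction := fun c =>
      Submodule.sum_mem _ fun j _ => Submodule.smul_mem _ _ (hu j)
    have hl : (p + ∑ j, (z j).re • u j, ∑ j, (z j).im • u j) ∈ cpts H := by
      refine ⟨?_, hs _⟩
      have := AffineSubspace.vadd_mem_of_mem_direction (hs fun j => (z j).re) hp
      rwa [vadd_eq_add, add_comm] at this
    rw [cval_eq hA hl]
    have h := A.map_vadd p (∑ j, (z j).re • u j)
    rw [vadd_eq_add, vadd_eq_add, add_comm] at h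
    simp only [h, map_sum, map_smul, Complex.real_smul]
    rw [Finset.mul_sum, add_right_comm, ← Finset.sum_add_distrib, add_comm]
    congr 1
    refine Finset.sum_congr rfl fun j _ => ?_
    nth_rewrite 3 [← Complex.re_add_im (z j)]
    ring
  simp only [this]
  fun_prop

lemma AffEquiv.symm {L : AffineSubspace ℝ V} {X Y : L → ℂ} (h : AffEquiv X Y) : AffEquiv Y X := by
  rcases h with rfl | rfl
  · exact Or.inl rfl
  · exact Or.inr (by abel)

lemma AffEquiv.trans {L : AffineSubspace ℝ V} {X Y Z : L → ℂ} (h : AffEquiv X Y)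
    (h' : AffEquiv Y Z) : AffEquiv X Z := by
  rcases h with rfl | rfl
  · exact h'
  · rcases h' with rfl | rfl
    · exact Or.inr rfl
    · exact Or.inl (by abel)

lemma affEquiv_corootOn_iff {H : AffineSubspace ℝ V} {i j : ι} :
    AffEquiv (corootOn P H i) (corootOn P H j) ↔ i ∈ cls P H j := by
  unfold AffEquiv cls corootOn
  refine or_congr ⟨fun h p hp => ?_, fun h => ?_⟩ ⟨fun h p hp => ?_, fun h => ?_⟩
  · exact_mod_cast congrFun h ⟨p, hp⟩
  · funext p; exact_mod_cast h p p.2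
  · have := congrFun h ⟨p, hp⟩
    simp only [Pi.sub_apply, Pi.one_apply] at this
    exact_mod_cast this
  · funext p
    simp only [Pi.sub_apply, Pi.one_apply]
    exact_mod_cast h p p.2

/-- A coroot as a complex valued affine map. -/
def corootAff (i : ι) : V →ᵃ[ℝ] ℂ :=
  (Complex.ofRealCLM.toLinearMap ∘ₗ P.coroot' i).toAffineMap

lemma corootAff_apply (i : ι) (v : V) : corootAff (P := P) i v = (P.coroot' i v : ℂ) := rfl

/-- The quadratic polynomial with zeros `a` and `1 - a`. -/
def quad (a s : ℂ) : ℂ := (s - a) * (s - (1 - a))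

lemma quad_symm (a s : ℂ) : quad a s = quad a (1 - s) := by unfold quad; ring

lemma differentiable_quad (a : ℂ) : Differentiable ℂ (quad a) := by unfold quad; fun_prop

lemma quad_ne_zero {a s : ℂ} (h1 : s ≠ a) (h2 : s ≠ 1 - a) : quad a s ≠ 0 :=
  mul_ne_zero (sub_ne_zero.2 h1) (sub_ne_zero.2 h2)

variable [FiniteDimensional ℝ V]

lemma count_clsMS {H : AffineSubspace ℝ V} (A : Set ι) {i : ι} (hi : i ∉ constSet P H) :
    open Classical in Multiset.count (cls P H i) (clsMS P H (A \ constSet P H)) =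
      (Finset.univ.filter fun j => j ∈ A ∧ j ∈ cls P H i).card := by
  classical
  rw [clsMS, Multiset.count_map, ← Finset.filter_val, Finset.card_val, Finset.filter_filter]
  congr 1
  ext j
  simp only [Finset.mem_filter, Finset.mem_univ, true_and, Set.mem_sdiff]
  constructor
  · rintro ⟨⟨h1, h2⟩, h3⟩
    exact ⟨h1, cls_eq_iff.1 h3.symm⟩
  · rintro ⟨h1, h3⟩
    exact ⟨⟨h1, notMem_constSet_of_mem_cls h3 hi⟩, (cls_eq_of_mem h3).symm⟩

lemma multiset_prod_filter_pow {κ : Type*} (s : Multiset κ) (p : κ → Prop) [DecidablePred p]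
    (F : κ → ℂ) (h : ℂ) (hF : ∀ i ∈ s, p i → F i = h) :
    (s.map F).prod = h ^ s.countP p * ((s.filter fun i => ¬ p i).map F).prod := by
  have h1 : (s.filter p).map F = (s.filter p).map fun _ => h :=
    Multiset.map_congr rfl fun i hi => hF i (Multiset.mem_of_mem_filter hi)
      (Multiset.of_mem_filter hi)
  nth_rewrite 1 [← Multiset.filter_add_not p s]
  rw [Multiset.map_add, Multiset.prod_add, h1, Multiset.map_const', Multiset.prod_replicate,
    Multiset.countP_eq_card_filter]

lemma comp_cval_of_affEquiv {H : AffineSubspace ℝ V} {X Y : H → ℂ} (h : AffEquiv X Y) {l : V × V}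
    (hl : l ∈ cpts H) {f : ℂ → ℂ} (hf : ∀ z, f z = f (1 - z)) : f (cval X l) = f (cval Y l) := by
  rcases h with rfl | rfl
  · rfl
  · have hadd : l.2 + l.1 ∈ H := AffineSubspace.vadd_mem_of_mem_direction hl.2 hl.1
    have : cval (1 - Y) l = 1 - cval Y l := by
      simp only [cval, ext, dif_pos hl.1, dif_pos hadd, Pi.sub_apply, Pi.one_apply]
      ring
    rw [this, ← hf]

namespace CosetDatum

variable (D : CosetDatum P)

include b in
-- `RestrictionHol` allows any presentation A/B. It is compared with num/den off the zeros of a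
-- nonzero entire function, so the cross-multiplied identity holds everywhere, and `B` can then be
-- cancelled on `H`.
lemma exists_of_restrictionHol {H : AffineSubspace ℝ V} {p₀ : V} (hp : p₀ ∈ H) {ρ : ℂ → ℂ}
    (hρ : Differentiable ℂ ρ) (hρ0 : ρ ≠ 0) {φ : V × V → ℂ} (hφ : HolOn ⊤ φ) {g : V × V → ℂ}
    (hg : HolOn H g) (h : RestrictionHol P ρ (D.sumF ρ φ) H g) :
    ∃ G, HolOn H G ∧ ∀ l ∈ cpts H, G l * D.den ρ l = g l * D.num ρ φ l := by
  obtain ⟨A, B, hA, hB, ⟨l₀, hl₀, hB0⟩, hAB, G, hG, hGB⟩ := h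
  obtain ⟨s, hs⟩ : ∃ s, ρ s ≠ 0 := by
    by_contra! h
    exact hρ0 (funext h)
  have h0 : (0 : V) ∈ (⊤ : AffineSubspace ℝ V) := AffineSubspace.mem_top _ _ _
  have hsurj : ∀ (i : ι) (s : ℂ), ∃ l ∈ cpts (⊤ : AffineSubspace ℝ V), ccoroot P i l = s := by
    intro i s
    refine ⟨((s.re / 2) • P.root i, (s.im / 2) • P.root i),
      ⟨AffineSubspace.mem_top _ _ _, by simp⟩, ?_⟩
    have h2 : P.coroot' i (P.root i) = 2 := by simp [RootPairing.coroot']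
    simp only [ccoroot, map_smul, h2, smul_eq_mul]
    push_cast
    nth_rewrite 3 [← Complex.re_add_im s]
    ring
  obtain ⟨l₁, hl₁, h₁⟩ := holOn_prod_ne_zero h0 Finset.univ
    (F := fun i l => ccoroot P i l * ρ (ccoroot P i l))
    (fun i _ => (holOn_ccoroot P ⊤ i).mul ((holOn_ccoroot P ⊤ i).comp hρ)) fun i _ => by
      obtain ⟨l₁, hl₁, h₁⟩ := hsurj i 1
      obtain ⟨l₂, hl₂, h₂⟩ := hsurj i s
      by_contra! hc
      have := holOn_eq_zero_of_mul h0 (holOn_ccoroot P ⊤ i) ((holOn_ccoroot P ⊤ i).comp hρ) hc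
        ⟨l₁, hl₁, by rw [h₁]; exact one_ne_zero⟩ l₂ hl₂
      rw [h₂] at this
      exact hs this
  have key : ∀ l ∈ cpts (⊤ : AffineSubspace ℝ V), A l * D.den ρ l - B l * D.num ρ φ l = 0 := by
    refine holOn_eq_zero_of_mul h0
      (HolOn.prod Finset.univ fun i _ => (holOn_ccoroot P ⊤ i).mul ((holOn_ccoroot P ⊤ i).comp hρ))
      ((hA.mul (D.holOn_den hρ)).sub (hB.mul (D.holOn_num hρ hφ))) (fun l _ => ?_) ⟨l₁, hl₁, h₁⟩
    by_cases hl : ∀ i, ccoroot P i l ≠ 0 ∧ ρ (ccoroot P i l) ≠ 0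
    · rw [D.num_eq_den_mul φ hl, hAB l hl]; ring
    · push Not at hl
      obtain ⟨i, hi⟩ := hl
      refine mul_eq_zero_of_left (Finset.prod_eq_zero (Finset.mem_univ i) ?_) _
      by_cases hi0 : ccoroot P i l = 0
      · rw [hi0, zero_mul]
      · rw [hi hi0, mul_zero]
  refine ⟨G, hG, fun l hl => sub_eq_zero.1 (holOn_eq_zero_of_mul hp (hB.mono le_top)
    ((hG.mul ((D.holOn_den hρ).mono le_top)).sub (hg.mul ((D.holOn_num hρ hφ).mono le_top)))
    (fun l hl => ?_) ⟨l₀, hl₀, hB0⟩ l hl)⟩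
  have h1 := key l ⟨AffineSubspace.mem_top _ _ _, by simp⟩
  have h2 := hGB l hl
  linear_combination D.den ρ l * h2 + g l * h1

/-- A product of values of `ρ` factors into its zero and nonzero parts. -/
lemma prod_filter_pow {κ : Type*} (s : Finset κ) (p : κ → Prop) [DecidablePred p] (F : κ → ℂ)
    (h : ℂ) (hF : ∀ i ∈ s, p i → F i = h) :
    ∏ i ∈ s, F i = h ^ (s.filter p).card * ∏ i ∈ s with ¬ p i, F i := by
  rw [← Finset.prod_filter_mul_prod_filter_not s p, Finset.prod_congr rfl fun i hi =>
    hF i (Finset.mem_filter.1 hi).1 (Finset.mem_filter.1 hi).2, Finset.prod_const]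

include b in
/-- The order of the pole of the sum at a zero of `ρ ∘ α` is bounded below by each term. -/
lemma count_le_of_clears {H : AffineSubspace ℝ V} {p₀ : V} (hp : p₀ ∈ H) (hH : zeroSet P H = ∅)
    {T : Multiset (H → ℂ)} (hT : Clears P D.sumF D.pos H T) {i₀ : ι} (hi₀ : i₀ ∉ constSet P H)
    {w : P.weylGroup} (hw : w ∈ D.surv H) : open Classical in
    (Finset.univ.filter fun j => j ∈ D.pos ∧ j ∈ cls P H i₀).card ≤
      T.countP (fun X => AffEquiv X (corootOn P H i₀)) +
      (Finset.univ.filter fun j => w • j ∈ D.pos ∧ j ∈ cls P H i₀).card := by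
  classical
  obtain ⟨hTA, hT⟩ := hT
  have hchoose : ∀ X : H → ℂ, ∃ A : V →ᵃ[ℝ] ℂ, X ∈ T → ∀ p : H, X p = A p := fun X => by
    by_cases hX : X ∈ T
    · obtain ⟨⟨A, hA⟩, -⟩ := hTA X hX
      exact ⟨A, fun _ => hA⟩
    · exact ⟨0, fun h => absurd h hX⟩
  choose AT hAT using hchoose
  set S₀ : Finset (V →ᵃ[ℝ] ℂ) :=
    Finset.univ.image (corootAff (P := P)) ∪ T.toFinset.image AT with hS₀
  have hc₀ : ∀ i, corootAff (P := P) i ∈ S₀ := fun i =>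
    Finset.mem_union_left _ (Finset.mem_image_of_mem _ (Finset.mem_univ _))
  -- At `q`, a coroot or an element of `T` takes the value 0, -1, α(q) or 1 - α(q), with α the
  -- coroot of `i₀`, only if the corresponding identity holds on all of `H`.
  obtain ⟨q, hq, hgen⟩ := exists_generic hp (S₀ ∪ S₀.image (fun f : V →ᵃ[ℝ] ℂ => f + AffineMap.const ℝ V 1) ∪
    S₀.image (fun f : V →ᵃ[ℝ] ℂ => f - corootAff (P := P) i₀) ∪
    S₀.image (fun f : V →ᵃ[ℝ] ℂ => f + (corootAff (P := P) i₀ - AffineMap.const ℝ V 1)))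
  have g1 : ∀ f ∈ S₀, f q = 0 → ∀ p ∈ H, f p = 0 := fun f hf =>
    hgen f (by simp only [Finset.mem_union]; exact Or.inl (Or.inl (Or.inl hf)))
  have g2 : ∀ f ∈ S₀, f q + 1 = 0 → ∀ p ∈ H, f p + 1 = 0 := fun f hf h =>
    hgen (f + AffineMap.const ℝ V 1) (by
      simp only [Finset.mem_union]; exact Or.inl (Or.inl (Or.inr (Finset.mem_image_of_mem _ hf)))) h
  have g3 : ∀ f ∈ S₀, f q = P.coroot' i₀ q → ∀ p ∈ H, f p = P.coroot' i₀ p := fun f hf h p hp =>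
    sub_eq_zero.1 (hgen (f - corootAff (P := P) i₀) (by
      simp only [Finset.mem_union]; exact Or.inl (Or.inr (Finset.mem_image_of_mem _ hf)))
        (sub_eq_zero.2 h) p hp)
  have g4 : ∀ f ∈ S₀, f q = 1 - P.coroot' i₀ q → ∀ p ∈ H, f p = 1 - P.coroot' i₀ p :=
    fun f hf h p hp => by
      have : f p + (P.coroot' i₀ p - 1) = 0 :=
        hgen (f + (corootAff (P := P) i₀ - AffineMap.const ℝ V 1)) (by
          simp only [Finset.mem_union]; exact Or.inr (Finset.mem_image_of_mem _ hf))
          (by change f q + (P.coroot' i₀ q - 1) = 0; rw [h]; ring) p hp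
      linear_combination this
  obtain ⟨v, hv, hv0⟩ : ∃ v ∈ H.direction, P.coroot' i₀ v ≠ 0 := by
    by_contra! h
    exact hi₀ ((mem_constSet_iff hp).2 h)
  set a : ℂ := ((P.coroot' i₀ q : ℝ) : ℂ) with ha
  set y : ℂ := ((P.coroot' i₀ v : ℝ) : ℂ) with hy
  have hy0 : y ≠ 0 := by rw [hy]; exact_mod_cast hv0
  have hne : ∀ j, j ∉ cls P H i₀ → (P.coroot' j q : ℂ) ≠ a ∧ (P.coroot' j q : ℂ) ≠ 1 - a := by
    refine fun j hj => ⟨fun h => hj (Or.inl fun p hp => ?_), fun h => hj (Or.inr fun p hp => ?_)⟩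
    · exact Complex.ofReal_injective (g3 _ (hc₀ j) h p hp)
    · refine Complex.ofReal_injective ((g4 _ (hc₀ j) h p hp).trans ?_)
      push_cast; rfl
  -- As `a` is not 1/2, the zeros of `quad a` at `a` and `1 - a` are simple.
  have ha2 : 2 * a - 1 ≠ 0 := fun h => by
    refine hi₀ ⟨1 / 2, fun p hp => ?_⟩
    have := g4 _ (hc₀ i₀) (by rw [corootAff_apply]; linear_combination h) p hp
    rw [corootAff_apply] at this
    have h3 : P.coroot' i₀ p = 1 - P.coroot' i₀ p := by exact_mod_cast this
    linarith
  have hreg : ∀ i, P.coroot' i q ≠ 0 := fun i h => by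
    have : i ∈ zeroSet P H := fun p hp => by
      exact Complex.ofReal_injective (g1 _ (hc₀ i) (by rw [corootAff_apply, h]; simp) p hp)
    rw [hH] at this
    exact this
  set mP := (Finset.univ.filter fun j => j ∈ D.pos ∧ j ∈ cls P H i₀).card with hmP
  set mT := T.countP (fun X => AffEquiv X (corootOn P H i₀)) with hmT
  set mw := (Finset.univ.filter fun j => w • j ∈ D.pos ∧ j ∈ cls P H i₀).card with hmw
  by_contra! hlt
  -- Regularity of `H` makes the generic point `q` regular, so its translates are pairwise distinct
  -- and linear forms separate them.
  have hsep : ∀ u : P.weylGroup, ∃ f : V →ₗ[ℝ] ℝ, u ≠ w → f (w • q) - f (u • q) ≠ 0 := by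
    intro u
    by_cases hu : u = w
    · exact ⟨0, fun h => absurd hu h⟩
    · have hne : w • q - u • q ≠ 0 := fun h => by
        have h1 : (w⁻¹ * u) • q = q := by
          rw [mul_smul, ← sub_eq_zero.1 h, inv_smul_smul]
        have h2 := weyl_eq_one_of_regular P b hreg h1
        exact hu (inv_mul_eq_one.1 h2).symm
      by_contra! hc
      refine hne ((Module.forall_dual_apply_eq_zero_iff ℝ (w • q - u • q)).1 fun f => ?_)
      rw [map_sub]; exact (hc f).2
  choose f hf using hsep
  -- The test function vanishes to order at least `mP` at every translate of `q` by the coset except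
  -- `w • q`, so only the term of `w` can contribute below that order.
  set φ : V × V → ℂ := fun l =>
    (∏ u ∈ D.coset.erase w, (clin (f u) l - f u (u • q))) ^ mP with hφd
  have hφ : HolOn ⊤ φ := (HolOn.prod _ fun u _ => (holOn_clin ⊤ (f u)).sub (HolOn.const _)).pow mP
  set ρ := quad a with hρd
  have hρ : Differentiable ℂ ρ := differentiable_quad a
  have hsy : ∀ s, ρ s = ρ (1 - s) := quad_symm a
  have hρ0 : ρ ≠ 0 := fun h => by
    obtain ⟨s, hs⟩ := Infinite.exists_notMem_finset ({a, 1 - a} : Finset ℂ)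
    simp only [Finset.mem_insert, Finset.mem_singleton, not_or] at hs
    exact quad_ne_zero hs.1 hs.2 (congrFun h s)
  have hg : HolOn H fun l => (T.map fun X => ρ (cval X l)).prod :=
    HolOn.multiset_prod _ fun X hX => (holOn_cval (hTA X hX)).comp hρ
  obtain ⟨G, hG, hGe⟩ := D.exists_of_restrictionHol b hp hρ hρ0 hφ hg
    (hT ρ hρ hρ0 (quad_symm a) (fun i _ c hc => by
      have hi : i ∉ cls P H i₀ := fun h => notMem_constSet_of_mem_cls h hi₀ ⟨c, hc⟩
      have h := hne i hi
      rw [hc q hq] at h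
      have h1 : ρ c ≠ 0 := quad_ne_zero h.1 h.2
      exact ⟨h1, by rwa [hρd, ← quad_symm]⟩) φ hφ)
  -- Along the line `q + z v` each factor ρ(α_j) with `j` in the class is `z * h z` with `h 0 ≠ 0`;
  -- every other factor is nonzero at `z = 0`.
  set h : ℂ → ℂ := fun z => y * (2 * a - 1 + z * y) with hh
  have hcls : ∀ j ∈ cls P H i₀, ∀ z, ρ (ccoroot P j (line q v z)) = z * h z := by
    intro j hj z
    rw [comp_ccoroot_of_mem_cls hj (line_mem hq hv z) hsy, ccoroot_line, hρd, quad, hh]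
    ring
  have hnc : ∀ j, j ∉ cls P H i₀ → ρ (ccoroot P j (line q v 0)) ≠ 0 := by
    intro j hj
    rw [ccoroot_line, zero_mul, add_zero]
    exact quad_ne_zero (hne j hj).1 (hne j hj).2
  have hcρ : ∀ j, Continuous fun z => ρ (ccoroot P j (line q v z)) := fun j =>
    hρ.continuous.comp ((holOn_ccoroot P H j).continuous_line hq hv)
  have hTz : ∀ z, (T.map fun X => ρ (cval X (line q v z))).prod = (z * h z) ^ mT *
      ((T.filter fun X => ¬ AffEquiv X (corootOn P H i₀)).map
        fun X => ρ (cval X (line q v z))).prod := fun z =>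
    multiset_prod_filter_pow _ _ _ _ fun X _ hX => by
      rw [← hcls i₀ (mem_cls_self H i₀) z, comp_cval_of_affEquiv hX (line_mem hq hv z)
        hsy, cval_corootOn _ (line_mem hq hv z)]
  have hT0 : ((T.filter fun X => ¬ AffEquiv X (corootOn P H i₀)).map
      fun X => ρ (cval X (line q v 0))).prod ≠ 0 := by
    refine Multiset.prod_ne_zero fun h0 => ?_
    obtain ⟨X, hX, hX0⟩ := Multiset.mem_map.1 h0
    obtain ⟨hXT, hXn⟩ := Multiset.mem_filter.1 hX
    have hval : cval X (line q v 0) = AT X q := by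
      rw [cval_eq (hAT X hXT) (line_mem hq hv 0), line_zero]; simp
    have hmem : AT X ∈ S₀ := Finset.mem_union_right _
      (Finset.mem_image_of_mem _ (Multiset.mem_toFinset.2 hXT))
    rw [hval] at hX0
    refine quad_ne_zero (fun h => hXn (Or.inl ?_)) (fun h => hXn (Or.inr ?_)) hX0
    · funext p
      rw [hAT X hXT, g3 _ hmem h p p.2]; rfl
    · funext p
      rw [hAT X hXT, g4 _ hmem h p p.2]; rfl
  have hwprod : ∀ z, ∏ i ∈ D.posIdx, ρ (ccoroot P i (w • line q v z)) = (z * h z) ^ mw *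
      ∏ j ∈ Finset.univ with w • j ∈ D.pos ∧ j ∉ cls P H i₀, ρ (ccoroot P j (line q v z)) := by
    intro z
    have h1 : ∏ i ∈ D.posIdx, ρ (ccoroot P i (w • line q v z)) =
        ∏ j ∈ Finset.univ.filter (fun j => w • j ∈ D.pos), ρ (ccoroot P j (line q v z)) := by
      refine Finset.prod_bij' (fun i _ => w⁻¹ • i) (fun j _ => w • j) ?_ ?_ ?_ ?_ ?_
      · intro i hi; simpa using D.mem_posIdx.1 hi
      · intro j hj; rw [mem_posIdx]; simpa using hj
      · intro i _; exact smul_inv_smul _ _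
      · intro i _; exact inv_smul_smul _ _
      · intro i _; rw [ccoroot_smul]
    rw [h1, prod_filter_pow _ (fun j => j ∈ cls P H i₀) _ _ fun j _ hj => hcls j hj z,
      Finset.filter_filter, Finset.filter_filter]
  have hdprod : ∀ z, ∏ i ∈ D.posIdx, ρ (ccoroot P i (line q v z)) = (z * h z) ^ mP *
      ∏ j ∈ Finset.univ with j ∈ D.pos ∧ j ∉ cls P H i₀, ρ (ccoroot P j (line q v z)) := by
    intro z
    rw [prod_filter_pow _ (fun j => j ∈ cls P H i₀) _ _ fun j _ hj => hcls j hj z, posIdx,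
      Finset.filter_filter, Finset.filter_filter]
  have hother : ∀ u ∈ D.coset.erase w, ∃ K : ℂ → ℂ, Continuous K ∧
      ∀ z, φ (u • line q v z) = z ^ mP * K z := by
    intro u hu
    refine ⟨fun z => ((f u (u • v) : ℂ) * ∏ u' ∈ (D.coset.erase w).erase u,
      (clin (f u') (u • line q v z) - f u' (u' • q))) ^ mP, ?_, fun z => ?_⟩
    · refine (continuous_const.mul (continuous_finsetProd _ fun u' _ => ?_)).pow _
      simp only [smul_line, clin_line]
      fun_prop
    · rw [hφd]
      simp only
      rw [← Finset.mul_prod_erase _ _ hu, ← mul_pow, smul_line, clin_line]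
      congr 1
      ring
  have hwφ : φ (w • line q v 0) ≠ 0 := by
    refine pow_ne_zero _ (Finset.prod_ne_zero_iff.2 fun u hu => ?_)
    rw [line_zero]
    have := hf u (Finset.ne_of_mem_erase hu)
    have h2 : clin (f u) (w • (q, (0 : V))) = f u (w • q) := by
      change ((f u (w • q) : ℝ) : ℂ) + Complex.I * (f u (w • (0 : V)) : ℝ) = _
      rw [smul_zero]; simp
    rw [h2]
    exact_mod_cast this
  have hwc : w ∈ D.coset := Finset.mem_of_mem_filter _ hw
  -- A vanishing factor would, by genericity, give a coroot identically 1 on `H` that contradicts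
  -- the survival of `w`.
  have hwP : ∏ i ∈ D.idx, (ccoroot P i (w • line q v 0) + 1) ≠ 0 := by
    refine Finset.prod_ne_zero_iff.2 fun i hi h0 => ?_
    rw [ccoroot_smul, ccoroot_line, zero_mul, add_zero] at h0
    have h1 := g2 _ (hc₀ (w⁻¹ • i)) h0
    have h2 : negIdx P (w⁻¹ • i) ∈ poleSet P H := fun p hp => by
      have h3 : ((P.coroot' (w⁻¹ • i) p : ℝ) : ℂ) + 1 = 0 := h1 p hp
      have h4 : P.coroot' (w⁻¹ • i) p + 1 = 0 := by exact_mod_cast h3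
      rw [coroot'_negIdx]
      linarith
    have h3 := (Finset.mem_filter.1 hw).2 _ h2
    rw [weyl_smul_negIdx, smul_inv_smul, D.neg_mem_sub, D.neg_mem_pos] at h3
    exact h3 (D.mem_idx.1 hi).2 (D.mem_idx.1 hi).1
  choose! K hKc hK using hother
  set ET : ℂ → ℂ := fun z => ((T.filter fun X => ¬ AffEquiv X (corootOn P H i₀)).map
        fun X => ρ (cval X (line q v z))).prod with hET
  set EW : ℂ → ℂ := fun z => ∏ j ∈ Finset.univ with w • j ∈ D.pos ∧ j ∉ cls P H i₀,
    ρ (ccoroot P j (line q v z)) with hEW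
  set EP : ℂ → ℂ := fun z => ∏ j ∈ Finset.univ with j ∈ D.pos ∧ j ∉ cls P H i₀,
    ρ (ccoroot P j (line q v z)) with hEP
  set PB : ℂ → ℂ := fun z => ∏ i ∈ D.idx, ccoroot P i (D.base • line q v z) with hPB
  set PW : P.weylGroup → ℂ → ℂ := fun u z => ∏ i ∈ D.idx, (ccoroot P i (u • line q v z) + 1)
    with hPW
  set RW : P.weylGroup → ℂ → ℂ := fun u z => ∏ i ∈ D.posIdx, ρ (ccoroot P i (u • line q v z))
    with hRW
  have hcu : ∀ (u : P.weylGroup) (i : ι), Continuous fun z => ccoroot P i (u • line q v z) :=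
    fun u i => (holOn_ccoroot_smul P u H i).continuous_line hq hv
  have cET : Continuous ET := by
    refine continuous_multiset_prod _ fun X hX => ?_
    exact hρ.continuous.comp
      ((holOn_cval (hTA X (Multiset.mem_of_mem_filter hX))).continuous_line hq hv)
  have cEW : Continuous EW := continuous_finsetProd _ fun j _ => hcρ j
  have cEP : Continuous EP := continuous_finsetProd _ fun j _ => hcρ j
  have cPB : Continuous PB := continuous_finsetProd _ fun i _ => hcu _ i
  have cPW : ∀ u, Continuous (PW u) := fun u =>
    continuous_finsetProd _ fun i _ => (hcu u i).add continuous_const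
  have cRW : ∀ u, Continuous (RW u) := fun u =>
    continuous_finsetProd _ fun i _ => hρ.continuous.comp (hcu u i)
  have cG : Continuous fun z => G (line q v z) := hG.continuous_line hq hv
  have cφ : Continuous fun z => φ (w • line q v z) :=
    ((hφ.smul w).mono (le_top : H ≤ ⊤)).continuous_line hq hv
  have ch : Continuous h := by rw [hh]; fun_prop
  -- The denominator side and all terms other than that of `w` are divisible by `z ^ mP`, while the
  -- term of `w` has exact order `mT + mw`, assumed smaller.
  have hfin := eq_zero_of_pow_mul_eq hlt
    (U := fun z => G (line q v z) * (PB z * (h z ^ mP * EP z)) - (z * h z) ^ mT * ET z *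
      ∑ u ∈ D.coset.erase w, D.sign u * PW u z * RW u z * K u z)
    (R := fun z => h z ^ mT * ET z * (D.sign w * PW w z * (h z ^ mw * EW z) * φ (w • line q v z)))
    (by
      refine (cG.mul (cPB.mul ((ch.pow _).mul cEP))).sub
        ((((continuous_id.mul ch).pow _).mul cET).mul (continuous_finsetSum _ fun u hu => ?_))
      exact ((continuous_const.mul (cPW u)).mul (cRW u)).mul (hKc u hu))
    (((ch.pow _).mul cET).mul (((continuous_const.mul (cPW w)).mul ((ch.pow _).mul cEW)).mul cφ))
    (fun z => by
      have e1 := hGe _ (line_mem hq hv z)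
      have e2 : D.num ρ φ (line q v z) = D.sign w * PW w z * ((z * h z) ^ mw * EW z) *
          φ (w • line q v z) + z ^ mP *
            ∑ u ∈ D.coset.erase w, D.sign u * PW u z * RW u z * K u z := by
        rw [num, ← Finset.add_sum_erase _ _ hwc, hwprod z, Finset.mul_sum]
        congr 1
        refine Finset.sum_congr rfl fun u hu => ?_
        rw [hK u hu z]
        ring
      rw [e2, den, hdprod z] at e1
      rw [hTz z] at e1
      simp only [mul_pow] at e1 ⊢
      rw [pow_add]
      linear_combination e1)
  have hh0 : h 0 ≠ 0 := by
    rw [hh]; simp only [zero_mul, add_zero]; exact mul_ne_zero hy0 ha2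
  have hEW0 : EW 0 ≠ 0 := Finset.prod_ne_zero_iff.2 fun j hj =>
    hnc j (Finset.mem_filter.1 hj).2.2
  have hsg : D.sign w ≠ 0 := by
    rcases D.sign_eq hwc with h | h <;> rw [h] <;> simp
  exact mul_ne_zero (mul_ne_zero (pow_ne_zero _ hh0) hT0)
    (mul_ne_zero (mul_ne_zero (mul_ne_zero hsg hwP) (mul_ne_zero (pow_ne_zero _ hh0) hEW0)) hwφ)
    hfin

end CosetDatum

lemma affEquiv_repFun {H : AffineSubspace ℝ V} (i : ι) :
    AffEquiv (repFun P H (cls P H i)) (corootOn P H i) := by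
  have hne : (cls P H i).Nonempty := ⟨i, mem_cls_self H i⟩
  rw [repFun, dif_pos hne, affEquiv_corootOn_iff]
  exact hne.some_mem

lemma CosetDatum.denCls_mono (D : CosetDatum P) {H : AffineSubspace ℝ V} {c : Set ι} {n : ℕ}
    (h : ∀ w ∈ D.surv H, open Classical in Multiset.count c (clsMS P H (D.pos \ constSet P H)) ≤
      n + Multiset.count c (clsMS P H ({j | w • j ∈ D.pos} \ constSet P H))) :
    open Classical in Multiset.count c (D.denCls H) ≤ n := by
  classical
  rw [denCls, Multiset.count_finset_sup]
  refine Finset.sup_le fun w hw => ?_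
  rw [Multiset.count_sub]
  have := h w hw
  convert tsub_le_iff_right.2 this using 2

include b in
/-- The denominators are the least multiset which clears denominators. -/
theorem CosetDatum.isDen_denMS (D : CosetDatum P) {H : AffineSubspace ℝ V} {p₀ : V} (hp : p₀ ∈ H)
    (hH : zeroSet P H = ∅) : IsDen P D.sumF D.pos H (D.denMS H) := by
  classical
  refine ⟨D.clears_denMS b hp hH, fun T hT ν => ?_⟩
  by_cases hν : ∃ c ∈ D.denCls H, AffEquiv (repFun P H c) ν
  · obtain ⟨c, hc, hcν⟩ := hν
    obtain ⟨i, hi, hic, rfl⟩ := D.exists_of_mem_denCls hc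
    have hiν : AffEquiv (corootOn P H i) ν := (affEquiv_repFun i).symm.trans hcν
    have h1 : multClass T ν = T.countP fun X => AffEquiv X (corootOn P H i) :=
      Multiset.countP_congr rfl fun X _ =>
        propext ⟨fun h => h.trans hiν.symm, fun h => h.trans hiν⟩
    have h2 : multClass (D.denMS H) ν = (D.denCls H).count (cls P H i) := by
      rw [multClass, denMS, Multiset.countP_map, Multiset.count, Multiset.countP_eq_card_filter]
      congr 1
      refine Multiset.filter_congr fun c hc => ?_
      obtain ⟨j, -, -, rfl⟩ := D.exists_of_mem_denCls hc
      constructor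
      · intro h
        exact (cls_eq_iff.2 (affEquiv_corootOn_iff.1
          (((affEquiv_repFun j).symm.trans h).trans hiν.symm))).symm
      · intro h
        rw [← h]; exact (affEquiv_repFun i).trans hiν
    rw [h1, h2]
    refine D.denCls_mono fun w hw => ?_
    rw [count_clsMS _ hic, count_clsMS _ hic]
    exact D.count_le_of_clears b hp hH hT hic hw
  · have : multClass (D.denMS H) ν = 0 := by
      rw [multClass, Multiset.countP_eq_zero]
      intro X hX h
      obtain ⟨c, hc, rfl⟩ := Multiset.mem_map.1 hX
      exact hν ⟨c, hc, h⟩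
    rw [this]
    exact Nat.zero_le _

end MinDen

/-! ### Counting denominators of the three families by Weyl-invariant numbers. -/

section Count

variable {ι V N : Type*} [Fintype ι] [AddCommGroup V] [Module ℝ V] [AddCommGroup N] [Module ℝ N]
  (P : RootPairing ι ℝ V N) [P.IsRootSystem] [P.IsCrystallographic] [P.IsReduced] (b : P.Base)
  (k : ι)

/-! ### Multisets with equal multiplicities of classes -/

/-- The equivalence `∼` as a setoid. -/
def affSetoid (L : AffineSubspace ℝ V) : Setoid (L → ℂ) :=
  ⟨AffEquiv, ⟨fun _ => Or.inl rfl, AffEquiv.symm, AffEquiv.trans⟩⟩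

lemma countP_eq_of_multClass {L : AffineSubspace ℝ V} {T₁ T₂ : Multiset (L → ℂ)}
    (h : ∀ ν, multClass T₁ ν = multClass T₂ ν) (p : (L → ℂ) → Prop) [DecidablePred p]
    (hp : ∀ X Y, AffEquiv X Y → p X → p Y) : T₁.countP p = T₂.countP p := by
  classical
  let mk : (L → ℂ) → Quotient (affSetoid L) := Quotient.mk _
  have hc : ∀ (T : Multiset (L → ℂ)) (ν : L → ℂ), (T.map mk).count (mk ν) = multClass T ν := by
    intro T ν
    rw [Multiset.count_map, multClass, Multiset.countP_eq_card_filter]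
    congr 1
    refine Multiset.filter_congr fun X _ => ?_
    rw [eq_comm]
    exact Quotient.eq (r := affSetoid L)
  have hmap : T₁.map mk = T₂.map mk := by
    ext c
    obtain ⟨ν, rfl⟩ := Quotient.exists_rep c
    exact (hc _ _).trans ((h ν).trans (hc _ _).symm)
  let p' : Quotient (affSetoid L) → Prop := Quotient.lift p fun X Y hXY =>
    propext ⟨hp X Y hXY, hp Y X (AffEquiv.symm hXY)⟩
  have h2 : ∀ T : Multiset (L → ℂ), (T.map mk).countP p' = T.countP p := by
    intro T
    rw [Multiset.countP_map, Multiset.countP_eq_card_filter]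
    congr 1
  rw [← h2, ← h2, hmap]

variable {P} in
-- Least multisets are unique up to `∼`, so `denMS` may replace any other representative in counts.
lemma IsDen.countP_eq {F : (ℂ → ℂ) → (V × V → ℂ) → V × V → ℂ} {S : Set ι} {L : AffineSubspace ℝ V}
    {T₁ T₂ : Multiset (L → ℂ)} (h₁ : IsDen P F S L T₁) (h₂ : IsDen P F S L T₂)
    (p : (L → ℂ) → Prop) [DecidablePred p] (hp : ∀ X Y, AffEquiv X Y → p X → p Y) :
    T₁.countP p = T₂.countP p :=
  countP_eq_of_multClass (fun ν => le_antisymm (h₁.2 _ h₂.1 ν) (h₂.2 _ h₁.1 ν)) p hp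

lemma filter_finset_sup {α κ : Type*} [DecidableEq α] (s : Finset κ) (f : κ → Multiset α)
    (p : α → Prop) [DecidablePred p] : (s.sup f).filter p = s.sup fun i => (f i).filter p := by
  ext a
  rw [Multiset.count_filter, Multiset.count_finset_sup, Multiset.count_finset_sup]
  simp only [Multiset.count_filter]
  split_ifs
  · rfl
  · exact (Finset.sup_bot s).symm

section

variable [FiniteDimensional ℝ V]

lemma filter_clsMS {H : AffineSubspace ℝ V} (A : Set ι) (p : Set ι → Prop) [DecidablePred p] :
    (clsMS P H A).filter p = clsMS P H (A ∩ {i | p (cls P H i)}) := by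
  classical
  rw [clsMS, clsMS, Multiset.filter_map, ← Finset.filter_val, Finset.filter_filter]
  congr 2
  ext; simp

open Classical in
/-- The number of elements of a supremum of differences of multisets of classes of coroots. -/
def supCard (H : AffineSubspace ℝ V) (U : Finset P.weylGroup) (A : Set ι)
    (B : P.weylGroup → Set ι) : ℕ :=
  Multiset.card (U.sup fun w => clsMS P H A - clsMS P H (B w))

/-- Filtering commutes with suprema and differences of multisets, so a `∼`-invariant condition
amounts to intersecting the sets of coroots with `Q`. -/
lemma CosetDatum.countP_denMS {P : RootPairing ι ℝ V N} [P.IsRootSystem] [P.IsCrystallographic]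
    [P.IsReduced] (D : CosetDatum P) {H : AffineSubspace ℝ V}
    (p : (H → ℂ) → Prop) [DecidablePred p] (hp : ∀ X Y, AffEquiv X Y → p X → p Y) {Q : Set ι}
    (hQ : ∀ i, i ∈ Q ↔ i ∉ constSet P H ∧ p (corootOn P H i)) :
    (D.denMS H).countP p = supCard P H (D.surv H) (D.pos ∩ Q) fun w => {j | w • j ∈ D.pos} ∩ Q := by
  classical
  have hset : ∀ A : Set ι, (A \ constSet P H) ∩ {i | p (repFun P H (cls P H i))} = A ∩ Q := by
    intro A
    ext i
    have : p (repFun P H (cls P H i)) ↔ p (corootOn P H i) :=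
      ⟨hp _ _ (affEquiv_repFun i), hp _ _ (affEquiv_repFun i).symm⟩
    simp only [Set.mem_inter_iff, Set.mem_sdiff, Set.mem_ofPred_eq, hQ, this]
    tauto
  rw [denMS, Multiset.countP_map, denCls, supCard]
  congr 1
  have := filter_finset_sup (D.surv H) (fun w => clsMS P H (D.pos \ constSet P H) -
    clsMS P H ({j | w • j ∈ D.pos} \ constSet P H)) fun c => p (repFun P H c)
  convert this using 1
  refine Finset.sup_congr rfl fun w _ => ?_
  rw [Multiset.filter_sub, filter_clsMS, filter_clsMS, hset, hset]

end

/-! ### The three families of functions -/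

/-- The datum of `Σ`. -/
def datSigma : CosetDatum P where
  pos := {i | ¬ b.IsPos i}
  sub := Set.univ
  reps := Set.univ
  base := 1
  neg_mem_pos i := by simp [isPos_negIdx P b]
  neg_mem_sub _ := by simp
  refl_mem_sub _ _ _ _ := Set.mem_univ _
  mem_reps w := by simp [reflGroup_univ]

/-- The datum of `Σ_τ`. -/
def datTau : CosetDatum P where
  pos := {i | b.IsPos i}
  sub := Set.univ
  reps := Set.univ
  base := 1
  neg_mem_pos i := by simp [isPos_negIdx P b]
  neg_mem_sub _ := by simp
  refl_mem_sub _ _ _ _ := Set.mem_univ _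
  mem_reps w := by simp [reflGroup_univ]

/-- The datum of `Σ'`. -/
def datPrime (x : P.weylGroup) : CosetDatum P where
  pos := {i | b.IsPos i}
  sub := {i | IsLevi P b k i}
  reps := {w | w * x⁻¹ ∈ leviWeyl P b k}
  base := x
  neg_mem_pos i := by simp [isPos_negIdx P b]
  neg_mem_sub i := negIdx_mem_leviSet P
  refl_mem_sub i hi j hj :=
    (smul_mem_leviSet P b (fun _ h => h.1) (ofIdx_mem_reflGroup P hi)).2 hj
  mem_reps w := Iff.rfl

variable {P} in
lemma RestrictionHol.congr {ρ : ℂ → ℂ} {f f' : V × V → ℂ} {L : AffineSubspace ℝ V}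
    {g : V × V → ℂ} (hff : ∀ l, (∀ i, ccoroot P i l ≠ 0 ∧ ρ (ccoroot P i l) ≠ 0) → f l = f' l)
    (h : RestrictionHol P ρ f L g) : RestrictionHol P ρ f' L g := by
  obtain ⟨A, B, hA, hB, hne, hAB, hG⟩ := h
  exact ⟨A, B, hA, hB, hne, fun l hl => by rw [hAB l hl, hff l hl], hG⟩

variable {P} in
/-- The denominators depend only on the generic values of the functions, and the test functions may
be replaced. -/
lemma isDen_congr {F F' : (ℂ → ℂ) → (V × V → ℂ) → V × V → ℂ} {S : Set ι} {L : AffineSubspace ℝ V}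
    (σ : (V × V → ℂ) → V × V → ℂ) (hσ : ∀ φ, HolOn ⊤ φ → HolOn ⊤ (σ φ)) (hσσ : ∀ φ, σ (σ φ) = φ)
    (hF : ∀ ρ φ l, (∀ i, ccoroot P i l ≠ 0 ∧ ρ (ccoroot P i l) ≠ 0) → F ρ φ l = F' ρ (σ φ) l)
    {T : Multiset (L → ℂ)} : IsDen P F S L T ↔ IsDen P F' S L T := by
  have key : ∀ T, Clears P F S L T ↔ Clears P F' S L T := fun T => by
    refine and_congr_right fun _ => forall_congr' fun ρ => ?_
    refine forall_congr' fun _ => forall_congr' fun _ => forall_congr' fun _ =>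
      forall_congr' fun _ => ⟨fun h φ hφ => ?_, fun h φ hφ => ?_⟩
    · refine (h (σ φ) (hσ φ hφ)).congr fun l hl => ?_
      rw [hF ρ _ l hl, hσσ]
    · exact (h (σ φ) (hσ φ hφ)).congr fun l hl => (hF ρ _ l hl).symm
  unfold IsDen
  rw [key]
  exact and_congr_right fun _ => forall_congr' fun T => by rw [key]

variable {P}

lemma ccoroot_neg_index_prod (f : ℂ → ℂ) (l : V × V) : open Classical in
    ∏ i with b.IsPos i, f (-ccoroot P i l) = ∏ i with ¬ b.IsPos i, f (ccoroot P i l) := by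
  classical
  refine Finset.prod_bij' (fun i _ => negIdx P i) (fun i _ => negIdx P i) ?_ ?_ ?_ ?_ ?_
  · intro i hi; simpa [isPos_negIdx P b] using hi
  · intro i hi; simpa [isPos_negIdx P b] using hi
  · intro i _; exact negIdx_negIdx P i
  · intro i _; exact negIdx_negIdx P i
  · intro i _; rw [ccoroot_negIdx]

/-- Both sides are the product of ρ over all coroots, which `w` permutes. This rewrites r(l)/r(wl)
as the opposite quotient for the negative coroots. -/
lemma rFun_mul_smul (ρ : ℂ → ℂ) (w : P.weylGroup) (l : V × V) : open Classical in
    rFun P b ρ (w • l) * ∏ i with ¬ b.IsPos i, ρ (ccoroot P i (w • l)) =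
      rFun P b ρ l * ∏ i with ¬ b.IsPos i, ρ (ccoroot P i l) := by
  classical
  rw [rFun, rFun, Finset.prod_filter_mul_prod_filter_not, Finset.prod_filter_mul_prod_filter_not]
  refine Fintype.prod_equiv (MulAction.toPerm w⁻¹) _ _ fun i => ?_
  rw [ccoroot_smul]; rfl

lemma rFun_neg (ρ : ℂ → ℂ) (l : V × V) : open Classical in
    rFun P b ρ (-l) = ∏ i with ¬ b.IsPos i, ρ (ccoroot P i l) := by
  classical
  rw [rFun, ← ccoroot_neg_index_prod]
  simp only [ccoroot_neg]

lemma rFun_ne_zero {ρ : ℂ → ℂ} {l : V × V} (h : ∀ i, ρ (ccoroot P i l) ≠ 0) : rFun P b ρ l ≠ 0 :=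
  Finset.prod_ne_zero_iff.2 fun i _ => h i

lemma sum_coset_univ {D : CosetDatum P} (hD : D.reps = Set.univ) (f : P.weylGroup → ℂ) :
    ∑ w ∈ D.coset, f w = ∑ᶠ w, f w := by
  classical
  have : Fintype P.weylGroup := Fintype.ofFinite _
  rw [finsum_eq_sum_of_fintype]
  refine Finset.sum_congr ?_ fun _ _ => rfl
  ext w
  simp [CosetDatum.coset, hD]

/-- The sign in c(-wl) replaces positive by negative coroots, and the quotient of the r's follows
suit; the sign in φ(-wl) is absorbed into the test function. -/
lemma sigma_eq (ρ : ℂ → ℂ) (φ : V × V → ℂ) {l : V × V}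
    (hl : ∀ i, ccoroot P i l ≠ 0 ∧ ρ (ccoroot P i l) ≠ 0) :
    sigma P b ρ φ l = (datSigma P b).sumF ρ (fun l => φ (-l)) l := by
  classical
  rw [sigma, CosetDatum.sumF, sum_coset_univ rfl]
  refine finsum_congr fun w => ?_
  have hw : ∀ i, ρ (ccoroot P i (w • l)) ≠ 0 := fun i => by rw [ccoroot_smul]; exact (hl _).2
  congr 1
  congr 1
  · rw [cFun]
    simp only [ccoroot_neg, Set.mem_univ, and_true]
    rw [ccoroot_neg_index_prod b (fun z => (z + 1) / z)]
    refine Finset.prod_congr ?_ fun _ _ => rfl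
    ext i; simp [CosetDatum.mem_idx, datSigma]
  · have h1 := rFun_mul_smul b ρ w l
    have hidx : (datSigma P b).posIdx = Finset.univ.filter fun i => ¬ b.IsPos i := by
      ext i; simp [CosetDatum.mem_posIdx, datSigma]
    rw [hidx, div_eq_div_iff (rFun_ne_zero b hw)
      (Finset.prod_ne_zero_iff.2 fun i _ => (hl i).2)]
    linear_combination -h1

lemma sigmaTau_eq (ρ : ℂ → ℂ) (φ : V × V → ℂ) {l : V × V}
    (hl : ∀ i, ccoroot P i l ≠ 0 ∧ ρ (ccoroot P i l) ≠ 0) :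
    sigmaTau P b ρ φ l = (datTau P b).sumF ρ φ l := by
  classical
  rw [sigmaTau, sigma, CosetDatum.sumF, sum_coset_univ rfl]
  refine finsum_congr fun w => ?_
  have hw : ∀ i, ρ (ccoroot P i (w • l)) ≠ 0 := fun i => by rw [ccoroot_smul]; exact (hl _).2
  rw [smul_neg, neg_neg]
  congr 1
  congr 1
  · have h1 := rFun_mul_smul b ρ w l
    have hidx : (datTau P b).posIdx = Finset.univ.filter fun i => b.IsPos i := by
      ext i; simp [CosetDatum.mem_posIdx, datTau]
    rw [hidx, rFun_neg, rFun_neg, div_eq_div_iff (Finset.prod_ne_zero_iff.2 fun i _ => hw i)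
      (Finset.prod_ne_zero_iff.2 fun i _ => (hl i).2)]
    unfold rFun at h1
    linear_combination -h1

lemma sigmaPrime_eq (x : P.weylGroup) (ρ : ℂ → ℂ) (φ : V × V → ℂ) (l : V × V) :
    sigmaPrime P b k x ρ φ l = (datPrime P b k x).sumF ρ φ l := by
  classical
  have : Fintype (leviWeyl P b k) := Fintype.ofFinite _
  rw [sigmaPrime, finsum_eq_sum_of_fintype, CosetDatum.sumF]
  refine Finset.sum_bij' (fun u _ => (u : P.weylGroup) * x)
    (fun w hw => ⟨w * x⁻¹, (datPrime P b k x).mem_coset.1 hw⟩) ?_ ?_ ?_ ?_ ?_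
  · intro u _
    rw [CosetDatum.mem_coset]
    change (u : P.weylGroup) * x * x⁻¹ ∈ leviWeyl P b k
    rw [mul_inv_cancel_right]; exact u.2
  · intro w _; exact Finset.mem_univ _
  · intro u _; simp
  · intro w _; simp
  · intro u _
    rfl

lemma isDenSigma_iff {L : AffineSubspace ℝ V} {T : Multiset (L → ℂ)} : IsDenSigma P b L T ↔
    IsDen P (datSigma P b).sumF (datSigma P b).pos L T :=
  isDen_congr (fun φ l => φ (-l)) (fun _ h => h.neg_arg) (fun φ => by simp)
    fun ρ φ _ hl => sigma_eq b ρ φ hl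

lemma isDenSigmaTau_iff {L : AffineSubspace ℝ V} {T : Multiset (L → ℂ)} : IsDenSigmaTau P b L T ↔
    IsDen P (datTau P b).sumF (datTau P b).pos L T :=
  isDen_congr id (fun _ h => h) (fun _ => rfl) fun ρ φ _ hl => sigmaTau_eq b ρ φ hl

lemma isDenSigmaPrime_iff {x : P.weylGroup} {L : AffineSubspace ℝ V} {T : Multiset (L → ℂ)} :
    IsDenSigmaPrime P b k x L T ↔
      IsDen P (datPrime P b k x).sumF (datPrime P b k x).pos L T :=
  isDen_congr id (fun _ h => h) (fun _ => rfl) fun ρ φ _ _ => sigmaPrime_eq b k x ρ φ _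

variable [FiniteDimensional ℝ V]

open Classical in
/-- The common form of the number of denominators of `Σ` and `Σ_τ` among given ones. -/
def envCard (H : AffineSubspace ℝ V) (A Q : Set ι) : ℕ :=
  supCard P H (Set.toFinite {w : P.weylGroup | ∀ j ∈ poleSet P H, b.IsPos (w • j)}).toFinset A
    fun w => {j | b.IsPos (w • j)} ∩ Q

lemma supCard_mono {H : AffineSubspace ℝ V} {U U' : Finset P.weylGroup} {A : Set ι}
    {B B' : P.weylGroup → Set ι} (h : ∀ w ∈ U, ∃ w' ∈ U', B' w' = B w) :
    supCard P H U A B ≤ supCard P H U' A B' := by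
  classical
  refine Multiset.card_le_card (Finset.sup_le fun w hw => ?_)
  obtain ⟨w', hw', hB⟩ := h w hw
  rw [← hB]
  exact Finset.le_sup (f := fun w => clsMS P H A - clsMS P H (B' w)) hw'

lemma affine_smul_smul (g h : P.weylGroup) (H : AffineSubspace ℝ V) : g • h • H = (g * h) • H :=
  SetLike.coe_injective (smul_smul g h (H : Set V))

lemma affine_one_smul (H : AffineSubspace ℝ V) : (1 : P.weylGroup) • H = H :=
  SetLike.coe_injective (one_smul P.weylGroup (H : Set V))

lemma mem_cls_smul {H : AffineSubspace ℝ V} (g : P.weylGroup) {i j : ι} :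
    g • j ∈ cls P (g • H) (g • i) ↔ j ∈ cls P H i := by
  have key : ∀ q : V → Prop, (∀ p ∈ g • H, q (g⁻¹ • p)) ↔ ∀ p ∈ H, q p := fun q =>
    ⟨fun h p hp => by
      have := h (g • p) (AffineSubspace.smul_mem_smul_iff.2 hp)
      rwa [inv_smul_smul] at this, fun h p hp => h _ (by
        rw [← AffineSubspace.smul_mem_smul_iff (a := g), smul_inv_smul]; exact hp)⟩
  simp only [cls, Set.mem_ofPred_eq, coroot'_smul_idx]
  exact or_congr (key fun p => P.coroot' j p = P.coroot' i p)
    (key fun p => P.coroot' j p = 1 - P.coroot' i p)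

lemma cls_smul {H : AffineSubspace ℝ V} (g : P.weylGroup) (i : ι) :
    cls P (g • H) (g • i) = g • cls P H i := by
  ext j
  rw [Set.mem_smul_set_iff_inv_smul_mem, ← mem_cls_smul (i := i) g, smul_inv_smul g j]

lemma count_clsMS_smul {H : AffineSubspace ℝ V} (g : P.weylGroup) {A A' : Set ι}
    (hA : ∀ i, i ∈ A ↔ g • i ∈ A') (c : Set ι) : open Classical in
    (clsMS P (g • H) A').count (g • c) = (clsMS P H A).count c := by
  classical
  rw [clsMS, clsMS, Multiset.count_map, Multiset.count_map, ← Finset.filter_val,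
    ← Finset.filter_val, Finset.card_val, Finset.card_val]
  refine Finset.card_bij' (fun i _ => g⁻¹ • i) (fun i _ => g • i) ?_ ?_ ?_ ?_
  · intro i hi
    simp only [Finset.mem_filter, Finset.mem_univ, true_and] at hi ⊢
    refine ⟨by rw [hA, smul_inv_smul]; exact hi.1, ?_⟩
    have := hi.2
    rw [← smul_inv_smul g i, cls_smul, smul_left_cancel_iff] at this
    exact this
  · intro i hi
    simp only [Finset.mem_filter, Finset.mem_univ, true_and] at hi ⊢
    exact ⟨(hA i).1 hi.1, by rw [cls_smul, hi.2]⟩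
  · intro i _; exact smul_inv_smul _ _
  · intro i _; exact inv_smul_smul _ _

lemma mem_poleSet_smul {H : AffineSubspace ℝ V} (g : P.weylGroup) {i : ι} :
    i ∈ poleSet P (g • H) ↔ g⁻¹ • i ∈ poleSet P H := by
  simp only [poleSet, Set.mem_ofPred_eq]
  constructor
  · intro h p hp
    rw [coroot'_smul_idx, inv_inv]
    exact h _ (AffineSubspace.smul_mem_smul_iff.2 hp)
  · intro h p hp
    have := h (g⁻¹ • p) (by
      rw [← AffineSubspace.smul_mem_smul_iff (a := g), smul_inv_smul]; exact hp)
    rwa [coroot'_smul_smul] at this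

/-- Right multiplication by `g⁻¹` matches the surviving elements on `H` with those on `g • H`, and
their contributions correspond under translation of classes by `g`. -/
lemma envCard_le_smul {H : AffineSubspace ℝ V} (g : P.weylGroup) {A A' Q Q' : Set ι}
    (hA : ∀ i, i ∈ A ↔ g • i ∈ A') (hQ : ∀ i, i ∈ Q ↔ g • i ∈ Q') :
    envCard b H A Q ≤ envCard b (g • H) A' Q' := by
  classical
  rw [envCard, supCard, envCard, supCard]
  rw [← Multiset.card_map (fun c : Set ι => g⁻¹ • c) (Finset.sup
    (Set.toFinite {w : P.weylGroup | ∀ j ∈ poleSet P (g • H), b.IsPos (w • j)}).toFinset _)]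
  refine Multiset.card_le_card (Finset.sup_le fun w hw => Multiset.le_iff_count.2 fun c => ?_)
  have hinj : Function.Injective fun c : Set ι => g⁻¹ • c := MulAction.injective g⁻¹
  have hc : c = (fun c : Set ι => g⁻¹ • c) (g • c) := (inv_smul_smul g c).symm
  nth_rewrite 2 [hc]
  rw [Multiset.count_map_eq_count' _ _ hinj]
  have hw' : w * g⁻¹ ∈ (Set.toFinite
      {w : P.weylGroup | ∀ j ∈ poleSet P (g • H), b.IsPos (w • j)}).toFinset := by
    simp only [Set.Finite.mem_toFinset, Set.mem_ofPred_eq] at hw ⊢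
    intro j hj
    rw [mul_smul]
    exact hw _ ((mem_poleSet_smul g).1 hj)
  refine le_trans ?_ (Multiset.count_le_of_le (g • c) (Finset.le_sup
    (f := fun w => clsMS P (g • H) A' - clsMS P (g • H) ({j | b.IsPos (w • j)} ∩ Q')) hw'))
  rw [Multiset.count_sub, Multiset.count_sub, count_clsMS_smul g hA, count_clsMS_smul g]
  intro i
  simp only [Set.mem_inter_iff, Set.mem_ofPred_eq, hQ, mul_smul, inv_smul_smul]

/-- The number of denominators is invariant under the Weyl group. -/
lemma envCard_smul {H : AffineSubspace ℝ V} (g : P.weylGroup) {A A' Q Q' : Set ι}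
    (hA : ∀ i, i ∈ A ↔ g • i ∈ A') (hQ : ∀ i, i ∈ Q ↔ g • i ∈ Q') :
    envCard b (g • H) A' Q' = envCard b H A Q := by
  refine le_antisymm ?_ (envCard_le_smul b g hA hQ)
  have := envCard_le_smul b (H := g • H) g⁻¹ (A := A') (A' := A) (Q := Q') (Q' := Q)
    (fun i => by rw [hA, smul_inv_smul]) (fun i => by rw [hQ, smul_inv_smul])
  rwa [affine_smul_smul, inv_mul_cancel, affine_one_smul] at this

lemma envCard_empty {H : AffineSubspace ℝ V} {A : Set ι} : envCard b H (A ∩ ∅) ∅ = 0 := by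
  classical
  rw [envCard, supCard, Multiset.card_eq_zero, ← Multiset.bot_eq_zero, eq_bot_iff]
  refine Finset.sup_le fun w _ => ?_
  simp [clsMS]

lemma exists_flip : ∃ g : P.weylGroup, ∀ i, b.IsPos (g • i) ↔ ¬ b.IsPos i := by
  obtain ⟨g, -, hg⟩ := exists_longest P b Set.univ
  refine ⟨g, fun i => ⟨fun h hi => hg i (Set.mem_univ _) hi h, fun h => ?_⟩⟩
  have := hg (negIdx P i) (Set.mem_univ _) ((isPos_negIdx P b i).2 h)
  rw [weyl_smul_negIdx, isPos_negIdx] at this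
  exact not_not.1 this

lemma CosetDatum.mem_surv (D : CosetDatum P) {H : AffineSubspace ℝ V} {w : P.weylGroup} :
    w ∈ D.surv H ↔ w ∈ D.reps ∧ ∀ j ∈ poleSet P H, w • j ∈ D.sub → w • j ∈ D.pos := by
  simp [CosetDatum.surv, CosetDatum.coset]

section

variable {H : AffineSubspace ℝ V} {p₀ : V} (hp₀ : p₀ ∈ H) (hH : zeroSet P H = ∅)
  {T : Multiset (H → ℂ)} (p : (H → ℂ) → Prop) [DecidablePred p]
  (hp : ∀ X Y, AffEquiv X Y → p X → p Y) {Q : Set ι}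
  (hQ : ∀ i, i ∈ Q ↔ i ∉ constSet P H ∧ p (corootOn P H i))

include hp₀ hH hp hQ

lemma countP_of_isDenSigmaTau (hT : IsDenSigmaTau P b H T) :
    T.countP p = envCard b H ({i | b.IsPos i} ∩ Q) Q := by
  rw [isDenSigmaTau_iff] at hT
  rw [hT.countP_eq ((datTau P b).isDen_denMS b hp₀ hH) p hp, CosetDatum.countP_denMS _ p hp hQ,
    envCard]
  congr 1
  ext w
  rw [CosetDatum.mem_surv]
  simp [datTau]

/-- Composing on the left with the element that exchanges positive and negative coroots turns the
surviving terms of Σ into those of Σ_τ, with the same subtracted sets; only the first set keeps the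
negative sign. -/
lemma countP_of_isDenSigma (hT : IsDenSigma P b H T) :
    T.countP p = envCard b H ({i | ¬ b.IsPos i} ∩ Q) Q := by
  rw [isDenSigma_iff] at hT
  rw [hT.countP_eq ((datSigma P b).isDen_denMS b hp₀ hH) p hp, CosetDatum.countP_denMS _ p hp hQ,
    envCard]
  obtain ⟨g, hg⟩ := exists_flip b
  refine le_antisymm (supCard_mono fun w hw => ⟨g * w, ?_, ?_⟩)
    (supCard_mono fun w hw => ⟨g * w, ?_, ?_⟩)
  · rw [CosetDatum.mem_surv] at hw
    simp only [Set.Finite.mem_toFinset, Set.mem_ofPred_eq, mul_smul, hg]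
    exact fun j hj => hw.2 j hj (Set.mem_univ _)
  · ext j; simp only [mul_smul, hg]; rfl
  · rw [CosetDatum.mem_surv]
    simp only [Set.Finite.mem_toFinset, Set.mem_ofPred_eq] at hw
    refine ⟨Set.mem_univ _, fun j hj _ => ?_⟩
    change ¬ b.IsPos ((g * w) • j)
    rw [mul_smul, hg, not_not]
    exact hw j hj
  · ext j
    change ¬ b.IsPos ((g * w) • j) ∧ _ ↔ _
    rw [mul_smul, hg, not_not]; rfl

/-- For `w` in W'x, survival controls the coroots that `w` sends into R'. The others are positive
already after `x`, by goodness of `H`, and W' preserves positivity outside R'. So `w` survives for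
Σ_τ too. -/
lemma countP_le_of_isDenSigmaPrime {x : P.weylGroup}
    (hx : ∀ i ∈ poleSet P H, b.IsPos (x • i) ∨ IsLevi P b k (x • i))
    (hT : IsDenSigmaPrime P b k x H T) :
    T.countP p ≤ envCard b H ({i | b.IsPos i} ∩ Q) Q := by
  rw [isDenSigmaPrime_iff] at hT
  rw [hT.countP_eq ((datPrime P b k x).isDen_denMS b hp₀ hH) p hp,
    CosetDatum.countP_denMS _ p hp hQ, envCard]
  refine supCard_mono fun w hw => ⟨w, ?_, rfl⟩
  rw [CosetDatum.mem_surv] at hw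
  simp only [Set.Finite.mem_toFinset, Set.mem_ofPred_eq]
  intro j hj
  by_cases hl : IsLevi P b k (w • j)
  · exact hw.2 j hj hl
  · have hJ : {j | j ∈ b.support ∧ j ≠ k} ⊆ (b.support : Set ι) := fun _ h => h.1
    have hu : w * x⁻¹ ∈ reflGroup P (leviSet P {j | j ∈ b.support ∧ j ≠ k}) := hw.1
    have he : w • j = (w * x⁻¹) • x • j := by rw [mul_smul, inv_smul_smul]
    have hl' : x • j ∉ leviSet P {j | j ∈ b.support ∧ j ≠ k} := fun h => hl (by
      rw [he]; exact (smul_mem_leviSet P b hJ hu).2 h)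
    rw [he, isPos_smul_of_notMem P b hJ hu hl']
    exact (hx j hj).resolve_right hl'

end

lemma exists_isDenSigma {H : AffineSubspace ℝ V} {p₀ : V} (hp₀ : p₀ ∈ H) (hH : zeroSet P H = ∅) :
    ∃ T, IsDenSigma P b H T :=
  ⟨_, (isDenSigma_iff b).2 ((datSigma P b).isDen_denMS b hp₀ hH)⟩

lemma exists_isDenSigmaTau {H : AffineSubspace ℝ V} {p₀ : V} (hp₀ : p₀ ∈ H)
    (hH : zeroSet P H = ∅) : ∃ T, IsDenSigmaTau P b H T :=
  ⟨_, (isDenSigmaTau_iff b).2 ((datTau P b).isDen_denMS b hp₀ hH)⟩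

lemma exists_isDenSigmaPrime {H : AffineSubspace ℝ V} {p₀ : V} (hp₀ : p₀ ∈ H)
    (hH : zeroSet P H = ∅) (x : P.weylGroup) : ∃ T, IsDenSigmaPrime P b k x H T :=
  ⟨_, (isDenSigmaPrime_iff b k).2 ((datPrime P b k x).isDen_denMS b hp₀ hH)⟩

end Count

/-! ### Pole spaces, centres, standard spaces and the map τ. -/

section Geometry

variable {ι V N : Type*} [Fintype ι] [AddCommGroup V] [Module ℝ V] [AddCommGroup N] [Module ℝ N]
  {P : RootPairing ι ℝ V N} [P.IsRootSystem] [P.IsCrystallographic] [P.IsReduced] (b : P.Base)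
  (k : ι) [FiniteDimensional ℝ V]

lemma mem_affine_smul {g : P.weylGroup} {H : AffineSubspace ℝ V} {p : V} :
    p ∈ g • H ↔ g⁻¹ • p ∈ H := by
  rw [← AffineSubspace.smul_mem_smul_iff (a := g) (p := g⁻¹ • p), smul_inv_smul]

lemma mem_direction_smul {g : P.weylGroup} {H : AffineSubspace ℝ V} {v : V} :
    v ∈ (g • H).direction ↔ g⁻¹ • v ∈ H.direction := by
  rw [AffineSubspace.smul_eq_map, AffineSubspace.map_direction]
  constructor
  · rintro ⟨u, hu, rfl⟩
    change g⁻¹ • g • u ∈ _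
    rw [inv_smul_smul]; exact hu
  · intro h
    exact ⟨g⁻¹ • v, h, smul_inv_smul g v⟩

lemma affine_smul_eq_iff {g : P.weylGroup} {H K : AffineSubspace ℝ V} :
    g • H = K ↔ H = g⁻¹ • K := by
  constructor
  · rintro rfl; rw [affine_smul_smul, inv_mul_cancel, affine_one_smul]
  · rintro rfl; rw [affine_smul_smul, mul_inv_cancel, affine_one_smul]

lemma finrank_direction_smul (g : P.weylGroup) (H : AffineSubspace ℝ V) :
    Module.finrank ℝ (g • H).direction = Module.finrank ℝ H.direction := by
  rw [AffineSubspace.smul_eq_map, AffineSubspace.map_direction]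
  exact (Submodule.equivMapOfInjective (DistribSMul.toLinearMap ℝ V g)
    (fun u v (h : g • u = g • v) => smul_left_cancel g h) _).finrank_eq.symm

lemma forall_mem_smul {g : P.weylGroup} {H : AffineSubspace ℝ V} {q : V → Prop} :
    (∀ p ∈ g • H, q (g⁻¹ • p)) ↔ ∀ p ∈ H, q p :=
  ⟨fun h p hp => by
    have := h (g • p) (AffineSubspace.smul_mem_smul_iff.2 hp)
    rwa [inv_smul_smul] at this, fun h p hp => h _ (mem_affine_smul.1 hp)⟩

lemma mem_constSet_smul {g : P.weylGroup} {H : AffineSubspace ℝ V} {i : ι} :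
    i ∈ constSet P (g • H) ↔ g⁻¹ • i ∈ constSet P H := by
  refine exists_congr fun c => ?_
  have := forall_mem_smul (g := g) (H := H) (q := fun p => P.coroot' (g⁻¹ • i) p = c)
  simpa only [coroot'_smul_smul] using this

lemma mem_zeroSet_smul {g : P.weylGroup} {H : AffineSubspace ℝ V} {i : ι} :
    i ∈ zeroSet P (g • H) ↔ g⁻¹ • i ∈ zeroSet P H := by
  have := forall_mem_smul (g := g) (H := H) (q := fun p => P.coroot' (g⁻¹ • i) p = 0)
  simp only [coroot'_smul_smul] at this
  exact this

lemma zeroSet_smul_eq_empty {g : P.weylGroup} {H : AffineSubspace ℝ V} (h : zeroSet P H = ∅) :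
    zeroSet P (g • H) = ∅ := by
  ext i; rw [mem_zeroSet_smul, h]; simp

lemma ncard_smul_set (g : P.weylGroup) {A A' : Set ι} (h : ∀ i, i ∈ A' ↔ g⁻¹ • i ∈ A) :
    A'.ncard = A.ncard := by
  have : A' = (fun i => g • i) '' A := by
    ext i
    rw [h]
    exact ⟨fun hi => ⟨_, hi, smul_inv_smul g i⟩, by rintro ⟨j, hj, rfl⟩; simpa using hj⟩
  rw [this, Set.ncard_image_of_injective _ (MulAction.injective g)]

lemma IsResidual.smul {L : AffineSubspace ℝ V} (h : IsResidual P L)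
    (g : P.weylGroup) : IsResidual P (g • L) := by
  refine ⟨?_, ?_⟩
  · obtain ⟨p, hp⟩ := h.1
    exact ⟨g • p, AffineSubspace.smul_mem_smul_iff.2 hp⟩
  · rw [codim, finrank_direction_smul, ncard_smul_set g fun _ => mem_zeroSet_smul,
      ncard_smul_set g fun _ => mem_poleSet_smul g]
    exact h.2

variable {b k}

lemma IsPole.smul {L : AffineSubspace ℝ V} (h : IsPole P b k L) (g : P.weylGroup) :
    IsPole P b k (g • L) := by
  obtain ⟨w, M, hM, rfl⟩ := h
  exact ⟨g * w, M, hM, affine_smul_smul _ _ _⟩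

lemma IsPole.nonempty {L : AffineSubspace ℝ V} (h : IsPole P b k L) : ∃ p, p ∈ L := by
  obtain ⟨w, M, hM, rfl⟩ := h
  obtain ⟨p, hp⟩ := hM.1
  exact ⟨w • p, AffineSubspace.smul_mem_smul_iff.2 hp⟩

/-- Up to translation by W a pole space is cut out by equations α = 1, so its direction is the
common kernel of coroots constant on it. -/
lemma IsPole.mem_direction {L : AffineSubspace ℝ V} (h : IsPole P b k L) {v : V}
    (hv : ∀ i ∈ constSet P L, P.coroot' i v = 0) : v ∈ L.direction := by
  obtain ⟨w, M, ⟨⟨p, hp⟩, -, hM⟩, rfl⟩ := h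
  rw [mem_direction_smul]
  have h1 : w⁻¹ • v + p ∈ M := by
    change _ ∈ (M : Set V)
    rw [hM]
    intro i hi
    have h2 := hv (w • i) (mem_constSet_smul.2 (by rw [inv_smul_smul]; exact ⟨1, hi.1⟩))
    rw [map_add, hi.1 p hp, coroot'_smul, inv_inv, h2, zero_add]
  have := AffineSubspace.vsub_mem_direction h1 hp
  simpa using this

lemma isPole_top : IsPole P b k ⊤ := by
  refine ⟨1, ⊤, ⟨⟨0, AffineSubspace.mem_top _ _ _⟩, ?_, ?_⟩, (affine_one_smul _).symm⟩
  · have : zeroSet P (⊤ : AffineSubspace ℝ V) = ∅ := by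
      ext i
      simp only [Set.mem_empty_iff_false, iff_false]
      intro h
      have := h (P.root i) (AffineSubspace.mem_top _ _ _)
      simp [RootPairing.coroot'] at this
    rw [this]
    rw [codim, AffineSubspace.direction_top ℝ V V, finrank_top]
    simp
  · have : poleSet P (⊤ : AffineSubspace ℝ V) = ∅ := by
      ext i
      simp only [Set.mem_empty_iff_false, iff_false]
      intro h
      have := h 0 (AffineSubspace.mem_top _ _ _)
      simp at this
    rw [this]
    simp

/-- The infima defining the multiplicities therefore never run over an empty family, where they
would be infinite. -/
lemma isGoodEnvelope_top (L : AffineSubspace ℝ V) (x : P.weylGroup) :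
    IsGoodEnvelope P b k L x ⊤ := by
  refine ⟨le_top, ⟨isPole_top, ?_⟩, fun i h => ?_⟩
  · ext i
    simp only [Set.mem_empty_iff_false, iff_false]
    intro h
    have := h (P.root i) (AffineSubspace.mem_top _ _ _)
    simp [RootPairing.coroot'] at this
  · have := h 0 (AffineSubspace.mem_top _ _ _)
    simp at this

lemma IsGoodEnvelope.smul {L H : AffineSubspace ℝ V} {x : P.weylGroup}
    (h : IsGoodEnvelope P b k L x H) (g : P.weylGroup) :
    IsGoodEnvelope P b k (g • L) (x * g⁻¹) (g • H) := by
  refine ⟨fun p hp => mem_affine_smul.2 (h.1 (mem_affine_smul.1 hp)),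
    ⟨h.2.1.1.smul g, zeroSet_smul_eq_empty h.2.1.2⟩, fun i hi => ?_⟩
  rw [mul_smul]
  exact h.2.2 _ ((mem_poleSet_smul g).1 hi)

lemma isGoodEnvelope_mul_left {L H : AffineSubspace ℝ V} {x u : P.weylGroup}
    (hu : u ∈ leviWeyl P b k) (h : IsGoodEnvelope P b k L x H) :
    IsGoodEnvelope P b k L (u * x) H := by
  refine ⟨h.1, h.2.1, fun i hi => ?_⟩
  have hJ : {j | j ∈ b.support ∧ j ≠ k} ⊆ (b.support : Set ι) := fun _ h => h.1
  have hu' : u ∈ reflGroup P (leviSet P {j | j ∈ b.support ∧ j ≠ k}) := hu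
  rw [mul_smul]
  by_cases hl : x • i ∈ leviSet P {j | j ∈ b.support ∧ j ≠ k}
  · exact Or.inr ((smul_mem_leviSet P b hJ hu').2 hl)
  · exact Or.inl ((isPos_smul_of_notMem P b hJ hu' hl).2 ((h.2.2 i hi).resolve_right hl))

/-! ### Centres -/

/-- The form is definite on the direction, so the functional given by `p` is represented by some
direction vector `u`, and `p - u` is the centre. -/
lemma isCenter_center {L : AffineSubspace ℝ V} {p : V} (hp : p ∈ L) :
    IsCenter P L (center P L) := by
  apply Classical.epsilon_spec (p := IsCenter P L)
  set B : L.direction →ₗ[ℝ] Module.Dual ℝ L.direction :=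
    (P.RootForm.domRestrict L.direction).compr₂ LinearMap.id |>.compl₂ L.direction.subtype with hB
  have hBv : ∀ u v : L.direction, B u v = P.RootForm (u : V) (v : V) := fun u v => rfl
  have hinj : Function.Injective B := by
    rw [← LinearMap.ker_eq_bot, LinearMap.ker_eq_bot']
    intro u hu
    have := LinearMap.congr_fun hu u
    rw [hBv] at this
    exact Subtype.ext (rootForm_self_eq_zero P this)
  have hsurj : Function.Surjective B :=
    (LinearMap.injective_iff_surjective_of_finrank_eq_finrank
      (Subspace.dual_finrank_eq (K := ℝ) (V := L.direction)).symm).1 hinj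
  obtain ⟨u, hu⟩ := hsurj ((P.RootForm p) ∘ₗ L.direction.subtype)
  refine ⟨p - u, ?_, fun v hv => ?_⟩
  · have := AffineSubspace.vadd_mem_of_mem_direction (neg_mem u.2) hp
    rwa [vadd_eq_add, neg_add_eq_sub] at this
  · have := LinearMap.congr_fun hu ⟨v, hv⟩
    rw [hBv] at this
    rw [map_sub, LinearMap.sub_apply, this]
    simp

lemma IsCenter.eq {L : AffineSubspace ℝ V} {c d : V} (hc : IsCenter P L c) (hd : IsCenter P L d) :
    c = d := by
  have hv : c - d ∈ L.direction := AffineSubspace.vsub_mem_direction hc.1 hd.1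
  rw [← sub_eq_zero]
  apply rootForm_self_eq_zero P
  rw [P.RootForm.map_sub, LinearMap.sub_apply, hc.2 _ hv, hd.2 _ hv, sub_zero]

lemma IsCenter.smul {L : AffineSubspace ℝ V} {c : V} (hc : IsCenter P L c) (g : P.weylGroup) :
    IsCenter P (g • L) (g • c) := by
  refine ⟨AffineSubspace.smul_mem_smul_iff.2 hc.1, fun v hv => ?_⟩
  rw [← smul_inv_smul g v, rootForm_smul_smul]
  exact hc.2 _ (mem_direction_smul.1 hv)

lemma center_smul {L : AffineSubspace ℝ V} {p : V} (hp : p ∈ L)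
    (g : P.weylGroup) : center P (g • L) = g • center P L :=
  (isCenter_center (P := P) (AffineSubspace.smul_mem_smul_iff (a := g).2 hp)).eq
    ((isCenter_center hp).smul g)

/-! ### Standard spaces -/

lemma IsStandard.exists_levi {L : AffineSubspace ℝ V} (h : IsStandard P b k L) :
    ∃ J ⊆ (b.support : Set ι), constSet P L = leviSet P J := h.2.1

lemma fixWeyl_eq {L : AffineSubspace ℝ V} : fixWeyl P L = reflGroup P (constSet P L) := rfl

lemma coroot'_eq_zero_of_direction {L : AffineSubspace ℝ V} {p : V} (hp : p ∈ L) {i : ι}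
    (hi : i ∈ constSet P L) {v : V} (hv : v ∈ L.direction) : P.coroot' i v = 0 := by
  obtain ⟨c, hc⟩ := hi
  have h := hc _ (AffineSubspace.vadd_mem_of_mem_direction hv hp)
  rw [vadd_eq_add, map_add, hc p hp] at h
  linarith

lemma fixWeyl_smul_direction {L : AffineSubspace ℝ V} {p : V} (hp : p ∈ L) {g : P.weylGroup}
    (hg : g ∈ fixWeyl P L) {v : V} (hv : v ∈ L.direction) : g • v = v :=
  reflGroup_smul_eq P (fun _ hi => coroot'_eq_zero_of_direction hp hi hv) hg

lemma fixWeyl_isPos_iff {L : AffineSubspace ℝ V} (hL : IsStandard P b k L) {g : P.weylGroup}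
    (hg : g ∈ fixWeyl P L) {i : ι} (hi : i ∉ constSet P L) : b.IsPos (g • i) ↔ b.IsPos i := by
  obtain ⟨J, hJ, hc⟩ := hL.exists_levi
  rw [fixWeyl_eq, hc] at hg
  exact isPos_smul_of_notMem P b hJ hg (hc ▸ hi)

/-- The direction of a standard space meets the interior of its positive cone. -/
lemma IsStandard.exists_direction {L : AffineSubspace ℝ V} (h : IsStandard P b k L) :
    ∃ v ∈ L.direction, ∀ i ∉ constSet P L, (b.IsPos i ↔ 0 < P.coroot' i v) := by
  obtain ⟨J, hJ, hc⟩ := h.exists_levi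
  refine ⟨wallPt P b J, h.1.mem_direction fun i hi => ?_, fun i hi => ?_⟩
  · exact (mem_leviSet_iff P b hJ).1 (hc ▸ hi)
  · exact isPos_iff_wallPt P b hJ (hc ▸ hi)

lemma exists_longest_conj {L : AffineSubspace ℝ V} {g h : P.weylGroup}
    (hh : h ∈ fixWeyl P (g • L)) : g⁻¹ * h * g ∈ fixWeyl P L := by
  induction hh using Subgroup.closure_induction with
  | mem x hx =>
    obtain ⟨i, hi, rfl⟩ := hx
    refine Subgroup.subset_closure ⟨g⁻¹ • i, mem_constSet_smul.1 hi, ?_⟩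
    rw [ofIdx_smul_idx, inv_inv]
  | one => simp [one_mem]
  | mul x y _ _ hx hy =>
    have : g⁻¹ * (x * y) * g = (g⁻¹ * x * g) * (g⁻¹ * y * g) := by group
    rw [this]; exact mul_mem hx hy
  | inv x _ hx =>
    have : g⁻¹ * x⁻¹ * g = (g⁻¹ * x * g)⁻¹ := by group
    rw [this]; exact inv_mem hx

/-! ### The map `τ` -/

lemma tau_add {L : AffineSubspace ℝ V} {p : V} (hp : p ∈ L) (q : V) {v : V} (hv : v ∈ L.direction) :
    tau P b L (v + q) = -v + tau P b L q := by
  rw [tau, tau, smul_add, fixWeyl_smul_direction hp (isLongest_longest P b L).1 hv, neg_add]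

/-- If `τ` maps one point of `L` to `L`, it is the point reflection at the centre. -/
lemma tau_eq {L : AffineSubspace ℝ V} {p : V} (hp : p ∈ L)
    (h : tau P b L p ∈ L) {q : V} (hq : q ∈ L) :
    tau P b L q = center P L + center P L - q := by
  have hc := isCenter_center (P := P) hp
  have hd : ∀ q ∈ L, tau P b L q ∈ L := fun q hq => by
    have hv : q - p ∈ L.direction := AffineSubspace.vsub_mem_direction hq hp
    have := tau_add (b := b) hp p hv
    rw [sub_add_cancel] at this
    rw [this]
    exact AffineSubspace.vadd_mem_of_mem_direction (neg_mem hv) h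
  -- The image of the centre lies in `L` and is again orthogonal to the direction, which the longest
  -- element fixes pointwise.
  have htc : tau P b L (center P L) = center P L := by
    refine IsCenter.eq (P := P) (L := L) ⟨hd _ hc.1, fun v hv => ?_⟩ hc
    have hw := fixWeyl_smul_direction hp (isLongest_longest P b L).1 hv
    nth_rewrite 1 [tau, ← hw]
    rw [map_neg, LinearMap.neg_apply, rootForm_smul_smul, hc.2 v hv, neg_zero]
  have hv : q - center P L ∈ L.direction := AffineSubspace.vsub_mem_direction hq hc.1
  have := tau_add (b := b) hp (center P L) hv
  rw [sub_add_cancel, htc] at this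
  rw [this]; abel

lemma IsStandard.longest_inv_flips {L : AffineSubspace ℝ V} (h : IsStandard P b k L) {i : ι}
    (hi : i ∈ constSet P L) (hpos : b.IsPos i) : ¬ b.IsPos ((longest P b L)⁻¹ • i) := by
  obtain ⟨J, hJ, hc⟩ := h.exists_levi
  have hl := isLongest_longest P b L
  have hl' := hl.1
  rw [fixWeyl_eq, hc] at hl'
  intro hn
  have hi' : (longest P b L)⁻¹ • i ∈ leviSet P J :=
    (smul_mem_leviSet P b hJ (inv_mem hl')).2 (hc ▸ hi)
  have := isLongest_flips P b hJ hc hl hi' hn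
  rw [smul_inv_smul] at this
  exact this hpos

/-- If `τ` preserves a standard space, it preserves all the standard spaces in the orbit. -/
lemma tau_mem_of_smul {L₀ L₁ : AffineSubspace ℝ V}
    (h₁ : IsStandard P b k L₁) {g : P.weylGroup} (hg : g • L₁ = L₀)
    {p : V} (hp : p ∈ L₀) (hτ : tau P b L₀ p ∈ L₀) : tau P b L₁ (center P L₁) ∈ L₁ := by
  subst hg
  obtain ⟨q, hq⟩ := h₁.1.nonempty
  have hc := isCenter_center (P := P) hq
  obtain ⟨J, hJ, hcst⟩ := h₁.exists_levi
  have hl := (isLongest_longest P b L₁).1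
  have h0 : tau P b (g • L₁) (g • center P L₁) = g • center P L₁ := by
    rw [← center_smul hq, tau_eq hp hτ (isCenter_center hp).1]; abel
  set w₀ := longest P b (g • L₁) with hw₀
  have hconj : g⁻¹ * w₀⁻¹ * g ∈ fixWeyl P L₁ :=
    exists_longest_conj (inv_mem (isLongest_longest P b (g • L₁)).1)
  -- The centre of `L₀` is fixed by its τ. Pulled back by `g`, this says that an element of the Weyl
  -- group of the coroots constant on `L₁` negates the centre of `L₁`.
  have h2 : (g⁻¹ * w₀⁻¹ * g) • center P L₁ = -center P L₁ := by
    rw [tau, neg_eq_iff_eq_neg, ← hw₀] at h0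
    rw [mul_smul, mul_smul, inv_smul_eq_iff, inv_smul_eq_iff, smul_neg, smul_neg, h0, neg_neg]
  have h3 : tau P b L₁ (center P L₁) =
      (longest P b L₁ * (g⁻¹ * w₀⁻¹ * g)) • center P L₁ := by
    rw [mul_smul, h2, smul_neg]; rfl
  have hmem := mul_mem hl hconj
  rw [fixWeyl_eq, hcst] at hmem
  -- The centre and its image under τ lie in one orbit of this Weyl group. Both are dominant, the
  -- image because the longest element flips the positive coroots, so they coincide.
  have h4 := smul_eq_of_dominant P b hJ hmem (v := center P L₁)
    (fun i hi hpos => h₁.2.2 i (hcst ▸ hi) hpos _ hc.1) (fun i hi hpos => by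
      rw [← h3, tau, map_neg, coroot'_smul]
      have hn := h₁.longest_inv_flips (hcst ▸ hi) hpos
      have hi2 : negIdx P ((longest P b L₁)⁻¹ • i) ∈ constSet P L₁ := by
        rw [hcst, negIdx_mem_leviSet]
        rw [fixWeyl_eq, hcst] at hl
        exact (smul_mem_leviSet P b hJ (inv_mem hl)).2 hi
      have := h₁.2.2 _ hi2 ((isPos_negIdx P b _).2 hn) _ hc.1
      rwa [coroot'_negIdx] at this)
  rw [h3, h4]
  exact hc.1

/-- An envelope of a standard space is a translate, under the reflections in the coroots constant on
the space, of a standard space. -/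
lemma IsStandard.exists_standardPair {L H : AffineSubspace ℝ V}
    (hL : IsStandard P b k L) (hLH : L ≤ H) (hH : IsPole P b k H) :
    ∃ w ∈ fixWeyl P L, ∃ H₀, IsStandardPair P b k H₀ w H := by
  classical
  obtain ⟨J, hJ, hcst⟩ := hL.exists_levi
  obtain ⟨q, hqL⟩ := hL.1.nonempty
  have hq : q ∈ H := hLH hqL
  obtain ⟨v, hv, hgen⟩ := exists_generic (H := H.direction.toAffineSubspace) (p₀ := 0)
    (by simp) (Finset.univ.image (corootAff (P := P)))
  have hv' : v ∈ H.direction := by simpa using hv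
  have hzero : ∀ i, P.coroot' i v = 0 → i ∈ constSet P H := by
    intro i hi
    refine ⟨P.coroot' i q, fun p hp => ?_⟩
    have hd : p - q ∈ H.direction := AffineSubspace.vsub_mem_direction hp hq
    have h0 := hgen _ (Finset.mem_image_of_mem _ (Finset.mem_univ i))
      (by rw [corootAff_apply, hi]; simp) (p - q) (by simpa using hd)
    rw [corootAff_apply] at h0
    have : P.coroot' i (p - q) = 0 := by exact_mod_cast h0
    rw [map_sub] at this
    linarith
  -- For `n` this large, `n • v` determines the sign of every coroot nonzero at `v`, while `q`
  -- decides for the rest. Dominance of the sum thus makes `g • v` dominant and the constant coroots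
  -- nonnegative.
  obtain ⟨n, hn⟩ : ∃ n : ℝ, 0 < n ∧ ∀ i, P.coroot' i v ≠ 0 →
      |P.coroot' i q| < n * |P.coroot' i v| := by
    refine ⟨1 + ∑ i, |P.coroot' i q| / |P.coroot' i v|, by positivity, fun i hi => ?_⟩
    rw [← div_lt_iff₀ (abs_pos.2 hi)]
    have := Finset.single_le_sum (f := fun i => |P.coroot' i q| / |P.coroot' i v|)
      (fun i _ => by positivity) (Finset.mem_univ i)
    linarith
  obtain ⟨g, hg, hdom⟩ := exists_dominant P b (leviSet P J) (n • v + q)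
  have hgL : g ∈ fixWeyl P L := by rw [fixWeyl_eq, hcst]; exact hg
  have hsub : constSet P H ⊆ leviSet P J := by
    rintro i ⟨c, hc⟩
    rw [← hcst]
    exact ⟨c, fun p hp => hc p (hLH hp)⟩
  have hnn : ∀ i ∈ leviSet P J, b.IsPos i → 0 ≤ P.coroot' i (g • v) := by
    intro i hi hpos
    by_contra! hneg
    have h1 := hdom i hi hpos
    rw [coroot'_smul] at hneg h1
    rw [map_add, map_smul, smul_eq_mul] at h1
    have h2 := hn.2 _ hneg.ne
    rw [abs_of_neg hneg] at h2
    have h3 := (abs_lt.1 h2).2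
    linarith
  have hciff : ∀ i, i ∈ constSet P (g • H) ↔ i ∈ leviSet P J ∧ P.coroot' i (g • v) = 0 := by
    intro i
    rw [mem_constSet_smul, coroot'_smul]
    constructor
    · intro h
      refine ⟨?_, coroot'_eq_zero_of_direction hq h hv'⟩
      have := hsub h
      rwa [smul_mem_leviSet P b hJ (inv_mem hg)] at this
    · exact fun h => hzero _ h.2
  refine ⟨g⁻¹, inv_mem hgL, g • H, ⟨hH.smul g, ⟨{j | j ∈ J ∧ P.coroot' j (g • v) = 0},
    fun j hj => hJ hj.1, ?_⟩, ?_⟩, ?_⟩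
  · change _ = leviSet P {j | j ∈ J ∧ P.coroot' j (g • v) = 0}
    -- The coroots vanishing at the dominant vector `g • v` are spanned by the simple ones vanishing
    -- there, since a sum of nonnegative terms is zero only termwise.
    have key : ∀ i, b.IsPos i → (i ∈ constSet P (g • H) ↔
        i ∈ leviSet P {j | j ∈ J ∧ P.coroot' j (g • v) = 0}) := by
      intro i hpos
      rw [hciff]
      constructor
      · rintro ⟨hi, hi0⟩
        obtain ⟨s, f, hs, hf, hsum⟩ := leviSet_sum P b hJ hi hpos
        have hval : ∑ j ∈ s, f j * P.coroot' j (g • v) = 0 := by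
          rw [← hi0, coroot'_eq_sum P hsum]
        have hz := (Finset.sum_eq_zero_iff_of_nonneg fun j hj => mul_nonneg (hf j)
          (hnn j (Submodule.subset_span ⟨j, hs j hj, rfl⟩)
            (b.isPos_of_mem_support (hJ (hs j hj))))).1 hval
        change P.coroot i ∈ Submodule.span ℝ (P.coroot '' {j | j ∈ J ∧ P.coroot' j (g • v) = 0})
        rw [hsum]
        refine Submodule.sum_mem _ fun j hj => ?_
        rcases mul_eq_zero.1 (hz j hj) with h | h
        · rw [h, zero_smul]; exact zero_mem _
        · exact Submodule.smul_mem _ _ (Submodule.subset_span ⟨j, ⟨hs j hj, h⟩, rfl⟩)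
      · intro hi
        exact ⟨Submodule.span_mono (Set.image_mono fun j hj => hj.1) hi,
          coroot'_eq_zero_of_mem_leviSet P hi fun j hj => hj.2⟩
    ext i
    by_cases hpos : b.IsPos i
    · exact key i hpos
    · have h1 := key (negIdx P i) ((isPos_negIdx P b i).2 hpos)
      rw [negIdx_mem_leviSet, hciff, negIdx_mem_leviSet, coroot'_negIdx, neg_eq_zero, ← hciff] at h1
      exact h1
  · intro i hi hpos p hp
    obtain ⟨hiJ, hi0⟩ := (hciff i).1 hi
    obtain ⟨c, hc⟩ := hi
    have h1 := hdom i hiJ hpos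
    rw [weyl_smul_add, weyl_smul_smul, map_add, map_smul, hi0, smul_zero, zero_add] at h1
    rw [hc p hp, ← hc (g • q) (AffineSubspace.smul_mem_smul_iff.2 hq)]
    exact h1
  · rw [affine_smul_smul, inv_mul_cancel, affine_one_smul]

end Geometry

/-! ### Positive gradients and formulas for the enveloping denominators. -/

section Functions

variable {ι V N : Type*} [Fintype ι] [AddCommGroup V] [Module ℝ V] [AddCommGroup N] [Module ℝ N]
  {P : RootPairing ι ℝ V N} [P.IsRootSystem] [P.IsCrystallographic] [P.IsReduced] {b : P.Base}
  {k : ι} [FiniteDimensional ℝ V]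

variable (P) in
/-- The coroots whose restriction to `L` is equivalent to `ν`. -/
def corootClass (L : AffineSubspace ℝ V) (ν : L → ℂ) : Set ι := {i | AffEquiv (corootOn P L i) ν}

lemma AffEquiv.one_sub {L : AffineSubspace ℝ V} {X Y : L → ℂ} (h : AffEquiv X Y) :
    AffEquiv X (1 - Y) := by
  rcases h with rfl | rfl
  · exact Or.inr (by abel)
  · exact Or.inl rfl

lemma corootClass_one_sub {L : AffineSubspace ℝ V} (ν : L → ℂ) :
    corootClass P L (1 - ν) = corootClass P L ν := by
  ext i
  refine ⟨fun h => ?_, fun h => AffEquiv.one_sub h⟩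
  have := AffEquiv.one_sub (show AffEquiv (corootOn P L i) (1 - ν) from h)
  rwa [sub_sub_cancel] at this

lemma IsAffStar.one_sub {L : AffineSubspace ℝ V} {X : L → ℂ} (h : IsAffStar X) :
    IsAffStar (1 - X) := by
  obtain ⟨⟨A, hA⟩, hc⟩ := h
  refine ⟨⟨AffineMap.const ℝ V 1 - A, fun p => ?_⟩, fun ⟨c, h⟩ => hc ⟨1 - c, fun p => ?_⟩⟩
  · rw [Pi.sub_apply, hA]; rfl
  · have := h p
    rw [Pi.sub_apply, Pi.one_apply] at this
    rw [← this]; ring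

lemma notMem_constSet_of_mem_corootClass {L : AffineSubspace ℝ V} {ν : L → ℂ} (hν : IsAffStar ν)
    {i : ι} (hi : i ∈ corootClass P L ν) : i ∉ constSet P L := by
  rintro ⟨c, hc⟩
  have h : ∀ X : L → ℂ, IsAffStar X → corootOn P L i ≠ X := by
    rintro X hX rfl
    exact hX.2 ⟨c, fun p => by rw [corootOn, hc p p.2]⟩
  exact hi.elim (h ν hν) (h _ hν.one_sub)

lemma ext_of_mem {L : AffineSubspace ℝ V} (X : L → ℂ) {v : V} (hv : v ∈ L) :
    ext X v = X ⟨v, hv⟩ := dif_pos hv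

lemma grad_apply {L : AffineSubspace ℝ V} (X : L → ℂ) (p : L) :
    grad P X p = X p - X ⟨center P L, (isCenter_center p.2).1⟩ := by
  rw [grad, ext_of_mem]

lemma grad_one_sub {L : AffineSubspace ℝ V} (X : L → ℂ) : grad P (1 - X) = -grad P X := by
  funext p
  rw [Pi.neg_apply, grad_apply, grad_apply]
  simp

lemma grad_corootOn {L : AffineSubspace ℝ V} (i : ι) (p : L) :
    grad P (corootOn P L i) p =
      ((P.coroot' i (p : V) - P.coroot' i (center P L) : ℝ) : ℂ) := by
  rw [grad_apply, corootOn, corootOn]; push_cast; rfl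

lemma grad_corootOn_negIdx {L : AffineSubspace ℝ V} (i : ι) :
    grad P (corootOn P L (negIdx P i)) = -grad P (corootOn P L i) := by
  funext p
  rw [Pi.neg_apply, grad_corootOn, grad_corootOn, coroot'_negIdx, coroot'_negIdx]
  push_cast; ring

lemma IsPosAff.of_grad_eq {L : AffineSubspace ℝ V} {X Y : L → ℂ} (hX : IsAffStar X)
    (h : grad P X = grad P Y) (hY : IsPosAff P b Y) : IsPosAff P b X :=
  ⟨hX, fun x hx => by rw [h]; exact hY.2 x hx⟩

lemma IsStandard.exists_posCone {L : AffineSubspace ℝ V} (hL : IsStandard P b k L) :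
    ∃ x ∈ posCone P b L, ∀ i ∉ constSet P L,
      (b.IsPos i ↔ 0 < P.coroot' i (x : V) - P.coroot' i (center P L)) := by
  obtain ⟨q, hq⟩ := hL.1.nonempty
  obtain ⟨v, hv, h⟩ := hL.exists_direction
  have hc := (isCenter_center (P := P) hq).1
  refine ⟨⟨v + center P L, AffineSubspace.vadd_mem_of_mem_direction hv hc⟩, fun i hi hic => ?_,
    fun i hi => ?_⟩
  · simp only [map_add]
    linarith [(h i hic).1 hi]
  · simp only [map_add, add_sub_cancel_right]
    exact h i hi

lemma isPosAff_corootOn {L : AffineSubspace ℝ V} {i : ι} (hi : i ∉ constSet P L)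
    (hpos : b.IsPos i) : IsPosAff P b (corootOn P L i) := by
  refine ⟨isAffStar_corootOn hi, fun x hx => ?_⟩
  rw [grad_corootOn, Complex.ofReal_re, Complex.ofReal_im]
  exact ⟨sub_pos.2 (hx i hpos hi), rfl⟩

/-- For standard `L` the positive cone is nonempty and contains a point at which the gradient of
each nonconstant restricted coroot has the sign of that coroot. -/
lemma isPosAff_corootOn_iff {L : AffineSubspace ℝ V} (hL : IsStandard P b k L) {i : ι}
    (hi : i ∉ constSet P L) : IsPosAff P b (corootOn P L i) ↔ b.IsPos i := by
  refine ⟨fun h => ?_, isPosAff_corootOn hi⟩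
  obtain ⟨x, hx, hxi⟩ := hL.exists_posCone
  have := (h.2 x hx).1
  rw [grad_corootOn, Complex.ofReal_re] at this
  exact (hxi i hi).2 this

lemma negIdx_mem_constSet {L : AffineSubspace ℝ V} {i : ι} :
    negIdx P i ∈ constSet P L ↔ i ∈ constSet P L := by
  constructor
  · rintro ⟨c, hc⟩
    exact ⟨-c, fun p hp => by rw [← hc p hp, coroot'_negIdx, neg_neg]⟩
  · rintro ⟨c, hc⟩
    exact ⟨-c, fun p hp => by rw [coroot'_negIdx, hc p hp]⟩

lemma isPosAff_one_sub_corootOn_iff {L : AffineSubspace ℝ V} (hL : IsStandard P b k L) {i : ι}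
    (hi : i ∉ constSet P L) : IsPosAff P b (1 - corootOn P L i) ↔ ¬ b.IsPos i := by
  rw [← isPos_negIdx P b, ← isPosAff_corootOn_iff hL (fun h => hi (negIdx_mem_constSet.1 h))]
  have hg : grad P (1 - corootOn P L i) = grad P (corootOn P L (negIdx P i)) := by
    rw [grad_one_sub, grad_corootOn_negIdx]
  exact ⟨IsPosAff.of_grad_eq (isAffStar_corootOn fun h => hi (negIdx_mem_constSet.1 h)) hg.symm,
    IsPosAff.of_grad_eq (isAffStar_corootOn hi).one_sub hg⟩

lemma IsPosAff.not_one_sub {L : AffineSubspace ℝ V} (hL : IsStandard P b k L) {X : L → ℂ}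
    (hX : IsPosAff P b X) : ¬ IsPosAff P b (1 - X) := by
  intro h
  obtain ⟨x, hx, -⟩ := hL.exists_posCone
  have h1 := (hX.2 x hx).1
  have h2 := (h.2 x hx).1
  rw [grad_one_sub, Pi.neg_apply, Complex.neg_re] at h2
  linarith

lemma IsPosAff.eq_of_mem {L : AffineSubspace ℝ V} (hL : IsStandard P b k L) {ν : L → ℂ}
    (hν : IsPosAff P b ν) {i : ι} (hi : i ∈ corootClass P L ν) :
    (ν = corootOn P L i ∧ b.IsPos i) ∨ (ν = 1 - corootOn P L i ∧ ¬ b.IsPos i) := by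
  have hic := notMem_constSet_of_mem_corootClass hν.1 hi
  rcases AffEquiv.symm hi with h | h
  · exact Or.inl ⟨h, (isPosAff_corootOn_iff hL hic).1 (h ▸ hν)⟩
  · exact Or.inr ⟨h, (isPosAff_one_sub_corootOn_iff hL hic).1 (h ▸ hν)⟩

/-! ### Restrictions -/

lemma restr_one_sub {L H : AffineSubspace ℝ V} (h : L ≤ H) (X : H → ℂ) :
    restr L (1 - X) = 1 - restr L X := by
  funext p
  simp only [restr, Pi.sub_apply, Pi.one_apply, ext_of_mem _ (h p.2)]

lemma AffEquiv.restr {L H : AffineSubspace ℝ V} (h : L ≤ H) {X Y : H → ℂ} (hXY : AffEquiv X Y) :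
    AffEquiv (restr L X) (restr L Y) := by
  rcases hXY with rfl | rfl
  · exact Or.inl rfl
  · exact Or.inr (restr_one_sub h Y)

lemma restr_corootOn {L H : AffineSubspace ℝ V} (h : L ≤ H) (i : ι) :
    restr L (corootOn P H i) = corootOn P L i := by
  funext p
  rw [restr, ext_corootOn i (h p.2)]; rfl

lemma constSet_anti {L H : AffineSubspace ℝ V} (h : L ≤ H) : constSet P H ⊆ constSet P L :=
  fun _ ⟨c, hc⟩ => ⟨c, fun p hp => hc p (h hp)⟩

/-! ### Formulas for the enveloping denominators -/

variable (b k) in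
/-- The least number of denominators on good envelopes. -/
def envInf (A : Set ι) (L : AffineSubspace ℝ V) (x : P.weylGroup) (Q : Set ι) : ℕ∞ :=
  ⨅ (H : AffineSubspace ℝ V) (_ : IsGoodEnvelope P b k L x H), (envCard b H (A ∩ Q) Q : ℕ∞)

lemma iInf_countP_eq {α : Type*} {D : Multiset α → Prop} {p : α → Prop} [DecidablePred p] {n : ℕ}
    (hex : ∃ T, D T) (h : ∀ T, D T → T.countP p = n) :
    ⨅ (T : Multiset α) (_ : D T), (T.countP p : ℕ∞) = n := by
  obtain ⟨T, hT⟩ := hex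
  exact le_antisymm (iInf₂_le_of_le T hT (by rw [h T hT])) (le_iInf₂ fun T hT => by rw [h T hT])

lemma mem_corootClass_iff {L H : AffineSubspace ℝ V} (h : L ≤ H) {ν : L → ℂ} (hν : IsAffStar ν)
    (i : ι) : i ∈ corootClass P L ν ↔
      i ∉ constSet P H ∧ AffEquiv (restr L (corootOn P H i)) ν := by
  rw [restr_corootOn h]
  exact ⟨fun hi => ⟨fun hc => notMem_constSet_of_mem_corootClass hν hi (constSet_anti h hc), hi⟩,
    And.right⟩

lemma affEquiv_restr_invariant {L H : AffineSubspace ℝ V} (h : L ≤ H) (ν : L → ℂ) (X Y : H → ℂ)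
    (hXY : AffEquiv X Y) (hX : AffEquiv (restr L X) ν) : AffEquiv (restr L Y) ν :=
  (hXY.restr h).symm.trans hX

lemma denEnv_of_pos {L : AffineSubspace ℝ V} {q : V} (hq : q ∈ L) (x : P.weylGroup) {ν : L → ℂ}
    (hν : IsPosAff P b ν) : denEnv P b k L x ν =
      envInf b k {i | ¬ b.IsPos i} L x (corootClass P L ν) := by
  classical
  rw [denEnv, if_pos hν, envMult, envInf]
  refine iInf_congr fun H => iInf_congr fun hH => ?_
  exact iInf_countP_eq (exists_isDenSigma b (hH.1 hq) hH.2.1.2) fun T hT =>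
    countP_of_isDenSigma b (hH.1 hq) hH.2.1.2 _ (affEquiv_restr_invariant hH.1 ν)
      (mem_corootClass_iff hH.1 hν.1) hT

lemma denEnv_of_not_pos {L : AffineSubspace ℝ V} {x : P.weylGroup} {ν : L → ℂ}
    (hν : ¬ IsPosAff P b ν) : denEnv P b k L x ν = 0 := by rw [denEnv, if_neg hν]

lemma denEnvPrime_le_of_pos {L : AffineSubspace ℝ V} {q : V} (hq : q ∈ L) (x : P.weylGroup)
    {ν : L → ℂ} (hν : IsPosAff P b ν) : denEnvPrime P b k L x ν ≤
      envInf b k {i | b.IsPos i} L x (corootClass P L ν) := by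
  classical
  rw [denEnvPrime, if_pos hν, envMult, envInf]
  refine iInf₂_mono fun H hH => ?_
  obtain ⟨T, hT⟩ := exists_isDenSigmaPrime b k (hH.1 hq) hH.2.1.2 x
  refine iInf₂_le_of_le T hT ?_
  exact_mod_cast countP_le_of_isDenSigmaPrime b k (hH.1 hq) hH.2.1.2 _
    (affEquiv_restr_invariant hH.1 ν) (mem_corootClass_iff hH.1 hν.1) hH.2.2 hT

lemma denEnvPrime_of_not_pos {L : AffineSubspace ℝ V} {x : P.weylGroup} {ν : L → ℂ}
    (hν : ¬ IsPosAff P b ν) : denEnvPrime P b k L x ν = 0 := by rw [denEnvPrime, if_neg hν]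

/-- Since `w` is a product of reflections in coroots constant on `L`, it preserves the signs of the
others. Positive gradient on `H₀` and on `L` are then the same condition. -/
lemma mem_corootClass_of_posAff {L H H₀ : AffineSubspace ℝ V} {w : P.weylGroup}
    (hL : IsStandard P b k L) (hLH : L ≤ H) (hw : w ∈ fixWeyl P L)
    (hH : IsStandardPair P b k H₀ w H) {ν : L → ℂ} (hν : IsAffStar ν) (i : ι) :
    (i ∉ constSet P H₀ ∧ ∃ Y, AffEquiv Y (corootOn P H₀ i) ∧ IsPosAff P b Y ∧
      ∀ p : L, ν p = ext Y (w⁻¹ • (p : V))) ↔ IsPosAff P b ν ∧ w • i ∈ corootClass P L ν := by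
  obtain ⟨hH₀, rfl⟩ := hH
  have hmem : ∀ p : L, w⁻¹ • (p : V) ∈ H₀ := fun p => mem_affine_smul.1 (hLH p.2)
  have hval : ∀ p : L, corootOn P H₀ i ⟨_, hmem p⟩ = corootOn P L (w • i) p := fun p => by
    rw [corootOn, corootOn, coroot'_smul_idx]
  constructor
  · rintro ⟨hi, Y, hY, hpos, hνY⟩
    rcases hY with rfl | rfl
    · have he : ν = corootOn P L (w • i) := funext fun p => by
        rw [hνY, ext_of_mem _ (hmem p), hval]
      have hq : w • i ∈ corootClass P L ν := Or.inl he.symm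
      have hc := notMem_constSet_of_mem_corootClass hν hq
      refine ⟨?_, hq⟩
      rw [he, isPosAff_corootOn_iff hL hc, ← fixWeyl_isPos_iff hL (inv_mem hw) hc, inv_smul_smul]
      exact (isPosAff_corootOn_iff hH₀ hi).1 hpos
    · have he : ν = 1 - corootOn P L (w • i) := funext fun p => by
        rw [hνY, ext_of_mem _ (hmem p), Pi.sub_apply, Pi.sub_apply, hval]; rfl
      have hq : w • i ∈ corootClass P L ν := Or.inr (by rw [he]; abel)
      have hc := notMem_constSet_of_mem_corootClass hν hq
      refine ⟨?_, hq⟩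
      rw [he, isPosAff_one_sub_corootOn_iff hL hc, ← fixWeyl_isPos_iff hL (inv_mem hw) hc,
        inv_smul_smul]
      exact (isPosAff_one_sub_corootOn_iff hH₀ hi).1 hpos
  · rintro ⟨hpos, hq⟩
    have hc := notMem_constSet_of_mem_corootClass hν hq
    have hi : i ∉ constSet P H₀ := fun h => hc (constSet_anti hLH
      (mem_constSet_smul.2 (by rwa [inv_smul_smul])))
    have hiff : b.IsPos (w • i) ↔ b.IsPos i := by
      rw [← fixWeyl_isPos_iff hL (inv_mem hw) hc, inv_smul_smul]
    refine ⟨hi, ?_⟩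
    rcases hpos.eq_of_mem hL hq with ⟨he, h⟩ | ⟨he, h⟩
    · refine ⟨corootOn P H₀ i, Or.inl rfl, (isPosAff_corootOn_iff hH₀ hi).2 (hiff.1 h), fun p => ?_⟩
      rw [ext_of_mem _ (hmem p), hval, he]
    · refine ⟨1 - corootOn P H₀ i, Or.inr rfl,
        (isPosAff_one_sub_corootOn_iff hH₀ hi).2 fun h' => h (hiff.2 h'), fun p => ?_⟩
      rw [ext_of_mem _ (hmem p), Pi.sub_apply, hval, he]; rfl

lemma countP_tau {L H H₀ : AffineSubspace ℝ V} {x w : P.weylGroup} (hL : IsStandard P b k L)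
    (hH : IsGoodEnvelope P b k L x H) (hw : w ∈ fixWeyl P L) (hH₀ : IsStandardPair P b k H₀ w H)
    {ν : L → ℂ} (hν : IsAffStar ν) {T : Multiset (H₀ → ℂ)} (hT : IsDenSigmaTau P b H₀ T)
    {Q : Set ι} (hQ : ∀ i, i ∈ Q ↔ IsPosAff P b ν ∧ i ∈ corootClass P L ν) : open Classical in
    T.countP (fun X => ∃ Y, AffEquiv Y X ∧ IsPosAff P b Y ∧
        ∀ p : L, ν p = ext Y (w⁻¹ • (p : V))) = envCard b H ({i | b.IsPos i} ∩ Q) Q := by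
  classical
  obtain ⟨q, hq⟩ := hH₀.1.1.nonempty
  have hz : zeroSet P H₀ = ∅ := by
    have := zeroSet_smul_eq_empty (g := w⁻¹) hH.2.1.2
    rwa [← hH₀.2, affine_smul_smul, inv_mul_cancel, affine_one_smul] at this
  rw [countP_of_isDenSigmaTau b hq hz _
    (fun X Y hXY ⟨Z, hZ, h⟩ => ⟨Z, hZ.trans hXY, h⟩) (Q := {i | w • i ∈ Q})
    (fun i => by
      rw [mem_corootClass_of_posAff hL hH.1 hw hH₀ hν i, Set.mem_ofPred_eq, hQ]) hT, ← hH₀.2]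
  symm
  refine envCard_smul b w (fun i => ?_) fun i => Iff.rfl
  refine and_congr_left fun hi => ?_
  have hc := notMem_constSet_of_mem_corootClass hν ((hQ _).1 hi).2
  have := fixWeyl_isPos_iff hL (inv_mem hw) hc
  rw [inv_smul_smul] at this
  exact this

lemma denEnvTau_of_pos {L : AffineSubspace ℝ V} (hL : IsStandard P b k L) (x : P.weylGroup)
    {ν : L → ℂ} (hν : IsPosAff P b ν) : denEnvTau P b k L x ν =
      envInf b k {i | b.IsPos i} L x (corootClass P L ν) := by
  classical
  rw [denEnvTau, if_pos hν.1, envInf]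
  refine iInf_congr fun H => iInf_congr fun hH => ?_
  obtain ⟨w₁, hw₁, H₁, hH₁⟩ := hL.exists_standardPair hH.1 hH.2.1.1
  have key : ∀ w ∈ fixWeyl P L, ∀ H₀, IsStandardPair P b k H₀ w H → ∀ T, IsDenSigmaTau P b H₀ T →
      T.countP (fun X => ∃ Y, AffEquiv Y X ∧ IsPosAff P b Y ∧
        ∀ p : L, ν p = ext Y (w⁻¹ • (p : V))) =
      envCard b H ({i | b.IsPos i} ∩ corootClass P L ν) (corootClass P L ν) :=
    fun w hw H₀ hH₀ T hT => countP_tau hL hH hw hH₀ hν.1 hT fun i => by simp [hν]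
  refine le_antisymm ?_ (le_iInf₂ fun w hw => le_iInf₂ fun H₀ hH₀ => le_iInf₂ fun T hT => ?_)
  · obtain ⟨q, hq⟩ := hH₁.1.1.nonempty
    have hz : zeroSet P H₁ = ∅ := by
      have := zeroSet_smul_eq_empty (g := w₁⁻¹) hH.2.1.2
      rwa [← hH₁.2, affine_smul_smul, inv_mul_cancel, affine_one_smul] at this
    obtain ⟨T, hT⟩ := exists_isDenSigmaTau b hq hz
    refine iInf₂_le_of_le w₁ hw₁ (iInf₂_le_of_le H₁ hH₁ (iInf₂_le_of_le T hT ?_))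
    rw [key w₁ hw₁ H₁ hH₁ T hT]
  · rw [key w hw H₀ hH₀ T hT]

/-- Positivity is imposed on `H₀` in the definition, not on `L`; the whole space as envelope already
shows that nothing else is counted. -/
lemma denEnvTau_of_not_pos {L : AffineSubspace ℝ V} (hL : IsStandard P b k L) (x : P.weylGroup)
    {ν : L → ℂ} (hν : ¬ IsPosAff P b ν) : denEnvTau P b k L x ν = 0 := by
  classical
  rw [denEnvTau]
  split_ifs with h
  · have hH : IsGoodEnvelope P b k L x ⊤ := isGoodEnvelope_top L x
    obtain ⟨w₁, hw₁, H₁, hH₁⟩ := hL.exists_standardPair hH.1 hH.2.1.1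
    obtain ⟨q, hq⟩ := hH₁.1.1.nonempty
    have hz : zeroSet P H₁ = ∅ := by
      have := zeroSet_smul_eq_empty (g := w₁⁻¹) hH.2.1.2
      rwa [← hH₁.2, affine_smul_smul, inv_mul_cancel, affine_one_smul] at this
    obtain ⟨T, hT⟩ := exists_isDenSigmaTau b hq hz
    rw [← nonpos_iff_eq_zero]
    refine iInf₂_le_of_le ⊤ hH (iInf₂_le_of_le w₁ hw₁ (iInf₂_le_of_le H₁ hH₁
      (iInf₂_le_of_le T hT ?_)))
    rw [countP_tau hL hH hw₁ hH₁ h hT (Q := ∅) (fun i => by simp [hν]), envCard_empty]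
    simp
  · rfl

end Functions

/-! ### Transport along the Weyl group, the map 1 - τ, and images of multiplicities. -/

section Transport

variable {ι V N : Type*} [Fintype ι] [AddCommGroup V] [Module ℝ V] [AddCommGroup N] [Module ℝ N]
  {P : RootPairing ι ℝ V N} [P.IsRootSystem] [P.IsCrystallographic] [P.IsReduced] {b : P.Base}
  {k : ι} [FiniteDimensional ℝ V]

/-- The image of a function on `L₁` under `g`, as a function on `L₀ = g • L₁`. -/
def push (g : P.weylGroup) {L₁ : AffineSubspace ℝ V} (L₀ : AffineSubspace ℝ V) (X : L₁ → ℂ) :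
    L₀ → ℂ := fun p => ext X (g⁻¹ • (p : V))

section Push

variable {g : P.weylGroup} {L₁ L₀ : AffineSubspace ℝ V} (hg : g • L₁ = L₀)

include hg

lemma inv_smul_mem_of_smul_eq (p : L₀) : g⁻¹ • (p : V) ∈ L₁ := by
  subst hg
  exact mem_affine_smul.1 p.2

lemma inv_smul_eq_of_smul_eq : g⁻¹ • L₀ = L₁ := (affine_smul_eq_iff.1 hg).symm

lemma push_apply (X : L₁ → ℂ) (p : L₀) :
    push g L₀ X p = X ⟨g⁻¹ • (p : V), inv_smul_mem_of_smul_eq hg p⟩ := ext_of_mem _ _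

lemma push_one_sub (X : L₁ → ℂ) : push g L₀ (1 - X) = 1 - push g L₀ X := by
  funext p
  rw [Pi.sub_apply, push_apply hg, push_apply hg]; rfl

lemma push_corootOn (i : ι) : push g L₀ (corootOn P L₁ i) = corootOn P L₀ (g • i) := by
  funext p
  rw [push_apply hg, corootOn, corootOn, coroot'_smul_idx]

lemma push_inv_push (X : L₁ → ℂ) : push g⁻¹ L₁ (push g L₀ X) = X := by
  funext p
  rw [push_apply (inv_smul_eq_of_smul_eq hg), push_apply hg]
  congr 1
  ext
  simp

lemma IsAffStar.push {X : L₁ → ℂ} (hX : IsAffStar X) : IsAffStar (push g L₀ X) := by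
  obtain ⟨⟨A, hA⟩, hc⟩ := hX
  refine ⟨⟨A.comp (DistribSMul.toLinearMap ℝ V g⁻¹).toAffineMap, fun p => ?_⟩,
    fun ⟨c, h⟩ => hc ⟨c, fun p => ?_⟩⟩
  · rw [push_apply hg, hA]; rfl
  · have h1 := congrFun (push_inv_push hg X) p
    rw [← h1, push_apply (inv_smul_eq_of_smul_eq hg), h]

lemma AffEquiv.push {X Y : L₁ → ℂ} (h : AffEquiv X Y) : AffEquiv (push g L₀ X) (push g L₀ Y) := by
  rcases h with rfl | rfl
  · exact Or.inl rfl
  · exact Or.inr (push_one_sub hg Y)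

lemma mem_corootClass_push (ν : L₁ → ℂ) (i : ι) :
    i ∈ corootClass P L₁ ν ↔ g • i ∈ corootClass P L₀ (push g L₀ ν) := by
  have hg' := inv_smul_eq_of_smul_eq hg
  constructor
  · intro h
    have := AffEquiv.push hg h
    rwa [push_corootOn hg] at this
  · intro h
    have := AffEquiv.push hg' h
    rwa [push_corootOn hg', inv_smul_smul, push_inv_push hg] at this

lemma center_eq_smul {q : V} (hq : q ∈ L₁) : center P L₀ = g • center P L₁ := by
  rw [← hg, center_smul hq]

lemma grad_push (X : L₁ → ℂ) (p : L₀) : grad P (push g L₀ X) p =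
    grad P X ⟨g⁻¹ • (p : V), inv_smul_mem_of_smul_eq hg p⟩ := by
  have hc := center_eq_smul hg (inv_smul_mem_of_smul_eq hg p)
  rw [grad_apply, grad_apply, push_apply hg, push_apply hg]
  congr 2
  ext
  simp [hc]

/-- A positive function equivalent to a coroot is sent to a positive function, or to the opposite,
according to the sign of the image of the coroot. -/
lemma posAff_push_of_mem (h₁ : IsStandard P b k L₁) (h₀ : IsStandard P b k L₀) {ν : L₁ → ℂ}
    (hν : IsPosAff P b ν) {i : ι} (hi : i ∈ corootClass P L₁ ν) :
    (IsPosAff P b (push g L₀ ν) ∧ (b.IsPos (g • i) ↔ b.IsPos i)) ∨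
      (IsPosAff P b (1 - push g L₀ ν) ∧ (b.IsPos (g • i) ↔ ¬ b.IsPos i)) := by
  have hc : g • i ∉ constSet P L₀ := by
    rw [← hg, mem_constSet_smul, inv_smul_smul]
    exact notMem_constSet_of_mem_corootClass hν.1 hi
  have h1 := isPosAff_corootOn_iff h₀ hc
  have h2 := isPosAff_one_sub_corootOn_iff h₀ hc
  rcases hν.eq_of_mem h₁ hi with ⟨rfl, h⟩ | ⟨rfl, h⟩
  · rw [push_corootOn hg, h1, h2]
    tauto
  · rw [push_one_sub hg, push_corootOn hg, sub_sub_cancel, h1, h2]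
    tauto

variable {x y : P.weylGroup} (hy : y = x * g)

include hy

lemma envInf_le_smul {A A' Q Q' : Set ι} (hA : ∀ i, i ∈ A ∩ Q ↔ g • i ∈ A' ∩ Q')
    (hQ : ∀ i, i ∈ Q ↔ g • i ∈ Q') : envInf b k A L₁ y Q ≤ envInf b k A' L₀ x Q' := by
  refine le_iInf₂ fun H hH => ?_
  have h1 : IsGoodEnvelope P b k L₁ y (g⁻¹ • H) := by
    have := hH.smul g⁻¹
    rwa [inv_smul_eq_of_smul_eq hg, inv_inv, ← hy] at this
  refine iInf₂_le_of_le _ h1 ?_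
  rw [← envCard_smul b g hA hQ, affine_smul_smul, mul_inv_cancel, affine_one_smul]

lemma envInf_smul {A A' Q Q' : Set ι} (hA : ∀ i, i ∈ A ∩ Q ↔ g • i ∈ A' ∩ Q')
    (hQ : ∀ i, i ∈ Q ↔ g • i ∈ Q') : envInf b k A L₁ y Q = envInf b k A' L₀ x Q' :=
  le_antisymm (envInf_le_smul hg hy hA hQ)
    (envInf_le_smul (inv_smul_eq_of_smul_eq hg) (by rw [hy, mul_inv_cancel_right])
      (fun i => by rw [hA, smul_inv_smul]) fun i => by rw [hQ, smul_inv_smul])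

lemma envInf_push_of_pos (h₁ : IsStandard P b k L₁) (h₀ : IsStandard P b k L₀) {ν : L₁ → ℂ}
    (hν : IsPosAff P b ν) (hp : IsPosAff P b (push g L₀ ν)) :
    envInf b k {i | ¬ b.IsPos i} L₁ y (corootClass P L₁ ν) =
      envInf b k {i | ¬ b.IsPos i} L₀ x (corootClass P L₀ (push g L₀ ν)) ∧
    envInf b k {i | b.IsPos i} L₁ y (corootClass P L₁ ν) =
      envInf b k {i | b.IsPos i} L₀ x (corootClass P L₀ (push g L₀ ν)) := by
  have key : ∀ i ∈ corootClass P L₁ ν, (b.IsPos i ↔ b.IsPos (g • i)) := fun i hi =>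
    ((posAff_push_of_mem hg h₁ h₀ hν hi).resolve_right fun h => hp.not_one_sub h₀ h.1).2.symm
  constructor <;> refine envInf_smul hg hy (fun i => ?_) (mem_corootClass_push hg ν)
  · rw [Set.mem_inter_iff, Set.mem_inter_iff, ← mem_corootClass_push hg]
    exact and_congr_left fun hi => not_congr (key i hi)
  · rw [Set.mem_inter_iff, Set.mem_inter_iff, ← mem_corootClass_push hg]
    exact and_congr_left fun hi => key i hi

/-- Here every coroot of the class changes sign under `g`, so its negative and positive members,
hence the counts for Σ and Σ_τ, trade places. -/
lemma envInf_push_of_neg (h₁ : IsStandard P b k L₁) (h₀ : IsStandard P b k L₀) {ν : L₁ → ℂ}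
    (hν : IsPosAff P b ν) (hp : IsPosAff P b (1 - push g L₀ ν)) :
    envInf b k {i | ¬ b.IsPos i} L₁ y (corootClass P L₁ ν) =
      envInf b k {i | b.IsPos i} L₀ x (corootClass P L₀ (push g L₀ ν)) ∧
    envInf b k {i | b.IsPos i} L₁ y (corootClass P L₁ ν) =
      envInf b k {i | ¬ b.IsPos i} L₀ x (corootClass P L₀ (push g L₀ ν)) := by
  have key : ∀ i ∈ corootClass P L₁ ν, (b.IsPos (g • i) ↔ ¬ b.IsPos i) := fun i hi =>
    ((posAff_push_of_mem hg h₁ h₀ hν hi).resolve_left fun h => h.1.not_one_sub h₀ hp).2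
  constructor <;> refine envInf_smul hg hy (fun i => ?_) (mem_corootClass_push hg ν)
  · rw [Set.mem_inter_iff, Set.mem_inter_iff, ← mem_corootClass_push hg]
    exact and_congr_left fun hi => (key i hi).symm
  · rw [Set.mem_inter_iff, Set.mem_inter_iff, ← mem_corootClass_push hg]
    exact and_congr_left fun hi => not_not.symm.trans (not_congr (key i hi)).symm

end Push

lemma envInf_empty (A : Set ι) (L : AffineSubspace ℝ V) (x : P.weylGroup) :
    envInf b k A L x ∅ = 0 := by
  rw [← nonpos_iff_eq_zero]
  refine iInf₂_le_of_le ⊤ (isGoodEnvelope_top L x) ?_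
  rw [envCard_empty]; simp

lemma envInf_mul_left {A Q : Set ι} {L : AffineSubspace ℝ V} {x u : P.weylGroup}
    (hu : u ∈ leviWeyl P b k) : envInf b k A L (u * x) Q = envInf b k A L x Q := by
  refine iInf_congr fun H => iInf_congr_Prop ⟨fun h => ?_, isGoodEnvelope_mul_left hu⟩ fun _ => rfl
  have := isGoodEnvelope_mul_left (inv_mem hu) h
  rwa [inv_mul_cancel_left] at this

/-! ### The map `1 - τ` -/

lemma IsAffStar.apply_reflect {L : AffineSubspace ℝ V} {X : L → ℂ} (hX : IsAffStar X) (c p q : L)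
    (hq : (q : V) = c + c - p) : X q = 2 * X c - X p := by
  obtain ⟨⟨A, hA⟩, -⟩ := hX
  rw [hA, hA, hA, hq]
  have h1 : A (p : V) = A.linear ((p : V) - c) + A c := by
    have := A.map_vadd (c : V) ((p : V) - c)
    simpa using this
  have h2 : A ((c : V) + c - p) = A.linear ((c : V) - p) + A c := by
    have := A.map_vadd (c : V) ((c : V) - p)
    rw [vadd_eq_add, vadd_eq_add] at this
    rw [← this]; congr 1; abel
  rw [h1, h2, map_sub, map_sub]; ring

section OneSubTau

variable {L : AffineSubspace ℝ V} (hτ : ∃ p ∈ L, tau P b L p ∈ L)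

include hτ

/-- For the point reflection, X∘τ = 2X(c_L) - X. Thus 1 - τ preserves the gradient and replaces the
value at the centre by 1 minus it; in particular it is an involution. -/
lemma oneSubTau_apply {X : L → ℂ} (hX : IsAffStar X) (p : L) :
    oneSubTau P b L X p = X p + (1 - 2 * X ⟨center P L, (isCenter_center p.2).1⟩) := by
  obtain ⟨q, hq, hτq⟩ := hτ
  have h := tau_eq hq hτq p.2
  have hc := (isCenter_center (P := P) hq).1
  have hm : tau P b L (p : V) ∈ L := by
    rw [h]
    have := AffineSubspace.vadd_mem_of_mem_direction (AffineSubspace.vsub_mem_direction hc p.2) hc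
    rw [vsub_eq_sub, vadd_eq_add] at this
    rwa [add_sub_right_comm]
  rw [oneSubTau, ext_of_mem _ hm, hX.apply_reflect ⟨center P L, hc⟩ p ⟨_, hm⟩ h]
  ring

lemma IsAffStar.oneSubTau {X : L → ℂ} (hX : IsAffStar X) : IsAffStar (oneSubTau P b L X) := by
  obtain ⟨q, hq, hτq⟩ := id hτ
  have h := oneSubTau_apply hτ hX
  obtain ⟨⟨A, hA⟩, hc⟩ := hX
  set d := 1 - 2 * X ⟨center P L, (isCenter_center hq).1⟩
  refine ⟨⟨A + AffineMap.const ℝ V d, fun p => ?_⟩, fun ⟨c, hc'⟩ => hc ⟨c - d, fun p => ?_⟩⟩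
  · rw [h, hA]; rfl
  · rw [← hc' p, h]; ring

lemma grad_oneSubTau {X : L → ℂ} (hX : IsAffStar X) :
    grad P (oneSubTau P b L X) = grad P X := by
  funext p
  rw [grad_apply, grad_apply, oneSubTau_apply hτ hX, oneSubTau_apply hτ hX]
  ring

lemma oneSubTau_oneSubTau {X : L → ℂ} (hX : IsAffStar X) :
    oneSubTau P b L (oneSubTau P b L X) = X := by
  funext p
  rw [oneSubTau_apply hτ (hX.oneSubTau hτ), oneSubTau_apply hτ hX, oneSubTau_apply hτ hX]
  ring

lemma oneSubTau_one_sub {X : L → ℂ} (hX : IsAffStar X) :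
    oneSubTau P b L (1 - X) = 1 - oneSubTau P b L X := by
  funext p
  rw [oneSubTau_apply hτ hX.one_sub, Pi.sub_apply (1 : L → ℂ) (oneSubTau P b L X),
    oneSubTau_apply hτ hX]
  simp only [Pi.sub_apply, Pi.one_apply]
  ring

lemma IsPosAff.oneSubTau {X : L → ℂ} (hX : IsPosAff P b X) : IsPosAff P b (oneSubTau P b L X) :=
  IsPosAff.of_grad_eq (hX.1.oneSubTau hτ) (grad_oneSubTau hτ hX.1) hX

lemma push_oneSubTau {g : P.weylGroup} {L₀ : AffineSubspace ℝ V} (hg : g • L = L₀)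
    (hτ₀ : ∃ p ∈ L₀, tau P b L₀ p ∈ L₀) {X : L → ℂ} (hX : IsAffStar X) :
    push g L₀ (oneSubTau P b L X) = oneSubTau P b L₀ (push g L₀ X) := by
  funext p
  have hc := center_eq_smul hg (inv_smul_mem_of_smul_eq hg p)
  rw [oneSubTau_apply hτ₀ (hX.push hg), push_apply hg, oneSubTau_apply hτ hX, push_apply hg,
    push_apply hg]
  congr 4
  ext
  simp [hc]

end OneSubTau

/-! ### Images of multiplicity functions -/

lemma summable_enat {α : Type*} (m : α → ℕ∞) : Summable m :=
  (hasSum_of_isLUB _ (isLUB_iSup (f := fun s : Finset α => ∑ x ∈ s, m x))).summable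

lemma image_eq_zero {α β : Type*} {f : α → β} {m : α → ℕ∞} {y : β}
    (h : ∀ x, f x = y → m x = 0) : image f m y = 0 := by
  rw [image]
  have : (fun x : {x // f x = y} => m x) = fun _ => 0 := funext fun x => h x x.2
  rw [this, tsum_zero]

lemma image_eq_single {α β : Type*} {f : α → β} {m : α → ℕ∞} {y : β} (x : α) (hx : f x = y)
    (h : ∀ x', f x' = y → m x' ≠ 0 → x' = x) : image f m y = m x := by
  rw [image, tsum_eq_single (⟨x, hx⟩ : {x // f x = y})]
  rintro ⟨x', hx'⟩ hne
  by_contra h0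
  exact hne (Subtype.ext (h x' hx' h0))

lemma eq_zero_of_image_eq_zero {α β : Type*} {f : α → β} {m : α → ℕ∞} {y : β}
    (h : image f m y = 0) (x : α) (hx : f x = y) : m x = 0 :=
  ((summable_enat _).tsum_eq_zero_iff.1 h) ⟨x, hx⟩

lemma image_oneSubTau_of_pos {L : AffineSubspace ℝ V} (hτ : ∃ p ∈ L, tau P b L p ∈ L)
    (x : P.weylGroup) {ν : L → ℂ} (hν : IsPosAff P b ν) :
    image (oneSubTau P b L) (denEnv P b k L x) ν = denEnv P b k L x (oneSubTau P b L ν) := by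
  refine image_eq_single _ (oneSubTau_oneSubTau hτ hν.1) fun X hX h0 => ?_
  have hXp : IsPosAff P b X := by
    by_contra h
    exact h0 (denEnv_of_not_pos h)
  rw [← hX, oneSubTau_oneSubTau hτ hXp.1]

lemma image_oneSubTau_of_not_pos {L : AffineSubspace ℝ V} (hτ : ∃ p ∈ L, tau P b L p ∈ L)
    (x : P.weylGroup) {ν : L → ℂ} (hν : ¬ IsPosAff P b ν) :
    image (oneSubTau P b L) (denEnv P b k L x) ν = 0 := by
  refine image_eq_zero fun X hX => ?_
  by_contra h0
  have hXp : IsPosAff P b X := by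
    by_contra h
    exact h0 (denEnv_of_not_pos h)
  exact hν (hX ▸ hXp.oneSubTau hτ)

/-- If `τ` does not preserve `L`, the `τ`-invariance forces all multiplicities to vanish. -/
lemma eq_zero_of_tau_notMem {L : AffineSubspace ℝ V} (hL : IsStandard P b k L) {x : P.weylGroup}
    (hτ : ¬ ∃ p ∈ L, tau P b L p ∈ L)
    (h : denEnvTau P b k L x = image (oneSubTau P b L) (denEnv P b k L x)) :
    denEnv P b k L x = 0 ∧ denEnvTau P b k L x = 0 := by
  push Not at hτ
  -- All evaluations fall outside `L`, where the extension by zero applies. The whole image then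
  -- sits at the constant function 1, which has no positive gradient.
  have hone : ∀ X : L → ℂ, oneSubTau P b L X = 1 := fun X => by
    funext p
    rw [oneSubTau, ext, dif_neg (hτ p p.2)]; simp
  have hnp : ¬ IsPosAff P b (1 : L → ℂ) := fun h => h.1.2 ⟨1, fun _ => rfl⟩
  have h1 := congrFun h 1
  rw [denEnvTau_of_not_pos hL x hnp] at h1
  refine ⟨funext fun X => eq_zero_of_image_eq_zero h1.symm X (hone X), funext fun ν => ?_⟩
  rw [h]
  exact image_eq_zero fun X _ => eq_zero_of_image_eq_zero h1.symm X (hone X)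

end Transport

/-! ### The map |w| and comparison of standard pairs. -/

section AbsMap

variable {ι V N : Type*} [Fintype ι] [AddCommGroup V] [Module ℝ V] [AddCommGroup N] [Module ℝ N]
  {P : RootPairing ι ℝ V N} [P.IsRootSystem] [P.IsCrystallographic] [P.IsReduced] {b : P.Base}
  {k : ι} [FiniteDimensional ℝ V]

lemma IsCorootForm.of_grad_eq {L : AffineSubspace ℝ V} {q : V} (hq : q ∈ L) {X : L → ℂ} {i : ι}
    (h : grad P X = grad P (corootOn P L i)) :
    IsCorootForm P X i (X ⟨center P L, (isCenter_center hq).1⟩) := fun p => by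
  rw [← h, grad_apply]; ring

lemma IsCorootForm.grad_eq {L : AffineSubspace ℝ V} {X : L → ℂ} {i : ι} {c : ℂ}
    (h : IsCorootForm P X i c) : grad P X = grad P (corootOn P L i) := by
  funext p
  rw [grad_apply, h p, h _, grad_apply _ (⟨center P L, _⟩ : L)]
  ring

lemma exists_isCorootForm {L : AffineSubspace ℝ V} {q : V} (hq : q ∈ L) {X : L → ℂ} {i : ι}
    (hi : i ∈ corootClass P L X) : ∃ j c, IsCorootForm P X j c := by
  rcases AffEquiv.symm hi with h | h
  · exact ⟨i, _, IsCorootForm.of_grad_eq hq (by rw [h])⟩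
  · exact ⟨negIdx P i, _, IsCorootForm.of_grad_eq hq (by
      rw [h, grad_one_sub, grad_corootOn_negIdx])⟩

lemma IsCorootForm.notMem_constSet {L : AffineSubspace ℝ V} (hL : IsStandard P b k L) {X : L → ℂ}
    (hX : IsPosAff P b X) {i : ι} {c : ℂ} (h : IsCorootForm P X i c) : i ∉ constSet P L := by
  rintro ⟨d, hd⟩
  obtain ⟨x, hx, -⟩ := hL.exists_posCone
  have := (hX.2 x hx).1
  rw [h.grad_eq, grad_corootOn, hd x x.2, hd _ (isCenter_center x.2).1] at this
  simp at this

section Push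

variable {g : P.weylGroup} {L₁ L₀ : AffineSubspace ℝ V} (hg : g • L₁ = L₀)
  (h₁ : IsStandard P b k L₁) (h₀ : IsStandard P b k L₀)

include hg h₁ h₀

lemma absMap_of_pos {X : L₁ → ℂ} (hX : IsPosAff P b X) {i : ι} (hi : i ∈ corootClass P L₁ X)
    (hp : IsPosAff P b (push g L₀ X)) : absMap P b g L₁ L₀ X = push g L₀ X := by
  obtain ⟨q, hq⟩ := h₁.1.nonempty
  have hs := ((posAff_push_of_mem hg h₁ h₀ hX hi).resolve_right fun h => hp.not_one_sub h₀ h.1).2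
  have hex : ∃ i c, IsCorootForm P X i c ∧ b.IsPos (g • i) := by
    rcases hX.eq_of_mem h₁ hi with ⟨h, hpos⟩ | ⟨h, hpos⟩
    · exact ⟨i, _, IsCorootForm.of_grad_eq hq (by rw [h]), hs.2 hpos⟩
    · refine ⟨negIdx P i, _, IsCorootForm.of_grad_eq hq (by
        rw [h, grad_one_sub, grad_corootOn_negIdx]), ?_⟩
      rw [weyl_smul_negIdx, isPos_negIdx, hs]
      exact hpos
  funext p
  rw [absMap, if_pos hex, one_mul, ext_of_mem _ (inv_smul_mem_of_smul_eq hg p),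
    ext_of_mem _ (isCenter_center hq).1, grad_apply, push_apply hg]
  ring

/-- With X = ∇ + c, the function 1 - τ turns the transported g∇ + c into g∇ + 1 - c, and subtracting
this from 1 gives -g∇ + c. -/
lemma absMap_of_neg {X : L₁ → ℂ} (hX : IsPosAff P b X) (hτ : ∃ p ∈ L₀, tau P b L₀ p ∈ L₀)
    (hp : IsPosAff P b (1 - push g L₀ X)) :
    absMap P b g L₁ L₀ X = 1 - oneSubTau P b L₀ (push g L₀ X) := by
  obtain ⟨q, hq⟩ := h₁.1.nonempty
  have hex : ¬ ∃ i c, IsCorootForm P X i c ∧ b.IsPos (g • i) := by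
    rintro ⟨i, c, hic, hpos⟩
    have hc : g • i ∉ constSet P L₀ := by
      rw [← hg, mem_constSet_smul, inv_smul_smul]
      exact hic.notMem_constSet h₁ hX
    refine (IsPosAff.of_grad_eq (hX.1.push hg) ?_ (isPosAff_corootOn hc hpos)).not_one_sub h₀ hp
    funext p
    rw [← push_corootOn hg, grad_push hg, grad_push hg, hic.grad_eq]
  funext p
  have hc := center_eq_smul hg (inv_smul_mem_of_smul_eq hg p)
  rw [absMap, if_neg hex, ext_of_mem _ (inv_smul_mem_of_smul_eq hg p),
    ext_of_mem _ (isCenter_center hq).1, grad_apply, Pi.sub_apply,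
    oneSubTau_apply hτ (hX.1.push hg), push_apply hg, push_apply hg]
  simp only [hc, inv_smul_smul, Pi.one_apply]
  ring

variable {x y : P.weylGroup} (hy : y = x * g)

include hy

/-- The `τ`-invariance is transported to the other standard pairs. -/
lemma envInf_oneSubTau_of_smul (hτ₀ : ∃ p ∈ L₀, tau P b L₀ p ∈ L₀)
    (hτ₁ : ∃ p ∈ L₁, tau P b L₁ p ∈ L₁)
    (hinv : ∀ ν, IsPosAff P b ν → envInf b k {i | b.IsPos i} L₀ x (corootClass P L₀ ν) =
      envInf b k {i | ¬ b.IsPos i} L₀ x (corootClass P L₀ (oneSubTau P b L₀ ν)))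
    {ν : L₁ → ℂ} (hν : IsPosAff P b ν) :
    envInf b k {i | b.IsPos i} L₁ y (corootClass P L₁ ν) =
      envInf b k {i | ¬ b.IsPos i} L₁ y (corootClass P L₁ (oneSubTau P b L₁ ν)) := by
  have hT := hν.oneSubTau hτ₁
  have hpush := push_oneSubTau hτ₁ hg hτ₀ hν.1
  have hsν := hν.1.push hg
  by_cases hp : IsPosAff P b (push g L₀ ν)
  · rw [(envInf_push_of_pos hg hy h₁ h₀ hν hp).2, hinv _ hp, ← hpush,
      (envInf_push_of_pos hg hy h₁ h₀ hT (hpush ▸ hp.oneSubTau hτ₀)).1]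
  · by_cases hn : IsPosAff P b (1 - push g L₀ ν)
    · have hn' := hn.oneSubTau hτ₀
      have h2 := hinv _ hn'
      rw [oneSubTau_oneSubTau hτ₀ hn.1, corootClass_one_sub, oneSubTau_one_sub hτ₀ hsν,
        corootClass_one_sub, ← hpush] at h2
      rw [oneSubTau_one_sub hτ₀ hsν, ← hpush] at hn'
      rw [(envInf_push_of_neg hg hy h₁ h₀ hν hn).2, (envInf_push_of_neg hg hy h₁ h₀ hT hn').1, h2]
    -- When neither sign of the transported function is positive, no coroot restricts to the class,
    -- and both counts are zero.
    · have e1 : corootClass P L₁ ν = ∅ := Set.eq_empty_of_forall_notMem fun i hi =>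
        (posAff_push_of_mem hg h₁ h₀ hν hi).elim (fun h => hp h.1) fun h => hn h.1
      have e2 : corootClass P L₁ (oneSubTau P b L₁ ν) = ∅ := by
        refine Set.eq_empty_of_forall_notMem fun i hi => ?_
        rcases posAff_push_of_mem hg h₁ h₀ hT hi with ⟨h, -⟩ | ⟨h, -⟩
        · rw [hpush] at h
          refine hp ?_
          rw [← oneSubTau_oneSubTau hτ₀ hsν]
          exact h.oneSubTau hτ₀
        · rw [hpush, ← oneSubTau_one_sub hτ₀ hsν] at h
          refine hn ?_
          rw [← oneSubTau_oneSubTau hτ₀ hsν.one_sub]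
          exact h.oneSubTau hτ₀
      rw [e1, e2, envInf_empty, envInf_empty]

/-- A nonzero multiplicity forces a coroot in the class, so one of the two sign cases applies. In
the negative one, transport leads to Σ_τ on `L₀` and the invariance leads back to Σ. -/
lemma denEnv_absMap (hτ₀ : ∃ p ∈ L₀, tau P b L₀ p ∈ L₀) (hτ₁ : ∃ p ∈ L₁, tau P b L₁ p ∈ L₁)
    (hinv : ∀ ν, IsPosAff P b ν → envInf b k {i | b.IsPos i} L₀ x (corootClass P L₀ ν) =
      envInf b k {i | ¬ b.IsPos i} L₀ x (corootClass P L₀ (oneSubTau P b L₀ ν)))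
    {X : L₁ → ℂ} (hX : denEnv P b k L₁ y X ≠ 0) :
    denEnv P b k L₁ y X = denEnv P b k L₀ x (absMap P b g L₁ L₀ X) ∧
      absMap P b g⁻¹ L₀ L₁ (absMap P b g L₁ L₀ X) = X := by
  obtain ⟨q₁, hq₁⟩ := h₁.1.nonempty
  obtain ⟨q₀, hq₀⟩ := h₀.1.nonempty
  have hg' := inv_smul_eq_of_smul_eq hg
  have hXp : IsPosAff P b X := by
    by_contra h
    exact hX (denEnv_of_not_pos h)
  have hsX := hXp.1.push hg
  obtain ⟨i, hi⟩ : (corootClass P L₁ X).Nonempty := by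
    by_contra! h
    rw [denEnv_of_pos hq₁ y hXp, h, envInf_empty] at hX
    exact hX rfl
  rcases posAff_push_of_mem hg h₁ h₀ hXp hi with ⟨hp, -⟩ | ⟨hn, -⟩
  · have ha := absMap_of_pos hg h₁ h₀ hXp hi hp
    have hinvX := push_inv_push hg X
    rw [ha]
    refine ⟨?_, ?_⟩
    · rw [denEnv_of_pos hq₁ y hXp, denEnv_of_pos hq₀ x hp,
        (envInf_push_of_pos hg hy h₁ h₀ hXp hp).1]
    · rw [absMap_of_pos hg' h₀ h₁ hp ((mem_corootClass_push hg X i).1 hi) (by rwa [hinvX]), hinvX]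
  · have ha := absMap_of_neg hg h₁ h₀ hXp hτ₀ hn
    have hpT := push_oneSubTau hτ₁ hg hτ₀ hXp.1
    have hZ : IsPosAff P b (1 - oneSubTau P b L₀ (push g L₀ X)) := by
      rw [← oneSubTau_one_sub hτ₀ hsX]
      exact hn.oneSubTau hτ₀
    rw [ha]
    refine ⟨?_, ?_⟩
    · have h2 := hinv _ hn
      rw [oneSubTau_one_sub hτ₀ hsX, corootClass_one_sub] at h2
      rw [denEnv_of_pos hq₁ y hXp, denEnv_of_pos hq₀ x hZ,
        (envInf_push_of_neg hg hy h₁ h₀ hXp hn).1, h2]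
    · have e : push g⁻¹ L₁ (1 - oneSubTau P b L₀ (push g L₀ X)) = 1 - oneSubTau P b L₁ X := by
        rw [← hpT, push_one_sub hg', push_inv_push hg]
      rw [absMap_of_neg hg' h₀ h₁ hZ hτ₁ (by
          rw [e, sub_sub_cancel]; exact hXp.oneSubTau hτ₁), e,
        oneSubTau_one_sub hτ₁ (hXp.1.oneSubTau hτ₁), sub_sub_cancel, oneSubTau_oneSubTau hτ₁ hXp.1]

/-- The enveloping denominators of two standard pairs representing the same space. -/
theorem denEnv_eq_image_of_smul
    (hinv : denEnvTau P b k L₀ x = image (oneSubTau P b L₀) (denEnv P b k L₀ x)) :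
    denEnv P b k L₀ x = image (absMap P b g L₁ L₀) (denEnv P b k L₁ y) ∧
      denEnvTau P b k L₁ y = image (oneSubTau P b L₁) (denEnv P b k L₁ y) := by
  obtain ⟨q₁, hq₁⟩ := h₁.1.nonempty
  obtain ⟨q₀, hq₀⟩ := h₀.1.nonempty
  have hg' := inv_smul_eq_of_smul_eq hg
  by_cases hτ₀ : ∃ p ∈ L₀, tau P b L₀ p ∈ L₀
  · have hτ₁ : ∃ p ∈ L₁, tau P b L₁ p ∈ L₁ := by
      obtain ⟨p, hp, hτp⟩ := hτ₀
      exact ⟨_, (isCenter_center (P := P) hq₁).1, tau_mem_of_smul h₁ hg hp hτp⟩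
    have hinv₀ : ∀ ν, IsPosAff P b ν → envInf b k {i | b.IsPos i} L₀ x (corootClass P L₀ ν) =
        envInf b k {i | ¬ b.IsPos i} L₀ x (corootClass P L₀ (oneSubTau P b L₀ ν)) := by
      intro ν hν
      rw [← denEnvTau_of_pos h₀ x hν, hinv, image_oneSubTau_of_pos hτ₀ x hν,
        denEnv_of_pos hq₀ x (hν.oneSubTau hτ₀)]
    have hinv₁ := fun ν (hν : IsPosAff P b ν) =>
      envInf_oneSubTau_of_smul hg h₁ h₀ hy hτ₀ hτ₁ hinv₀ (ν := ν) hν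
    have hx : x = y * g⁻¹ := by rw [hy, mul_inv_cancel_right]
    refine ⟨funext fun Z => ?_, funext fun ν => ?_⟩
    · by_cases hZ : denEnv P b k L₀ x Z = 0
      · rw [hZ, image_eq_zero]
        intro X hX
        by_contra h0
        rw [(denEnv_absMap hg h₁ h₀ hy hτ₀ hτ₁ hinv₀ h0).1, hX] at h0
        exact h0 hZ
      -- The invariance transported to `L₁` makes the situation symmetric, so |g| and |g⁻¹| are
      -- inverse bijections between the supports.
      · obtain ⟨e1, e2⟩ := denEnv_absMap hg' h₀ h₁ hx hτ₁ hτ₀ hinv₁ hZ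
        rw [inv_inv] at e2
        rw [image_eq_single _ e2, e1]
        intro X hX h0
        rw [← hX, (denEnv_absMap hg h₁ h₀ hy hτ₀ hτ₁ hinv₀ h0).2]
    · by_cases hν : IsPosAff P b ν
      · rw [denEnvTau_of_pos h₁ y hν, image_oneSubTau_of_pos hτ₁ y hν,
          denEnv_of_pos hq₁ y (hν.oneSubTau hτ₁), hinv₁ ν hν]
      · rw [denEnvTau_of_not_pos h₁ y hν, image_oneSubTau_of_not_pos hτ₁ y hν]
  · obtain ⟨z1, z2⟩ := eq_zero_of_tau_notMem h₀ hτ₀ hinv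
    have key : ∀ ν : L₁ → ℂ, IsPosAff P b ν →
        envInf b k {i | ¬ b.IsPos i} L₁ y (corootClass P L₁ ν) = 0 ∧
          envInf b k {i | b.IsPos i} L₁ y (corootClass P L₁ ν) = 0 := by
      intro ν hν
      rcases (corootClass P L₁ ν).eq_empty_or_nonempty with h | ⟨i, hi⟩
      · rw [h, envInf_empty, envInf_empty]; exact ⟨rfl, rfl⟩
      · rcases posAff_push_of_mem hg h₁ h₀ hν hi with ⟨hp, -⟩ | ⟨hn, -⟩
        · rw [(envInf_push_of_pos hg hy h₁ h₀ hν hp).1, (envInf_push_of_pos hg hy h₁ h₀ hν hp).2,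
            ← denEnv_of_pos hq₀ x hp, ← denEnvTau_of_pos h₀ x hp, z1, z2]
          exact ⟨rfl, rfl⟩
        · rw [(envInf_push_of_neg hg hy h₁ h₀ hν hn).1, (envInf_push_of_neg hg hy h₁ h₀ hν hn).2,
            ← corootClass_one_sub, ← denEnv_of_pos hq₀ x hn, ← denEnvTau_of_pos h₀ x hn, z1, z2]
          exact ⟨rfl, rfl⟩
    have y1 : denEnv P b k L₁ y = 0 := funext fun ν => by
      by_cases hν : IsPosAff P b ν
      · rw [denEnv_of_pos hq₁ y hν, (key ν hν).1]; rfl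
      · rw [denEnv_of_not_pos hν]; rfl
    have y2 : denEnvTau P b k L₁ y = 0 := funext fun ν => by
      by_cases hν : IsPosAff P b ν
      · rw [denEnvTau_of_pos h₁ y hν, (key ν hν).2]; rfl
      · rw [denEnvTau_of_not_pos h₁ y hν]; rfl
    rw [z1, y1, y2]
    exact ⟨funext fun Z => (image_eq_zero fun _ _ => rfl).symm,
      funext fun Z => (image_eq_zero fun _ _ => rfl).symm⟩

end Push

lemma denEnv_mul_left {L : AffineSubspace ℝ V} {q : V} (hq : q ∈ L) {x u : P.weylGroup}
    (hu : u ∈ leviWeyl P b k) : denEnv P b k L (u * x) = denEnv P b k L x := by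
  funext ν
  by_cases hν : IsPosAff P b ν
  · rw [denEnv_of_pos hq _ hν, denEnv_of_pos hq _ hν, envInf_mul_left hu]
  · rw [denEnv_of_not_pos hν, denEnv_of_not_pos hν]

lemma denEnvTau_mul_left {L : AffineSubspace ℝ V} (hL : IsStandard P b k L) {x u : P.weylGroup}
    (hu : u ∈ leviWeyl P b k) : denEnvTau P b k L (u * x) = denEnvTau P b k L x := by
  funext ν
  by_cases hν : IsPosAff P b ν
  · rw [denEnvTau_of_pos hL _ hν, denEnvTau_of_pos hL _ hν, envInf_mul_left hu]
  · rw [denEnvTau_of_not_pos hL _ hν, denEnvTau_of_not_pos hL _ hν]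

/-- Both sides use the same x-good envelopes, so the termwise bound from
`countP_le_of_isDenSigmaPrime` passes to the infimum. -/
lemma denEnvPrime_le_denEnvTau {L : AffineSubspace ℝ V} (hL : IsStandard P b k L)
    (x : P.weylGroup) : denEnvPrime P b k L x ≤ denEnvTau P b k L x := by
  intro ν
  obtain ⟨q, hq⟩ := hL.1.nonempty
  by_cases hν : IsPosAff P b ν
  · rw [denEnvTau_of_pos hL _ hν]
    exact denEnvPrime_le_of_pos hq x hν
  · rw [denEnvPrime_of_not_pos hν]
    exact zero_le

lemma exists_isCorootForm_of_denEnv {L : AffineSubspace ℝ V} (hL : IsStandard P b k L)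
    {x : P.weylGroup} {X : L → ℂ} (hX : denEnv P b k L x X ≠ 0) :
    ∃ i c, IsCorootForm P X i c := by
  obtain ⟨q, hq⟩ := hL.1.nonempty
  have hXp : IsPosAff P b X := by
    by_contra h
    exact hX (denEnv_of_not_pos h)
  obtain ⟨i, hi⟩ : (corootClass P L X).Nonempty := by
    by_contra! h
    rw [denEnv_of_pos hq x hXp, h, envInf_empty] at hX
    exact hX rfl
  exact exists_isCorootForm hq hi

end AbsMap

end EnvDen

end

/-! ### The theorem. -/

theorem theorem3p2 {ι V N : Type*} [Fintype ι] [AddCommGroup V] [Module ℝ V] [AddCommGroup N]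
    [Module ℝ N] (P : RootPairing ι ℝ V N) [P.IsRootSystem] [P.IsCrystallographic] [P.IsReduced]
    (b : P.Base) (k : ι) (hk : k ∈ b.support) (C : EnvDen.Cascade P b k) (hC : C.TauInvariant) :
    (∀ L : AffineSubspace ℝ V, C.Appears L → EnvDen.IsResidual P L →
      ∀ (L₀ : AffineSubspace ℝ V) (x : P.weylGroup), (L₀, x) ∈ C.SP → x • L₀ = L →
      ∀ (L₁ : AffineSubspace ℝ V) (y : P.weylGroup), EnvDen.IsStandardPair P b k L₁ y L →
        -- (a)
        ((∀ X, EnvDen.denEnv P b k L₁ y X ≠ 0 → ∃ i c, EnvDen.IsCorootForm P X i c) ∧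
          EnvDen.denEnv P b k L₀ x =
            EnvDen.image (EnvDen.absMap P b (x⁻¹ * y) L₁ L₀) (EnvDen.denEnv P b k L₁ y)) ∧
        -- (b)
        EnvDen.denEnvTau P b k L₁ y =
          EnvDen.image (EnvDen.oneSubTau P b L₁) (EnvDen.denEnv P b k L₁ y)) ∧
    -- (c)
    (∀ L : AffineSubspace ℝ V, C.Appears L → EnvDen.IsResidual P L →
      ∀ (L₁ : AffineSubspace ℝ V) (x : P.weylGroup), EnvDen.IsStandardPair P b k L₁ x L →
        EnvDen.denEnvPrime P b k L₁ x ≤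
          EnvDen.image (EnvDen.oneSubTau P b L₁) (EnvDen.denEnv P b k L₁ x)) := by
  have := EnvDen.finite_module P
  have key : ∀ L : AffineSubspace ℝ V, EnvDen.IsResidual P L →
      ∀ (L₀ : AffineSubspace ℝ V) (x : P.weylGroup), (L₀, x) ∈ C.SP → x • L₀ = L →
      ∀ (L₁ : AffineSubspace ℝ V) (y : P.weylGroup), EnvDen.IsStandardPair P b k L₁ y L →
        EnvDen.denEnv P b k L₀ x =
            EnvDen.image (EnvDen.absMap P b (x⁻¹ * y) L₁ L₀) (EnvDen.denEnv P b k L₁ y) ∧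
        EnvDen.denEnvTau P b k L₁ y =
          EnvDen.image (EnvDen.oneSubTau P b L₁) (EnvDen.denEnv P b k L₁ y) := by
    intro L hL L₀ x ⟨L', ⟨a, e, hseg⟩, hpair⟩ hx L₁ y ⟨h₁, hy⟩
    obtain ⟨⟨h₀, -⟩, u, hu, d, hud, hd⟩ := C.stdPair_spec a e L' hseg
    rw [← hpair] at h₀ hud hd
    simp only at h₀ hud hd
    subst hud
    obtain ⟨q, hq⟩ := h₀.1.nonempty
    have hres : EnvDen.IsResidual P L₀ := by
      rw [EnvDen.affine_smul_eq_iff.1 hx]; exact hL.smul _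
    have hinv := hC _ hd hres
    simp only at hinv
    -- The invariance is given for the minimal representative `d`; left multiplication by `u` in W'
    -- carries it to the chosen pair.
    rw [← EnvDen.denEnv_mul_left hq hu, ← EnvDen.denEnvTau_mul_left h₀ hu] at hinv
    refine EnvDen.denEnv_eq_image_of_smul ?_ h₁ h₀ (by rw [mul_inv_cancel_left]) hinv
    rw [← EnvDen.affine_smul_smul, hy, ← hx, EnvDen.affine_smul_smul, inv_mul_cancel,
      EnvDen.affine_one_smul]
  refine ⟨fun L _ hL L₀ x hSP hx L₁ y hy => ?_, fun L ⟨a, e, hseg⟩ hL L₁ x hx => ?_⟩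
  · obtain ⟨h1, h2⟩ := key L hL L₀ x hSP hx L₁ y hy
    exact ⟨⟨fun X hX => EnvDen.exists_isCorootForm_of_denEnv hy.1 hX, h1⟩, h2⟩
  -- Applying (b) through the pair chosen for `L` replaces the right-hand side by the multiplicities
  -- for Σ_τ.
  · rw [← (key L hL _ _ ⟨L, ⟨a, e, hseg⟩, rfl⟩ (C.stdPair_spec a e L hseg).1.2 L₁ x hx).2]
    exact EnvDen.denEnvPrime_le_denEnvTau hx.1 x
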